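/- Let $k$ be a field and $A$ a finite dimensional Hopf algebra over $k$. A Hopf bimodule over $A$ is an $A$-bimodule and $A$-bicomodule $M$ whose coactions $\delta_L: M\to A\otimes M$ and $\delta_R: M\to M\otimes A$ are bimodule maps for the diagonal actions; $\mathrm{Hom}_{A4}$ denotes morphisms of bimodules and bicomodules. Let $X$ be the algebra of Cibils and Rosso, with underlying space $(A^{*op}\otimes A^*)\otimes(A\otimes A^{op})$, in which $A^{*op}$, $A^*$ and $A \otimes A^{op}$ are subalgebras, $A^{*op}$ and $A^*$ commute, and $(a\otimes b)\,(l\otimes l')=\sum \bigl(l(S(a^{(1)})\,\cdot\,S^{-1}(b^{(1)}))\otimes l'(S^{-1}(a^{(3)})\,\cdot\,S(b^{(3)}))\bigr)\otimes(a^{(2)}\otimes b^{(2)})$ ($S$ is the antipode); a Hopf bimodule $M$ is an $X$-module through $l\cdot m=\sum l(m_{(-1)})m_{(0)}$ for $l\in A^{*op}$, $l'\cdot m=\sum l'(m_{(1)})m_{(0)}$ for $l'\in A^*$, and $(a\otimes b)\cdot m=amb$. For Hopf bimodules $M,N$ put $K^{pq}(M,N)=\mathrm{Hom}_{A4}(M\otimes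 A^{\otimes q+1},A^{\otimes p+1}\otimes N)$ ($p,q\ge 0$), where $M\otimes A^{\otimes q+1}$ has the standard actions (left on $M$, right on the last factor) and the codiagonal coactions, and $A^{\otimes p+1}\otimes N$ has the diagonal actions and the standard coactions (left on the first factor, right on $N$). Put $d_h\alpha=\alpha\circ\lambda$ and $d_c\alpha=(-1)^q\rho\circ\alpha$ with $$\lambda(m\otimes a_0\otimes\dots\otimes a_{q+1})=ma_0\otimes a_1\otimes\dots\otimes a_{q+1}+\sum_{i=0}^{q}(-1)^{i+1}m\otimes\dots\otimes a_ia_{i+1}\otimes\dots\otimes a_{q+1},$$ $$\rho=\sum_{i=0}^{p}(-1)^i\Delta_i+(-1)^{p+1}\,1^{\otimes p+1}\otimes\delta_L^N ,$$ where $\Delta_i$ applies the comultiplication to the factor number $i$ of $A^{\otimes p+1}$ (counted from $0$). Let $H^*_{A4}(M,N)$ be the cohomology of the total complex, with differential $D=d_h+d_c$. Let $N$ be a Hopf bimodule. (a) Let $0\to M'\xrightarrow{i}M\xrightarrow{p}M''\to0$ be a short exact sequence of Hopf bimodules and $n\ge 0$. For every $x\in H^n_{A4}(M',N)$ there is exactly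 one $y\in H^{n+1}_{A4}(M'',N)$ such that for some cocycles $z$ in $x$ and $c$ in $y$ and some $n$-cochain $g$ of $M$ one has $i^*g=z$ and $Dg=p^*c$. This defines the connecting maps $\delta: x\mapsto y$ of the contravariant $\delta$-functor $H^*_{A4}(-,N)$. (b) Let $Ext_X^*(-,N)$ have as connecting map of $0\to M'\to M\to M''\to0$ the Yoneda product with the class of this sequence in $Ext^1_X(M'',M')$. There is a unique family of $k$-linear maps $\varphi_M^n:H^n_{A4}(M,N)\to Ext^n_X(M,N)$, over all Hopf bimodules $M$ and all $n\ge0$, that is natural in $M$, commutes with the connecting maps, and in degree $0$ sends the class of the cocycle $\delta_L^N\circ\beta\circ\mu_R^M$ to $\beta$ for every $\beta\in\mathrm{Hom}_{A4}(M,N)$ ($\mu_R^M: M\otimes A\to M$ is the right action). Every $\varphi^n_M$ is an isomorphism. (c) Let $M$ be a Hopf bimodule. Given a $1$-cocycle $F=(F_0,F_1)$ with $F_0\in K^{01}(M,N)$ and $F_1\in K^{10}(M,N)$, put $f_0(m\otimes a)=(\varepsilon\otimes 1)F_0(m\otimes a\otimes 1)\in N$ and $f_1(m)=(\varepsilon\otimes1\otimes1)F_1(m\otimes1)\in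 A\otimes N$. Then $N\oplus M$ is a Hopf bimodule with right action and left coaction $$\begin{pmatrix}\mu_R^N&f_0\\0&\mu_R^M\end{pmatrix},\qquad\begin{pmatrix}\delta_L^N&f_1\\0&\delta_L^M\end{pmatrix}$$ and with the left action and the right coaction of the direct sum, so that $0\to N\to N\oplus M\to M\to0$ is an exact sequence of Hopf bimodules. Sending the class of $F$ to the class of this extension is a well defined isomorphism $\psi: H^1_{A4}(M,N)\to Ext^1_X(M,N)$, and $$\psi=\varphi_M^1 .$$ In particular $\psi$ commutes with the first connecting homomorphism. -/

import Mathlib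

open scoped TensorProduct
open TensorProduct Coalgebra HopfAlgebra CategoryTheory CategoryTheory.Abelian

universe u

set_option linter.unusedSectionVars false
set_option linter.unusedSimpArgs false

namespace HopfBimod


section Conv

variable {k C E : Type u} [Field k] [AddCommGroup C] [Module k C] [Coalgebra k C]
  [Ring E] [Algebra k E]

/-- Convolution product of linear maps: `c ↦ ∑ f c₁ * g c₂`. -/
noncomputable def conv (f g : C →ₗ[k] E) : C →ₗ[k] E :=
  LinearMap.mul' k E ∘ₗ map f g ∘ₗ comul

theorem conv_apply (f g : C →ₗ[k] E) (c : C) :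
    conv f g c = LinearMap.mul' k E (map f g (comul c)) := rfl

theorem conv_assoc (f g h : C →ₗ[k] E) : conv (conv f g) h = conv f (conv g h) :=
  congrArg WithConv.ofConv
    (mul_assoc (WithConv.toConv f) (WithConv.toConv g) (WithConv.toConv h))

theorem conv_unit (f : C →ₗ[k] E) : conv f (Algebra.linearMap k E ∘ₗ counit) = f :=
  congrArg WithConv.ofConv (mul_one (WithConv.toConv f))

theorem unit_conv (f : C →ₗ[k] E) : conv (Algebra.linearMap k E ∘ₗ counit) f = f :=
  congrArg WithConv.ofConv (one_mul (WithConv.toConv f))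

end Conv

section Antipode

variable {k A E : Type u} [Field k] [Ring A] [HopfAlgebra k A] [Ring E] [Algebra k E]

theorem conv_antipode (f : A →ₐ[k] E) :
    conv f.toLinearMap (f.toLinearMap ∘ₗ antipode k) = Algebra.linearMap k E ∘ₗ counit := by
  have h := LinearMap.algHom_comp_convMul_distrib f (WithConv.toConv LinearMap.id)
    (WithConv.toConv (antipode k (A := A)))
  rw [LinearMap.id_mul_antipode] at h
  refine Eq.trans h.symm ?_
  ext a
  simp

theorem antipode_conv (f : A →ₐ[k] E) :
    conv (f.toLinearMap ∘ₗ antipode k) f.toLinearMap = Algebra.linearMap k E ∘ₗ counit := by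
  have h := LinearMap.algHom_comp_convMul_distrib f (WithConv.toConv (antipode k (A := A)))
    (WithConv.toConv LinearMap.id)
  rw [LinearMap.antipode_mul_id] at h
  refine Eq.trans h.symm ?_
  ext a
  simp

/-- The two inclusions `A → A ⊗ A`. -/
noncomputable abbrev incl₁ (k A : Type u) [Field k] [Ring A] [Algebra k A] : A →ₐ[k] A ⊗[k] A :=
  Algebra.TensorProduct.includeLeft
noncomputable abbrev incl₂ (k A : Type u) [Field k] [Ring A] [Algebra k A] : A →ₐ[k] A ⊗[k] A :=
  Algebra.TensorProduct.includeRight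

theorem conv_incl : conv (incl₁ k A).toLinearMap (incl₂ k A).toLinearMap = comul := by
  ext a
  rw [conv_apply]
  generalize comul (R := k) a = t
  induction t with
  | zero =>
    simp only [LinearMap.map_zero, LinearEquiv.map_zero, zero_tmul, tmul_zero,
      LinearMap.zero_apply, mul_zero, zero_mul]
  | add x y hx hy => simp only [LinearMap.map_add, LinearEquiv.map_add, hx, hy]
  | tmul x y => simp

theorem conv_incl_antipode :
    conv ((incl₂ k A).toLinearMap ∘ₗ antipode k) ((incl₁ k A).toLinearMap ∘ₗ antipode k) =
      map (antipode k) (antipode k) ∘ₗ (TensorProduct.comm k A A).toLinearMap ∘ₗ comul := by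
  ext a
  simp only [conv_apply, LinearMap.comp_apply]
  generalize comul (R := k) a = t
  induction t with
  | zero =>
    simp only [LinearMap.map_zero, LinearEquiv.map_zero, zero_tmul, tmul_zero,
      LinearMap.zero_apply, mul_zero, zero_mul]
  | add x y hx hy => simp only [LinearMap.map_add, LinearEquiv.map_add, hx, hy]
  | tmul x y => simp

theorem comul_comp_antipode :
    comul ∘ₗ antipode k (A := A) =
      conv ((incl₂ k A).toLinearMap ∘ₗ antipode k) ((incl₁ k A).toLinearMap ∘ₗ antipode k) := by
  have h1 := antipode_conv (Bialgebra.comulAlgHom k A)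
  have h2 : conv (Bialgebra.comulAlgHom k A).toLinearMap
      (conv ((incl₂ k A).toLinearMap ∘ₗ antipode k) ((incl₁ k A).toLinearMap ∘ₗ antipode k)) =
      Algebra.linearMap k _ ∘ₗ counit := by
    have : (Bialgebra.comulAlgHom k A).toLinearMap = 
        conv (incl₁ k A).toLinearMap (incl₂ k A).toLinearMap := conv_incl.symm
    rw [this, conv_assoc, ← conv_assoc (incl₂ k A).toLinearMap, conv_antipode, unit_conv,
      conv_antipode]
  calc comul ∘ₗ antipode k (A := A) = conv ((Bialgebra.comulAlgHom k A).toLinearMap ∘ₗ antipode k)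
        (Algebra.linearMap k _ ∘ₗ counit) := by rw [conv_unit]; rfl
    _ = _ := by rw [← h2, ← conv_assoc, h1, unit_conv]

theorem comul_antipode (a : A) :
    comul (R := k) (antipode k a) =
      map (antipode k) (antipode k) (TensorProduct.comm k A A (comul (R := k) a)) := by
  have h := LinearMap.congr_fun (comul_comp_antipode (k := k) (A := A)) a
  rw [conv_incl_antipode] at h
  exact h

end Antipode

section HopfModule

variable {k A M : Type u} [Field k] [Ring A] [HopfAlgebra k A] [AddCommGroup M] [Module k M]

/-- A right Hopf module with nonzero elements contains a nonzero coinvariant, and acting on such an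
element through the antipode is injective. -/
theorem antipode_injective_of_hopfModule (ρ : M →ₗ[k] M ⊗[k] A) (r : M ⊗[k] A →ₗ[k] M)
    (h1 : ∀ m, LinearMap.rTensor A ρ (ρ m) =
      (TensorProduct.assoc k M A A).symm (LinearMap.lTensor M comul (ρ m)))
    (h2 : ∀ m, LinearMap.lTensor M counit (ρ m) = m ⊗ₜ[k] 1)
    (h3 : ∀ m a b, r (r (m ⊗ₜ a) ⊗ₜ b) = r (m ⊗ₜ (a * b)))
    (h3' : ∀ m, r (m ⊗ₜ 1) = m)
    (h4 : ∀ m a, ρ (r (m ⊗ₜ a)) =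
      map r (LinearMap.mul' k A) (tensorTensorTensorComm k M A A A (ρ m ⊗ₜ comul a)))
    (h5 : ∀ m a, antipode k a = 0 → r (m ⊗ₜ a) = 0) (m : M) (hm : m ≠ 0) :
    Function.Injective (antipode k (A := A)) := by
  let e : M →ₗ[k] M := r ∘ₗ LinearMap.lTensor M (antipode k) ∘ₗ ρ
  -- the projection onto coinvariants
  have hA : ∀ m, ρ (e m) = e m ⊗ₜ 1 := by
    intro m
    let G : (M ⊗[k] A) ⊗[k] A →ₗ[k] M ⊗[k] A := map r (LinearMap.mul' k A) ∘ₗ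
      (tensorTensorTensorComm k M A A A).toLinearMap ∘ₗ LinearMap.lTensor _ (comul ∘ₗ antipode k)
    have e1 : ∀ t, ρ (r (LinearMap.lTensor M (antipode k) t)) = G (LinearMap.rTensor A ρ t) := by
      intro t
      induction t with
      | zero =>
        simp only [LinearMap.map_zero, LinearEquiv.map_zero, zero_tmul, tmul_zero,
          LinearMap.zero_apply, mul_zero, zero_mul]
      | add x y hx hy => simp only [LinearMap.map_add, LinearEquiv.map_add, hx, hy]
      | tmul x y => simp [G, h4]
    let p : A →ₐ[k] Module.End k (M ⊗[k] A) :=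
      (Module.endTensorEndAlgHom (R := k) (S := k) (A := k) (M := M) (N := A)).comp
        (Algebra.TensorProduct.includeRight.comp (Algebra.lmul k A))
    have hp : ∀ a x y, p a (x ⊗ₜ y) = x ⊗ₜ (a * y) := fun _ _ _ => rfl
    let q : A →ₗ[k] Module.End k (M ⊗[k] A) := LinearMap.rTensorHom A ∘ₗ TensorProduct.curry 
      (r ∘ₗ (TensorProduct.comm k A M).toLinearMap)
    have e2 : ∀ t, G ((TensorProduct.assoc k M A A).symm (LinearMap.lTensor M comul t)) =
        r (LinearMap.lTensor M (antipode k) t) ⊗ₜ 1 := by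
      intro t
      induction t with
      | zero =>
        simp only [LinearMap.map_zero, LinearEquiv.map_zero, zero_tmul, tmul_zero,
          LinearMap.zero_apply, mul_zero, zero_mul]
      | add x y hx hy => simp only [LinearMap.map_add, LinearEquiv.map_add, hx, hy, add_tmul]
      | tmul x y =>
        have e3 : ∀ b : A, G ((x ⊗ₜ 1) ⊗ₜ b) =
            conv (p.toLinearMap ∘ₗ antipode k) (q ∘ₗ antipode k) b (x ⊗ₜ 1) := by
          intro b
          simp only [G, LinearMap.comp_apply, LinearMap.lTensor_tmul, comul_antipode, conv_apply]
          generalize comul (R := k) b = s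
          induction s with
          | zero =>
            simp only [LinearMap.map_zero, LinearEquiv.map_zero, zero_tmul, tmul_zero,
              LinearMap.zero_apply, mul_zero, zero_mul]
          | add x y hx hy =>
            simp only [LinearMap.map_add, LinearEquiv.map_add, hx, hy, tmul_add,
              LinearMap.add_apply]
          | tmul c d => simp [hp, q]
        have e4 : ∀ s : A ⊗[k] A, G ((TensorProduct.assoc k M A A).symm (x ⊗ₜ s)) =
            (LinearMap.mul' k _ (map p.toLinearMap
              (conv (p.toLinearMap ∘ₗ antipode k) (q ∘ₗ antipode k)) s)) (x ⊗ₜ 1) := by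
          intro s
          induction s with
          | zero =>
            simp only [LinearMap.map_zero, LinearEquiv.map_zero, zero_tmul, tmul_zero,
              LinearMap.zero_apply, mul_zero, zero_mul]
          | add x y hx hy =>
            simp only [LinearMap.map_add, LinearEquiv.map_add, hx, hy, tmul_add,
              LinearMap.add_apply]
          | tmul c d =>
            rw [TensorProduct.assoc_symm_tmul, map_tmul, LinearMap.mul'_apply,
              Module.End.mul_apply, ← e3]
            simp only [G, LinearMap.comp_apply, LinearMap.lTensor_tmul]
            generalize comul (R := k) (antipode k d) = s
            induction s with
            | zero =>
              simp only [LinearMap.map_zero, LinearEquiv.map_zero, zero_tmul, tmul_zero,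
                LinearMap.zero_apply, mul_zero, zero_mul]
            | add x y hx hy => simp only [LinearMap.map_add, LinearEquiv.map_add, hx, hy, tmul_add]
            | tmul c d => simp [hp]
        rw [LinearMap.lTensor_tmul, e4, ← conv_apply, ← conv_assoc, conv_antipode, unit_conv]
        simp [q]
    change ρ (r (LinearMap.lTensor M (antipode k) (ρ m))) = _
    rw [e1, h1, e2]; rfl
  have hB : ∃ m, e m ≠ 0 := by
    by_contra! hcon
    apply hm
    let K : (M ⊗[k] A) ⊗[k] A →ₗ[k] M :=
      r ∘ₗ LinearMap.rTensor A (r ∘ₗ LinearMap.lTensor M (antipode k))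
    have e1 : K (LinearMap.rTensor A ρ (ρ m)) = 0 := by
      have : ∀ t, K (LinearMap.rTensor A ρ t) = 0 := by
        intro t
        induction t with
        | zero =>
          simp only [LinearMap.map_zero, LinearEquiv.map_zero, zero_tmul, tmul_zero,
            LinearMap.zero_apply, mul_zero, zero_mul]
        | add x y hx hy => simp only [LinearMap.map_add, LinearEquiv.map_add, hx, hy, add_zero]
        | tmul x y =>
          have := hcon x
          simp only [e, LinearMap.comp_apply] at this
          simp [K, this]
      exact this _
    rw [h1] at e1
    have e2 : ∀ t, K ((TensorProduct.assoc k M A A).symm (LinearMap.lTensor M comul t)) =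
        TensorProduct.rid k M (LinearMap.lTensor M counit t) := by
      intro t
      induction t with
      | zero =>
        simp only [LinearMap.map_zero, LinearEquiv.map_zero, zero_tmul, tmul_zero,
          LinearMap.zero_apply, mul_zero, zero_mul]
      | add x y hx hy => simp only [LinearMap.map_add, LinearEquiv.map_add, hx, hy]
      | tmul x y =>
        have e4 : ∀ s : A ⊗[k] A, K ((TensorProduct.assoc k M A A).symm (x ⊗ₜ s)) =
            r (x ⊗ₜ (LinearMap.mul' k A (LinearMap.rTensor A (antipode k) s))) := by
          intro s
          induction s with
          | zero =>
            simp only [LinearMap.map_zero, LinearEquiv.map_zero, zero_tmul, tmul_zero,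
              LinearMap.zero_apply, mul_zero, zero_mul]
          | add x y hx hy => simp only [LinearMap.map_add, LinearEquiv.map_add, hx, hy, tmul_add]
          | tmul c d => simp [K, h3]
        rw [LinearMap.lTensor_tmul, e4, mul_antipode_rTensor_comul_apply]
        simp [Algebra.algebraMap_eq_smul_one, h3']
    rw [e2, h2] at e1
    simpa using e1
  obtain ⟨m', hm'⟩ := hB
  rw [injective_iff_map_eq_zero]
  intro a ha
  have e0 := hA m'
  set l := e m' with hl
  have e1 : map r (LinearMap.mul' k A) (tensorTensorTensorComm k M A A A ((l ⊗ₜ 1) ⊗ₜ comul a)) = 0 := by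
    rw [← e0, ← h4, h5 _ _ ha, map_zero]
  let J : A ⊗[k] A →ₗ[k] M ⊗[k] A := LinearMap.rTensor A (r ∘ₗ TensorProduct.mk k M A l)
  have e2 : ∀ s : A ⊗[k] A, map r (LinearMap.mul' k A)
      (tensorTensorTensorComm k M A A A ((l ⊗ₜ 1) ⊗ₜ s)) = J s := by
    intro s
    induction s with
    | zero =>
      simp only [LinearMap.map_zero, LinearEquiv.map_zero, zero_tmul, tmul_zero,
        LinearMap.zero_apply, mul_zero, zero_mul]
    | add x y hx hy => simp only [LinearMap.map_add, LinearEquiv.map_add, hx, hy, tmul_add]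
    | tmul c d => simp [J]
  rw [e2] at e1
  let H : M ⊗[k] A →ₗ[k] M ⊗[k] A := LinearMap.rTensor A (r ∘ₗ LinearMap.lTensor M (antipode k)) ∘ₗ
    (TensorProduct.assoc k M A A).symm.toLinearMap ∘ₗ LinearMap.lTensor M comul
  have e3 : ∀ s : A ⊗[k] A, H (J s) = J (LinearMap.mul' k _ (map (incl₁ k A).toLinearMap
      (conv ((incl₁ k A).toLinearMap ∘ₗ antipode k) (incl₂ k A).toLinearMap) s)) := by
    intro s
    induction s with
    | zero =>
      simp only [LinearMap.map_zero, LinearEquiv.map_zero, zero_tmul, tmul_zero,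
        LinearMap.zero_apply, mul_zero, zero_mul]
    | add x y hx hy => simp only [LinearMap.map_add, LinearEquiv.map_add, hx, hy]
    | tmul c d =>
      simp only [H, J, LinearMap.comp_apply, LinearMap.rTensor_tmul, LinearMap.lTensor_tmul, map_tmul,
        conv_apply, LinearMap.mul'_apply]
      generalize comul (R := k) d = s
      induction s with
      | zero =>
        simp only [LinearMap.map_zero, LinearEquiv.map_zero, zero_tmul, tmul_zero,
          LinearMap.zero_apply, mul_zero, zero_mul]
      | add x y hx hy =>
        simp only [LinearMap.map_add, LinearEquiv.map_add, hx, hy, tmul_add, mul_add]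
      | tmul c d => simp [h3]
  have e4 := e3 (comul a)
  rw [e1, ← conv_apply, ← conv_assoc, conv_antipode, unit_conv, map_zero] at e4
  have e5 : l ⊗ₜ[k] a = 0 := by simpa [J, h3'] using e4.symm
  by_contra hne
  refine hm' ((Module.forall_dual_apply_eq_zero_iff k l).1 fun g => ?_)
  have e6 := congrArg (fun t => TensorProduct.lid k A (LinearMap.rTensor A g t)) e5
  simpa [hne] using e6

end HopfModule

section Inverse

variable {k A : Type u} [Field k] [Ring A] [HopfAlgebra k A] [FiniteDimensional k A]

theorem antipode_injective : Function.Injective (antipode k (A := A)) := by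
  let θ := dualTensorHomEquiv k A A
  let θ₂ := dualTensorHomEquiv k A (A ⊗[k] A)
  -- `F f z = ∑ f z₂ • z₁`
  let F : Module.Dual k A →ₗ[k] A →ₗ[k] A :=
    LinearMap.mk₂ k (fun f z => TensorProduct.rid k A (LinearMap.lTensor A f (comul z)))
      (by intros; simp [LinearMap.lTensor_add]) (by intros; simp [LinearMap.lTensor_smul])
      (by intros; simp) (by intros; simp)
  let ρ : Module.Dual k A →ₗ[k] Module.Dual k A ⊗[k] A := θ.symm.toLinearMap ∘ₗ F
  let r : Module.Dual k A ⊗[k] A →ₗ[k] Module.Dual k A := TensorProduct.lift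
    ((LinearMap.llcomp k A A k).flip.flip.compr₂ LinearMap.id |>.compl₂
      ((LinearMap.mul k A).flip ∘ₗ antipode k))
  have hr : ∀ f a z, r (f ⊗ₜ a) z = f (z * antipode k a) := fun f a z => rfl
  have hθ : ∀ f z, θ (ρ f) z = F f z := by intro f z; simp [ρ]
  have hF : ∀ f z, F f z = TensorProduct.rid k A (LinearMap.lTensor A f (comul z)) :=
    fun f z => rfl
  refine antipode_injective_of_hopfModule ρ r ?_ ?_ ?_ ?_ ?_ ?_ (counit (R := k) (A := A)) ?_
  · -- coassociativity
    intro f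
    have key : ∀ t : Module.Dual k A ⊗[k] A, ∀ z,
        θ₂ (TensorProduct.assoc k _ A A (LinearMap.rTensor A ρ t)) z =
          LinearMap.lTensor A (θ t) (comul z) := by
      intro t z
      induction t with
      | zero => simp
      | add x y hx hy =>
        simp only [LinearMap.map_add, LinearEquiv.map_add, hx, hy, LinearMap.add_apply,
          LinearMap.lTensor_add]
      | tmul g b =>
        have h : ∀ s : Module.Dual k A ⊗[k] A,
            θ₂ (TensorProduct.assoc k _ A A (s ⊗ₜ b)) z = θ s z ⊗ₜ b := by
          intro s
          induction s with
          | zero =>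
            simp only [LinearMap.map_zero, LinearEquiv.map_zero, zero_tmul, tmul_zero,
              LinearMap.zero_apply, mul_zero, zero_mul]
          | add x y hx hy =>
            simp only [LinearMap.map_add, LinearEquiv.map_add, hx, hy, LinearMap.add_apply,
              add_tmul]
          | tmul c d => simp [θ, θ₂, smul_tmul']
        rw [LinearMap.rTensor_tmul, h, hθ, hF]
        generalize comul (R := k) z = s
        induction s with
        | zero =>
          simp only [LinearMap.map_zero, LinearEquiv.map_zero, zero_tmul, tmul_zero,
            LinearMap.zero_apply, mul_zero, zero_mul]
        | add x y hx hy => simp only [LinearMap.map_add, LinearEquiv.map_add, hx, hy, add_tmul]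
        | tmul c d => simp [θ, smul_tmul]
    have key2 : ∀ t : Module.Dual k A ⊗[k] A, ∀ z,
        θ₂ (LinearMap.lTensor _ comul t) z = comul (θ t z) := by
      intro t z
      induction t with
      | zero =>
        simp only [LinearMap.map_zero, LinearEquiv.map_zero, zero_tmul, tmul_zero,
          LinearMap.zero_apply, mul_zero, zero_mul]
      | add x y hx hy =>
        simp only [LinearMap.map_add, LinearEquiv.map_add, hx, hy, LinearMap.add_apply]
      | tmul g b => simp [θ, θ₂]
    rw [LinearEquiv.eq_symm_apply]
    apply θ₂.injective
    ext z
    rw [key, key2, hθ, hF]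
    have h : ∀ s : A ⊗[k] (A ⊗[k] A), LinearMap.lTensor A (TensorProduct.rid k A ∘ₗ
        LinearMap.lTensor A f) s = TensorProduct.rid k (A ⊗[k] A) (LinearMap.lTensor _ f
          ((TensorProduct.assoc k A A A).symm s)) := by
      intro s
      induction s with
      | zero =>
        simp only [LinearMap.map_zero, LinearEquiv.map_zero, zero_tmul, tmul_zero,
          LinearMap.zero_apply, mul_zero, zero_mul]
      | add x y hx hy => simp only [LinearMap.map_add, LinearEquiv.map_add, hx, hy]
      | tmul c s =>
        induction s with
        | zero =>
          simp only [LinearMap.map_zero, LinearEquiv.map_zero, zero_tmul, tmul_zero,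
            LinearMap.zero_apply, mul_zero, zero_mul]
        | add x y hx hy => simp only [LinearMap.map_add, LinearEquiv.map_add, hx, hy, tmul_add]
        | tmul d e => simp
    have hL : LinearMap.lTensor A (θ (ρ f)) (comul z) = LinearMap.lTensor A (TensorProduct.rid k A ∘ₗ
        LinearMap.lTensor A f) (LinearMap.lTensor A comul (comul z)) := by
      have hc : θ (ρ f) = (TensorProduct.rid k A).toLinearMap ∘ₗ LinearMap.lTensor A f ∘ₗ comul := by
        ext w
        rw [hθ, hF]; rfl
      rw [hc, ← LinearMap.comp_assoc, LinearMap.lTensor_comp]; rfl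
    rw [hL, h, coassoc_symm_apply]
    generalize comul (R := k) z = s
    induction s with
    | zero =>
      simp only [LinearMap.map_zero, LinearEquiv.map_zero, zero_tmul, tmul_zero,
        LinearMap.zero_apply, mul_zero, zero_mul]
    | add x y hx hy => simp only [LinearMap.map_add, LinearEquiv.map_add, hx, hy]
    | tmul c d => simp
  · -- counit
    intro f
    apply (TensorProduct.rid k _).injective
    ext z
    have h : ∀ t : Module.Dual k A ⊗[k] A,
        (TensorProduct.rid k _ (LinearMap.lTensor (Module.Dual k A) counit t)) z =
          counit (θ t z) := by
      intro t
      induction t with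
      | zero =>
        simp only [LinearMap.map_zero, LinearEquiv.map_zero, zero_tmul, tmul_zero,
          LinearMap.zero_apply, mul_zero, zero_mul]
      | add x y hx hy =>
        simp only [LinearMap.map_add, LinearEquiv.map_add, hx, hy, LinearMap.add_apply]
      | tmul g b => simp [θ, mul_comm]
    rw [h, hθ, hF]
    have h' : ∀ s : A ⊗[k] A, counit (R := k) (TensorProduct.rid k A (LinearMap.lTensor A f s)) =
        f (TensorProduct.lid k A (LinearMap.rTensor A counit s)) := by
      intro s
      induction s with
      | zero =>
        simp only [LinearMap.map_zero, LinearEquiv.map_zero, zero_tmul, tmul_zero,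
          LinearMap.zero_apply, mul_zero, zero_mul]
      | add x y hx hy => simp only [LinearMap.map_add, LinearEquiv.map_add, hx, hy]
      | tmul c d => simp [mul_comm]
    rw [h', rTensor_counit_comul]
    simp
  · intro f a b
    ext z
    simp [hr, antipode_mul_antidistrib, mul_assoc]
  · intro f
    ext z
    simp [hr]
  · -- compatibility
    intro f a
    apply θ.injective
    ext z
    rw [hθ, hF]
    have h : ∀ t : Module.Dual k A ⊗[k] A, ∀ s : A ⊗[k] A,
        θ (map r (LinearMap.mul' k A) (tensorTensorTensorComm k _ A A A (t ⊗ₜ s))) z =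
          LinearMap.mul' k A (map (θ t ∘ₗ LinearMap.mulLeft k z ∘ₗ antipode k) LinearMap.id s) := by
      intro t s
      induction s with
      | zero =>
        simp only [LinearMap.map_zero, LinearEquiv.map_zero, zero_tmul, tmul_zero,
          LinearMap.zero_apply, mul_zero, zero_mul]
      | add x y hx hy =>
        simp only [LinearMap.map_add, LinearEquiv.map_add, hx, hy, LinearMap.add_apply, tmul_add]
      | tmul c d =>
        induction t with
        | zero => simp
        | add x y hx hy =>
          simp only [add_tmul, map_add, hx, hy, LinearMap.add_apply, map_tmul,
            LinearMap.comp_apply, LinearMap.mul'_apply, LinearMap.id_apply]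
        | tmul g b => simp [θ, hr]
    rw [h]
    have h2 : ∀ s : A ⊗[k] A,
        LinearMap.mul' k A (map (θ (ρ f) ∘ₗ LinearMap.mulLeft k z ∘ₗ antipode k) LinearMap.id s) =
          TensorProduct.rid k A (LinearMap.lTensor A f (comul z * LinearMap.mul' k _
            (map (comul ∘ₗ antipode k) (incl₁ k A).toLinearMap s))) := by
      intro s
      induction s with
      | zero =>
        simp only [LinearMap.map_zero, LinearEquiv.map_zero, zero_tmul, tmul_zero,
          LinearMap.zero_apply, mul_zero, zero_mul]
      | add x y hx hy => simp only [LinearMap.map_add, LinearEquiv.map_add, hx, hy, mul_add]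
      | tmul c d =>
        simp only [map_tmul, LinearMap.comp_apply, LinearMap.mul'_apply, LinearMap.id_apply, hθ, hF,
          LinearMap.mulLeft_apply, Bialgebra.comul_mul, ← mul_assoc]
        generalize comul (R := k) z * comul (antipode k c) = s
        induction s with
        | zero =>
          simp only [LinearMap.map_zero, LinearEquiv.map_zero, zero_tmul, tmul_zero,
            LinearMap.zero_apply, mul_zero, zero_mul]
        | add x y hx hy => simp only [LinearMap.map_add, LinearEquiv.map_add, hx, hy, add_mul]
        | tmul c d => simp
    rw [h2, ← conv_apply, comul_comp_antipode, conv_assoc, antipode_conv, conv_unit]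
    generalize comul (R := k) z = s
    induction s with
    | zero =>
      simp only [LinearMap.map_zero, LinearEquiv.map_zero, zero_tmul, tmul_zero,
        LinearMap.zero_apply, mul_zero, zero_mul]
    | add x y hx hy => simp only [LinearMap.map_add, LinearEquiv.map_add, hx, hy, add_mul]
    | tmul c d => simp [hr]
  · intro f a ha
    ext z
    simp [hr, ha]
  · intro h
    have := LinearMap.congr_fun h 1
    simp at this

variable (k A) in
/-- The inverse `S⁻¹` of the antipode of a finite dimensional Hopf algebra. -/
noncomputable def antipodeInv : A →ₗ[k] A :=
  (LinearEquiv.ofInjectiveEndo (antipode k (A := A)) antipode_injective).symm.toLinearMap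

@[simp] theorem antipode_antipodeInv (a : A) : antipode k (antipodeInv k A a) = a :=
  (LinearEquiv.ofInjectiveEndo (antipode k (A := A)) antipode_injective).apply_symm_apply a

@[simp] theorem antipodeInv_antipode (a : A) : antipodeInv k A (antipode k a) = a :=
  (LinearEquiv.ofInjectiveEndo (antipode k (A := A)) antipode_injective).symm_apply_apply a

theorem antipodeInv_one : antipodeInv k A 1 = 1 := by
  apply antipode_injective (k := k); simp

theorem antipodeInv_mul (a b : A) :
    antipodeInv k A (a * b) = antipodeInv k A b * antipodeInv k A a := by
  apply antipode_injective (k := k); simp [antipode_mul_antidistrib]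

theorem comul_antipodeInv (a : A) :
    comul (R := k) (antipodeInv k A a) =
      map (antipodeInv k A) (antipodeInv k A) (TensorProduct.comm k A A (comul (R := k) a)) := by
  have h := comul_antipode (k := k) (antipodeInv k A a)
  rw [antipode_antipodeInv] at h
  rw [h]
  generalize comul (R := k) (antipodeInv k A a) = s
  induction s with
  | zero =>
    simp only [LinearMap.map_zero, LinearEquiv.map_zero, zero_tmul, tmul_zero,
      LinearMap.zero_apply, mul_zero, zero_mul]
  | add x y hx hy => simp only [map_add, ← hx, ← hy]
  | tmul c d => simp

/-- `∑ S⁻¹(a₂) a₁ = ε(a)` -/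
theorem antipodeInv_mul_swap (a : A) :
    LinearMap.mul' k A (TensorProduct.comm k A A
      (LinearMap.lTensor A (antipodeInv k A) (comul (R := k) a))) = algebraMap k A (counit a) := by
  apply antipode_injective (k := k)
  have h : ∀ s : A ⊗[k] A, antipode k (LinearMap.mul' k A (TensorProduct.comm k A A
      (LinearMap.lTensor A (antipodeInv k A) s))) =
      LinearMap.mul' k A (LinearMap.rTensor A (antipode k) s) := by
    intro s
    induction s with
    | zero =>
      simp only [LinearMap.map_zero, LinearEquiv.map_zero, zero_tmul, tmul_zero,
        LinearMap.zero_apply, mul_zero, zero_mul]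
    | add x y hx hy => simp only [LinearMap.map_add, LinearEquiv.map_add, hx, hy]
    | tmul c d => simp [antipode_mul_antidistrib]
  rw [h, mul_antipode_rTensor_comul_apply]
  simp [Algebra.algebraMap_eq_smul_one]

/-- `∑ a₂ S⁻¹(a₁) = ε(a)` -/
theorem mul_antipodeInv_swap (a : A) :
    LinearMap.mul' k A (TensorProduct.comm k A A
      (LinearMap.rTensor A (antipodeInv k A) (comul (R := k) a))) = algebraMap k A (counit a) := by
  apply antipode_injective (k := k)
  have h : ∀ s : A ⊗[k] A, antipode k (LinearMap.mul' k A (TensorProduct.comm k A A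
      (LinearMap.rTensor A (antipodeInv k A) s))) =
      LinearMap.mul' k A (LinearMap.lTensor A (antipode k) s) := by
    intro s
    induction s with
    | zero =>
      simp only [LinearMap.map_zero, LinearEquiv.map_zero, zero_tmul, tmul_zero,
        LinearMap.zero_apply, mul_zero, zero_mul]
    | add x y hx hy => simp only [LinearMap.map_add, LinearEquiv.map_add, hx, hy]
    | tmul c d => simp [antipode_mul_antidistrib]
  rw [h, mul_antipode_lTensor_comul_apply]
  simp [Algebra.algebraMap_eq_smul_one]

end Inverse

section Opposite

variable {k A : Type u} [Field k] [Ring A] [HopfAlgebra k A]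

/-- `Aᵒᵖ` with the multiplication reversed and the same comultiplication. -/
noncomputable instance opBialgebra : Bialgebra k Aᵐᵒᵖ :=
  Bialgebra.mk' k Aᵐᵒᵖ
    (by simp [MulOpposite.counit_def])
    (by intro a b; simp [MulOpposite.counit_def, Bialgebra.counit_mul, mul_comm])
    (by simp [MulOpposite.comul_def, Algebra.TensorProduct.one_def])
    (by
      intro a b
      simp only [MulOpposite.comul_def, LinearMap.comp_apply, LinearEquiv.coe_coe,
        MulOpposite.coe_opLinearEquiv_symm, MulOpposite.unop_mul, Bialgebra.comul_mul]
      generalize comul (R := k) a.unop = s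
      generalize comul (R := k) b.unop = t
      induction s with
      | zero =>
        simp only [LinearMap.map_zero, LinearEquiv.map_zero, zero_tmul, tmul_zero,
          LinearMap.zero_apply, mul_zero, zero_mul]
      | add x y hx hy =>
        simp only [LinearMap.map_add, LinearEquiv.map_add, hx, hy, add_mul, mul_add]
      | tmul c d =>
        induction t with
        | zero =>
          simp only [LinearMap.map_zero, LinearEquiv.map_zero, zero_tmul, tmul_zero,
            LinearMap.zero_apply, mul_zero, zero_mul]
        | add x y hx hy =>
          simp only [LinearMap.map_add, LinearEquiv.map_add, hx, hy, add_mul, mul_add]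
        | tmul e f => simp)

/-- The antipode of `Aᵒᵖ` is `S⁻¹`. -/
noncomputable instance opHopfAlgebra [FiniteDimensional k A] : HopfAlgebra k Aᵐᵒᵖ where
  antipode := (MulOpposite.opLinearEquiv k).toLinearMap ∘ₗ antipodeInv k A ∘ₗ
    (MulOpposite.opLinearEquiv k).symm.toLinearMap
  mul_antipode_rTensor_comul := by
    ext a
    have h := congrArg MulOpposite.op (mul_antipodeInv_swap (k := k) a.unop)
    refine Eq.trans ?_ (h.trans ?_)
    · simp only [LinearMap.comp_apply, MulOpposite.comul_def, LinearEquiv.coe_coe,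
        MulOpposite.coe_opLinearEquiv_symm, MulOpposite.coe_opLinearEquiv, MulOpposite.unop_op]
      generalize comul (R := k) a.unop = s
      induction s with
      | zero => simp
      | add x y hx hy =>
        simp only [LinearMap.map_add, LinearEquiv.map_add, hx, hy, MulOpposite.op_add]
      | tmul c d => simp
    · simp [MulOpposite.counit_def]
  mul_antipode_lTensor_comul := by
    ext a
    have h := congrArg MulOpposite.op (antipodeInv_mul_swap (k := k) a.unop)
    refine Eq.trans ?_ (h.trans ?_)
    · simp only [LinearMap.comp_apply, MulOpposite.comul_def, LinearEquiv.coe_coe,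
        MulOpposite.coe_opLinearEquiv_symm, MulOpposite.coe_opLinearEquiv, MulOpposite.unop_op]
      generalize comul (R := k) a.unop = s
      induction s with
      | zero => simp
      | add x y hx hy =>
        simp only [LinearMap.map_add, LinearEquiv.map_add, hx, hy, MulOpposite.op_add]
      | tmul c d => simp
    · simp [MulOpposite.counit_def]

theorem antipode_op [FiniteDimensional k A] (a : A) :
    antipode k (MulOpposite.op a) = MulOpposite.op (antipodeInv k A a) := rfl

end Opposite



section ConvAlg

variable {k C E : Type u} [Field k] [Ring C] [Bialgebra k C] [Ring E] [Algebra k E]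

/-- The convolution product of two algebra maps with commuting images is an algebra map. -/
noncomputable def convAlg (f g : C →ₐ[k] E) (h : ∀ x y, Commute (f x) (g y)) : C →ₐ[k] E :=
  (Algebra.TensorProduct.lift f g h).comp (Bialgebra.comulAlgHom k C)

theorem convAlg_toLinearMap (f g : C →ₐ[k] E) (h : ∀ x y, Commute (f x) (g y)) :
    (convAlg f g h).toLinearMap = conv f.toLinearMap g.toLinearMap := by
  ext c
  rw [conv_apply]
  simp only [convAlg, AlgHom.toLinearMap_apply, AlgHom.comp_apply, Bialgebra.comulAlgHom_apply]
  generalize comul (R := k) c = t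
  induction t with
  | zero => simp
  | add x y hx hy => simp only [map_add, hx, hy]
  | tmul x y => simp

theorem convAlg_apply (f g : C →ₐ[k] E) (h : ∀ x y, Commute (f x) (g y)) (c : C) :
    convAlg f g h c = LinearMap.mul' k E (map f.toLinearMap g.toLinearMap (comul c)) := by
  rw [← conv_apply, ← convAlg_toLinearMap f g h]; rfl

theorem convAlg_commute (f g : C →ₐ[k] E) (h : ∀ x y, Commute (f x) (g y)) (e : E)
    (hf : ∀ x, Commute e (f x)) (hg : ∀ x, Commute e (g x)) (c : C) :
    Commute e (convAlg f g h c) := by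
  rw [convAlg_apply]
  generalize comul (R := k) c = t
  induction t with
  | zero => simp
  | add x y hx hy => simpa only [map_add] using hx.add_right hy
  | tmul x y => exact (hf x).mul_right (hg y)

/-- The convolution product for the opposite multiplication: `c ↦ ∑ g c₂ * f c₁`. -/
noncomputable def oconv (f g : C →ₗ[k] E) : C →ₗ[k] E :=
  LinearMap.mul' k E ∘ₗ (TensorProduct.comm k E E).toLinearMap ∘ₗ map f g ∘ₗ comul

theorem oconv_apply (f g : C →ₗ[k] E) (c : C) :
    oconv f g c = LinearMap.mul' k E (TensorProduct.comm k E E (map f g (comul c))) := rfl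

theorem op_oconv (f g : C →ₗ[k] E) :
    (MulOpposite.opLinearEquiv k).toLinearMap ∘ₗ oconv f g =
      conv ((MulOpposite.opLinearEquiv k).toLinearMap ∘ₗ f)
        ((MulOpposite.opLinearEquiv k).toLinearMap ∘ₗ g) := by
  ext c
  rw [conv_apply, LinearMap.comp_apply, oconv_apply]
  generalize comul (R := k) c = t
  induction t with
  | zero =>
    simp only [LinearMap.map_zero, LinearEquiv.map_zero, zero_tmul, tmul_zero,
      LinearMap.zero_apply, mul_zero, zero_mul]
  | add x y hx hy => simp only [LinearMap.map_add, LinearEquiv.map_add, hx, hy]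
  | tmul x y => simp

theorem oconv_assoc (f g h : C →ₗ[k] E) : oconv (oconv f g) h = oconv f (oconv g h) := by
  have h1 := conv_assoc ((MulOpposite.opLinearEquiv k).toLinearMap ∘ₗ f)
    ((MulOpposite.opLinearEquiv k).toLinearMap ∘ₗ g)
    ((MulOpposite.opLinearEquiv k).toLinearMap ∘ₗ h)
  rw [← op_oconv, ← op_oconv, ← op_oconv, ← op_oconv] at h1
  refine LinearMap.ext fun c => MulOpposite.op_injective ?_
  exact LinearMap.congr_fun h1 c

theorem conv_eq_oconv (f g : C →ₗ[k] E) (h : ∀ x y, Commute (f x) (g y)) :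
    conv f g = oconv f g := by
  ext c
  rw [conv_apply, oconv_apply]
  generalize comul (R := k) c = t
  induction t with
  | zero =>
    simp only [LinearMap.map_zero, LinearEquiv.map_zero, zero_tmul, tmul_zero,
      LinearMap.zero_apply, mul_zero, zero_mul]
  | add x y hx hy => simp only [LinearMap.map_add, LinearEquiv.map_add, hx, hy]
  | tmul x y => simpa using (h x y).eq

theorem mulRight_oconv (f g : C →ₗ[k] E) (e : E) (h : ∀ x, Commute e (f x)) :
    LinearMap.mulRight k e ∘ₗ oconv f g = oconv f (LinearMap.mulRight k e ∘ₗ g) := by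
  ext c
  rw [oconv_apply, LinearMap.comp_apply, oconv_apply]
  generalize comul (R := k) c = t
  induction t with
  | zero =>
    simp only [LinearMap.map_zero, LinearEquiv.map_zero, zero_tmul, tmul_zero,
      LinearMap.zero_apply, mul_zero, zero_mul]
  | add x y hx hy => simp only [LinearMap.map_add, LinearEquiv.map_add, hx, hy]
  | tmul x y => simp [mul_assoc, (h x).eq]

theorem mulRight_conv (f g : C →ₗ[k] E) (e : E) (h : ∀ x, Commute e (g x)) :
    LinearMap.mulRight k e ∘ₗ conv f g = conv (LinearMap.mulRight k e ∘ₗ f) g := by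
  ext c
  rw [conv_apply, LinearMap.comp_apply, conv_apply]
  generalize comul (R := k) c = t
  induction t with
  | zero =>
    simp only [LinearMap.map_zero, LinearEquiv.map_zero, zero_tmul, tmul_zero,
      LinearMap.zero_apply, mul_zero, zero_mul]
  | add x y hx hy => simp only [LinearMap.map_add, LinearEquiv.map_add, hx, hy]
  | tmul x y => simp [mul_assoc, (h y).eq]

theorem convAlg_mul_left (f g : C →ₐ[k] E) (h : ∀ x y, Commute (f x) (g y)) (e : E)
    (hg : ∀ x, Commute e (g x)) (θ : C →ₗ[k] E)
    (he : LinearMap.mulRight k e ∘ₗ f.toLinearMap = conv θ f.toLinearMap) (c : C) :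
    convAlg f g h c * e =
      LinearMap.mul' k E (map θ (convAlg f g h).toLinearMap (comul c)) := by
  have h1 := LinearMap.congr_fun (mulRight_conv f.toLinearMap g.toLinearMap e hg) c
  rw [he, conv_assoc, ← convAlg_toLinearMap f g h] at h1
  exact h1

theorem convAlg_mul_right (f g₁ g₂ : C →ₐ[k] E) (h₁₂ : ∀ x y, Commute (g₁ x) (g₂ y))
    (h : ∀ x y, Commute (f x) (convAlg g₁ g₂ h₁₂ y)) (e : E)
    (hf : ∀ x, Commute e (f x)) (hg : ∀ x, Commute e (g₁ x)) (θ : C →ₗ[k] E)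
    (he : LinearMap.mulRight k e ∘ₗ g₂.toLinearMap = oconv g₂.toLinearMap θ) (c : C) :
    convAlg f (convAlg g₁ g₂ h₁₂) h c * e = LinearMap.mul' k E (TensorProduct.comm k E E
      (map (convAlg f (convAlg g₁ g₂ h₁₂) h).toLinearMap θ (comul c))) := by
  have hG : (convAlg f (convAlg g₁ g₂ h₁₂) h).toLinearMap =
      oconv f.toLinearMap (oconv g₁.toLinearMap g₂.toLinearMap) := by
    rw [convAlg_toLinearMap, conv_eq_oconv f.toLinearMap (convAlg g₁ g₂ h₁₂).toLinearMap h, convAlg_toLinearMap,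
      conv_eq_oconv g₁.toLinearMap g₂.toLinearMap h₁₂]
  have h1 := LinearMap.congr_fun (mulRight_oconv f.toLinearMap
    (oconv g₁.toLinearMap g₂.toLinearMap) e hf) c
  rw [← hG, mulRight_oconv g₁.toLinearMap g₂.toLinearMap e hg, he,
    ← oconv_assoc g₁.toLinearMap, ← oconv_assoc f.toLinearMap, ← hG] at h1
  exact h1

end ConvAlg

/-! ### The algebra `X` -/

section Algebra

variable (k A : Type u) [Field k] [Ring A] [HopfAlgebra k A]

/-- Left multiplication of `A` on itself. -/
noncomputable abbrev leftMul : A →ₐ[k] Module.End k A := Algebra.lmul k A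

/-- Right multiplication of `A` on itself. -/
noncomputable abbrev rightMul : Aᵐᵒᵖ →ₐ[k] Module.End k A := Algebra.lsmul k k A

theorem leftMul_rightMul_comm (x : A) (y : Aᵐᵒᵖ) : Commute (leftMul k A x) (rightMul k A y) := by
  refine LinearMap.ext fun z => ?_
  simp [Module.End.mul_apply, mul_assoc]

/-- The action `(a ⊗ b) z = a z b` of `A ⊗ Aᵒᵖ` on `A`. -/
noncomputable def regAct : A ⊗[k] Aᵐᵒᵖ →ₐ[k] Module.End k A :=
  Algebra.TensorProduct.lift (leftMul k A) (rightMul k A) (leftMul_rightMul_comm k A)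

variable {k A} in
theorem regAct_tmul (a : A) (b : Aᵐᵒᵖ) (z : A) : regAct k A (a ⊗ₜ b) z = a * z * b.unop := by
  simp [regAct, mul_assoc]

variable {k A} in
theorem comul_regAct (c : A ⊗[k] Aᵐᵒᵖ) (z : A) :
    comul (regAct k A c z) =
      Module.endTensorEndAlgHom (R := k) (S := k) (A := k)
        (map (regAct k A).toLinearMap (regAct k A).toLinearMap (comul (R := k) c)) (comul (R := k) z) := by
  induction c with
  | zero => simp
  | add x y hx hy => simp only [map_add, hx, hy, LinearMap.add_apply]
  | tmul a b =>
    rw [regAct_tmul, Bialgebra.comul_mul, Bialgebra.comul_mul, TensorProduct.comul_tmul,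
      MulOpposite.comul_def]
    simp only [LinearMap.comp_apply, LinearEquiv.coe_coe, MulOpposite.coe_opLinearEquiv_symm]
    generalize comul (R := k) a = s
    generalize comul (R := k) b.unop = t
    generalize comul (R := k) z = w
    induction s with
    | zero => simp
    | add x y hx hy => simp only [map_add, hx, hy, add_mul, add_tmul, LinearMap.add_apply]
    | tmul s₁ s₂ =>
      induction t with
      | zero => simp
      | add x y hx hy => simp only [map_add, hx, hy, mul_add, tmul_add, LinearMap.add_apply]
      | tmul t₁ t₂ =>
        induction w with
        | zero =>
          simp only [LinearMap.map_zero, LinearEquiv.map_zero, zero_tmul, tmul_zero,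
            LinearMap.zero_apply, mul_zero, zero_mul]
        | add x y hx hy =>
          simp only [LinearMap.map_add, LinearEquiv.map_add, hx, hy, mul_add, add_mul]
        | tmul w₁ w₂ => simp [Module.endTensorEndAlgHom_apply, regAct_tmul]

variable {k A} in
theorem counit_regAct (c : A ⊗[k] Aᵐᵒᵖ) (z : A) :
    counit (R := k) (regAct k A c z) = counit (R := k) c * counit (R := k) z := by
  induction c with
  | zero => simp
  | add x y hx hy => simp only [map_add, hx, hy, LinearMap.add_apply, add_mul]
  | tmul a b =>
    rw [regAct_tmul, Bialgebra.counit_mul, Bialgebra.counit_mul]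
    simp [MulOpposite.counit_def]
    ring

/-- The dual space `A*`. -/
def DualA : Type u := Module.Dual k A

noncomputable instance : AddCommGroup (DualA k A) := inferInstanceAs (AddCommGroup (Module.Dual k A))
noncomputable instance : Module k (DualA k A) := inferInstanceAs (Module k (Module.Dual k A))

/-- The identification of `DualA k A` with the space of linear forms. -/
noncomputable def toForm : DualA k A ≃ₗ[k] (A →ₗ[k] k) := LinearEquiv.refl k _

variable {k A} in
@[ext] theorem dual_ext {l l' : DualA k A} (h : ∀ z, toForm k A l z = toForm k A l' z) : l = l' :=
  (toForm k A).injective (LinearMap.ext h)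

/-- The convolution product `(l l')(a) = ∑ l(a₁) l'(a₂)` of `A*`. -/
noncomputable def dualMul : DualA k A →ₗ[k] DualA k A →ₗ[k] DualA k A :=
  LinearMap.mk₂ k (fun l l' => (toForm k A).symm (conv (toForm k A l) (toForm k A l')))
    (by intros; simp [conv, map_add_left, LinearMap.add_comp, LinearMap.comp_add])
    (by intros; simp [conv, map_smul_left, LinearMap.smul_comp, LinearMap.comp_smul])
    (by intros; simp [conv, map_add_right, LinearMap.add_comp, LinearMap.comp_add])
    (by intros; simp [conv, map_smul_right, LinearMap.smul_comp, LinearMap.comp_smul])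

/-- The unit `ε` of `A*`. -/
noncomputable def dualOne : DualA k A := (toForm k A).symm counit

variable {k A}

theorem toForm_dualMul (l l' : DualA k A) :
    toForm k A (dualMul k A l l') = conv (toForm k A l) (toForm k A l') := rfl

theorem dualMul_assoc (l l' l'' : DualA k A) :
    dualMul k A (dualMul k A l l') l'' = dualMul k A l (dualMul k A l' l'') :=
  conv_assoc (toForm k A l) (toForm k A l') (toForm k A l'')

theorem dualMul_one (l : DualA k A) : dualMul k A l (dualOne k A) = l :=
  conv_unit (toForm k A l)

theorem one_dualMul (l : DualA k A) : dualMul k A (dualOne k A) l = l :=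
  unit_conv (toForm k A l)

variable (k A)

/-- Precomposition `l ↦ l ∘ f`. -/
noncomputable def pull : Module.End k A →ₗ[k] Module.End k (DualA k A) :=
  LinearMap.mk₂ k (fun f l => (toForm k A).symm (toForm k A l ∘ₗ f))
    (by intros; simp [LinearMap.comp_add])
    (by intros; simp [LinearMap.comp_smul])
    (by intros; simp [LinearMap.add_comp])
    (by intros; simp [LinearMap.smul_comp])

variable [FiniteDimensional k A]

/-- The twist `(a ⊗ b) ↦ (l ↦ l(S(a) · S⁻¹(b)))` on the dual of `A`. -/
noncomputable def twistL : A ⊗[k] Aᵐᵒᵖ →ₐ[k] Module.End k (DualA k A) :=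
  AlgHom.ofLinearMap (pull k A ∘ₗ (regAct k A).toLinearMap ∘ₗ antipode k)
    (by
      refine LinearMap.ext fun l => ?_
      simp only [LinearMap.comp_apply, antipode_one, AlgHom.toLinearMap_apply, map_one]
      rfl)
    (by
      intro x y
      refine LinearMap.ext fun l => ?_
      simp only [LinearMap.comp_apply, antipode_mul_antidistrib, AlgHom.toLinearMap_apply, map_mul]
      rfl)

/-- The twist `(a ⊗ b) ↦ (l ↦ l(S⁻¹(a) · S(b)))` on the dual of `A`. -/
noncomputable def twistR : A ⊗[k] Aᵐᵒᵖ →ₐ[k] Module.End k (DualA k A) :=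
  AlgHom.ofLinearMap (pull k A ∘ₗ (regAct k A).toLinearMap ∘ₗ antipodeInv k _)
    (by
      refine LinearMap.ext fun l => ?_
      simp only [LinearMap.comp_apply, antipodeInv_one, AlgHom.toLinearMap_apply, map_one]
      rfl)
    (by
      intro x y
      refine LinearMap.ext fun l => ?_
      simp only [LinearMap.comp_apply, antipodeInv_mul, AlgHom.toLinearMap_apply, map_mul]
      rfl)

variable {k A}

theorem twistL_apply (c : A ⊗[k] Aᵐᵒᵖ) (l : DualA k A) :
    toForm k A (twistL k A c l) = toForm k A l ∘ₗ regAct k A (antipode k c) := rfl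

theorem twistR_apply (c : A ⊗[k] Aᵐᵒᵖ) (l : DualA k A) :
    toForm k A (twistR k A c l) = toForm k A l ∘ₗ regAct k A (antipodeInv k _ c) := rfl

theorem twistL_tmul (a b : A) (l : DualA k A) (z : A) :
    toForm k A (twistL k A (a ⊗ₜ MulOpposite.op b) l) z =
      toForm k A l (antipode k a * z * antipodeInv k A b) := by
  rw [twistL_apply, TensorProduct.antipode_def, AlgebraTensorModule.map_tmul, antipode_op,
    LinearMap.comp_apply, regAct_tmul]
  rfl

theorem twistR_tmul (a b : A) (l : DualA k A) (z : A) :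
    toForm k A (twistR k A (a ⊗ₜ MulOpposite.op b) l) z =
      toForm k A l (antipodeInv k A a * z * antipode k b) := by
  have h : antipodeInv k (A ⊗[k] Aᵐᵒᵖ) (a ⊗ₜ[k] MulOpposite.op b) =
      antipodeInv k A a ⊗ₜ MulOpposite.op (antipode k b) := by
    apply antipode_injective (k := k)
    rw [antipode_antipodeInv, TensorProduct.antipode_def, AlgebraTensorModule.map_tmul, antipode_op]
    simp
  rw [twistR_apply, h, LinearMap.comp_apply, regAct_tmul]
  rfl

/-- `twistL c (l l') = ∑ (twistL c₂ l) (twistL c₁ l')` for the convolution product. -/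
theorem twistL_dualMul (c : A ⊗[k] Aᵐᵒᵖ) (l l' : DualA k A) :
    twistL k A c (dualMul k A l l') = lift (dualMul k A) (TensorProduct.comm k _ _
      (map ((twistL k A).toLinearMap.flip l') ((twistL k A).toLinearMap.flip l)
        (comul (R := k) c))) := by
  apply dual_ext
  intro z
  rw [twistL_apply, LinearMap.comp_apply, toForm_dualMul, conv_apply, comul_regAct, comul_antipode]
  generalize comul (R := k) c = t
  induction t with
  | zero => simp
  | add x y hx hy => simp only [map_add, hx, hy, LinearMap.add_apply]
  | tmul x y =>
    simp only [map_tmul, comm_tmul, lift.tmul, toForm_dualMul, conv_apply]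
    generalize comul (R := k) z = w
    induction w with
    | zero => simp only [map_zero]
    | add x y hx hy => simp only [LinearMap.map_add, LinearEquiv.map_add, hx, hy]
    | tmul w₁ w₂ => rfl

/-- `twistR c (l l') = ∑ (twistR c₂ l) (twistR c₁ l')` for the convolution product. -/
theorem twistR_dualMul (c : A ⊗[k] Aᵐᵒᵖ) (l l' : DualA k A) :
    twistR k A c (dualMul k A l l') = lift (dualMul k A) (TensorProduct.comm k _ _
      (map ((twistR k A).toLinearMap.flip l') ((twistR k A).toLinearMap.flip l)
        (comul (R := k) c))) := by
  apply dual_ext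
  intro z
  rw [twistR_apply, LinearMap.comp_apply, toForm_dualMul, conv_apply, comul_regAct,
    comul_antipodeInv]
  generalize comul (R := k) c = t
  induction t with
  | zero => simp
  | add x y hx hy => simp only [map_add, hx, hy, LinearMap.add_apply]
  | tmul x y =>
    simp only [map_tmul, comm_tmul, lift.tmul, toForm_dualMul, conv_apply]
    generalize comul (R := k) z = w
    induction w with
    | zero => simp only [map_zero]
    | add x y hx hy => simp only [LinearMap.map_add, LinearEquiv.map_add, hx, hy]
    | tmul w₁ w₂ => rfl

theorem counit_antipodeInv {B : Type u} [Ring B] [HopfAlgebra k B] [FiniteDimensional k B] (b : B) :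
    counit (R := k) (antipodeInv k B b) = counit (R := k) b := by
  conv_rhs => rw [← antipode_antipodeInv (k := k) b, counit_antipode]

theorem twistL_one (c : A ⊗[k] Aᵐᵒᵖ) :
    twistL k A c (dualOne k A) = counit (R := k) c • dualOne k A := by
  apply dual_ext
  intro z
  rw [twistL_apply, LinearMap.comp_apply]
  refine (counit_regAct _ z).trans ?_
  rw [counit_antipode]
  rfl

theorem twistR_one (c : A ⊗[k] Aᵐᵒᵖ) :
    twistR k A c (dualOne k A) = counit (R := k) c • dualOne k A := by
  apply dual_ext
  intro z
  rw [twistR_apply, LinearMap.comp_apply]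
  refine (counit_regAct _ z).trans ?_
  rw [counit_antipodeInv]
  rfl

variable (k A)

/-- The vector space `(A*ᵒᵖ ⊗ A*) ⊗ (A ⊗ Aᵒᵖ)` underlying the algebra `X`. -/
def AlgX : Type u := (DualA k A ⊗[k] DualA k A) ⊗[k] (A ⊗[k] Aᵐᵒᵖ)

noncomputable instance : AddCommGroup (AlgX k A) :=
  inferInstanceAs (AddCommGroup ((DualA k A ⊗[k] DualA k A) ⊗[k] (A ⊗[k] Aᵐᵒᵖ)))
noncomputable instance : Module k (AlgX k A) :=
  inferInstanceAs (Module k ((DualA k A ⊗[k] DualA k A) ⊗[k] (A ⊗[k] Aᵐᵒᵖ)))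

/-- The element `(l ⊗ m) ⊗ c` of `X`, for `l, m ∈ A*` and `c ∈ A ⊗ Aᵒᵖ`. -/
noncomputable def xmk (l m : DualA k A) (c : A ⊗[k] Aᵐᵒᵖ) : AlgX k A := (l ⊗ₜ[k] m) ⊗ₜ[k] c

variable {k A} in
theorem xmk_zero_left (m c) : xmk k A 0 m c = 0 := by
  change ((0 : DualA k A) ⊗ₜ[k] m) ⊗ₜ[k] c = 0
  rw [zero_tmul, zero_tmul]

variable {k A} in
theorem xmk_add_left (l l' m c) : xmk k A (l + l') m c = xmk k A l m c + xmk k A l' m c := by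
  change ((l + l') ⊗ₜ[k] m) ⊗ₜ[k] c = _
  rw [add_tmul, add_tmul]
  rfl

variable {k A} in
theorem xmk_zero_mid (l c) : xmk k A l 0 c = 0 := by
  change (l ⊗ₜ[k] (0 : DualA k A)) ⊗ₜ[k] c = 0
  rw [tmul_zero, zero_tmul]

variable {k A} in
theorem xmk_add_mid (l m m' c) : xmk k A l (m + m') c = xmk k A l m c + xmk k A l m' c := by
  change (l ⊗ₜ[k] (m + m')) ⊗ₜ[k] c = _
  rw [tmul_add, add_tmul]
  rfl

variable {k A} in
theorem xmk_smul_left (r : k) (l m c) : xmk k A (r • l) m c = r • xmk k A l m c := rfl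

variable {k A} in
theorem xmk_smul_mid (r : k) (l m c) : xmk k A l (r • m) c = r • xmk k A l m c := by
  change (l ⊗ₜ[k] (r • m)) ⊗ₜ[k] c = r • ((l ⊗ₜ[k] m) ⊗ₜ[k] c)
  rw [tmul_smul]
  rfl

variable {k A} in
theorem xInduction {P : AlgX k A → Prop} (zero : P 0) (add : ∀ x y, P x → P y → P (x + y))
    (mk : ∀ l m c, P (xmk k A l m c)) (x : AlgX k A) : P x := by
  refine TensorProduct.induction_on (motive := P) x zero (fun y c => ?_) add
  refine TensorProduct.induction_on (motive := fun y => P (y ⊗ₜ[k] c)) y ?_ (fun l m => mk l m c) ?_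
  · rw [zero_tmul]; exact zero
  · intro y z hy hz
    rw [add_tmul]; exact add _ _ hy hz

/-- Left multiplication by `l ∈ A*ᵒᵖ` on `X`. -/
noncomputable def xL : DualA k A →ₗ[k] Module.End k (AlgX k A) :=
  LinearMap.rTensorHom (A ⊗[k] Aᵐᵒᵖ) ∘ₗ LinearMap.rTensorHom (DualA k A) ∘ₗ (dualMul k A).flip

/-- Left multiplication by `m ∈ A*` on `X`. -/
noncomputable def xR : DualA k A →ₗ[k] Module.End k (AlgX k A) :=
  LinearMap.rTensorHom (A ⊗[k] Aᵐᵒᵖ) ∘ₗ LinearMap.lTensorHom (DualA k A) ∘ₗ dualMul k A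

theorem xL_mk (l l' m' c') : xL k A l (xmk k A l' m' c') = xmk k A (dualMul k A l' l) m' c' := rfl

theorem xR_mk (m l' m' c') : xR k A m (xmk k A l' m' c') = xmk k A l' (dualMul k A m m') c' := rfl

/-- `c ↦ (twistL c ⊗ 1) ⊗ 1` -/
noncomputable def xTwistL : A ⊗[k] Aᵐᵒᵖ →ₐ[k] Module.End k (AlgX k A) :=
  (Module.End.rTensorAlgHom k (DualA k A ⊗[k] DualA k A) (A ⊗[k] Aᵐᵒᵖ)).comp
    ((Module.End.rTensorAlgHom k (DualA k A) (DualA k A)).comp (twistL k A))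

/-- `c ↦ (1 ⊗ twistR c) ⊗ 1` -/
noncomputable def xTwistR : A ⊗[k] Aᵐᵒᵖ →ₐ[k] Module.End k (AlgX k A) :=
  (Module.End.rTensorAlgHom k (DualA k A ⊗[k] DualA k A) (A ⊗[k] Aᵐᵒᵖ)).comp
    ((Module.End.lTensorAlgHom k (DualA k A) (DualA k A)).comp (twistR k A))

/-- `c ↦ (1 ⊗ 1) ⊗ (left multiplication by c)` -/
noncomputable def xMul : A ⊗[k] Aᵐᵒᵖ →ₐ[k] Module.End k (AlgX k A) :=
  (Module.End.lTensorAlgHom k (A ⊗[k] Aᵐᵒᵖ) (DualA k A ⊗[k] DualA k A)).comp (Algebra.lmul k _)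

theorem xTwistL_mk (c l m d) : xTwistL k A c (xmk k A l m d) = xmk k A (twistL k A c l) m d := rfl
theorem xTwistR_mk (c l m d) : xTwistR k A c (xmk k A l m d) = xmk k A l (twistR k A c m) d := rfl
theorem xMul_mk (c l m d) : xMul k A c (xmk k A l m d) = xmk k A l m (c * d) := rfl

theorem xext {f g : Module.End k (AlgX k A)}
    (h : ∀ l m c, f (xmk k A l m c) = g (xmk k A l m c)) : f = g := by
  refine LinearMap.ext fun x => ?_
  induction x using xInduction with
  | zero =>
    simp only [LinearMap.map_zero, LinearEquiv.map_zero, zero_tmul, tmul_zero,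
      LinearMap.zero_apply, mul_zero, zero_mul]
  | add x y hx hy => simp only [LinearMap.map_add, LinearEquiv.map_add, hx, hy]
  | mk l m c => exact h l m c

theorem xMul_comm (x y) : Commute (xMul k A x) (xTwistR k A y) := xext k A fun _ _ _ => rfl

/-- `c ↦ ∑ (1 ⊗ twistR c₂) ⊗ (c₁ ·)` -/
noncomputable def xGammaR : A ⊗[k] Aᵐᵒᵖ →ₐ[k] Module.End k (AlgX k A) :=
  convAlg (xMul k A) (xTwistR k A) (xMul_comm k A)

theorem xTwistL_comm (x y) : Commute (xTwistL k A x) (xGammaR k A y) := by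
  rw [xGammaR, convAlg_apply]
  generalize comul (R := k) y = t
  induction t with
  | zero => simp
  | add x y hx hy => simpa only [map_add] using hx.add_right hy
  | tmul y z => exact xext k A fun _ _ _ => rfl

/-- Left multiplication by `c ∈ A ⊗ Aᵒᵖ` on `X`:
`(l ⊗ m) ⊗ d ↦ ∑ (twistL c₁ l ⊗ twistR c₃ m) ⊗ c₂ d`. -/
noncomputable def xGamma : A ⊗[k] Aᵐᵒᵖ →ₐ[k] Module.End k (AlgX k A) :=
  convAlg (xTwistL k A) (xGammaR k A) (xTwistL_comm k A)

/-- Data that give an action of `X` on a vector space `V`: actions of `A*ᵒᵖ`, of `A*` and of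
`A ⊗ Aᵒᵖ` that satisfy the straightening relations of `X`. -/
structure XRep (V : Type u) [AddCommGroup V] [Module k V] where
  actL : DualA k A →ₗ[k] Module.End k V
  actR : DualA k A →ₗ[k] Module.End k V
  act : A ⊗[k] Aᵐᵒᵖ →ₐ[k] Module.End k V
  actL_one : actL (dualOne k A) = 1
  actR_one : actR (dualOne k A) = 1
  actL_mul : ∀ l l', actL (dualMul k A l' l) = actL l * actL l'
  actR_mul : ∀ m m', actR (dualMul k A m m') = actR m * actR m'
  actL_actR : ∀ l m, Commute (actL l) (actR m)
  act_actL : ∀ c l, act c * actL l = LinearMap.mul' k _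
    (map (actL ∘ₗ (twistL k A).toLinearMap.flip l) act.toLinearMap (comul c))
  act_actR : ∀ c m, act c * actR m = LinearMap.mul' k _ (TensorProduct.comm k _ _
    (map act.toLinearMap (actR ∘ₗ (twistR k A).toLinearMap.flip m) (comul c)))

namespace XRep

variable {k A} {V : Type u} [AddCommGroup V] [Module k V] (ρ : XRep k A V)

/-- The operator by which an element of `X` acts: `(l ⊗ m) ⊗ c` acts as `l ∘ m ∘ c`. -/
noncomputable def hom : AlgX k A →ₗ[k] Module.End k V :=
  TensorProduct.lift ((LinearMap.mul k (Module.End k V)).compl₁₂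
    (TensorProduct.lift ((LinearMap.mul k (Module.End k V)).compl₁₂ ρ.actL ρ.actR))
    ρ.act.toLinearMap)

theorem hom_mk (l m c) : ρ.hom (xmk k A l m c) = ρ.actL l * ρ.actR m * ρ.act c := rfl

theorem hom_xL (l) (x : AlgX k A) : ρ.hom (xL k A l x) = ρ.actL l * ρ.hom x := by
  induction x using xInduction with
  | zero =>
    simp only [LinearMap.map_zero, LinearEquiv.map_zero, zero_tmul, tmul_zero,
      LinearMap.zero_apply, mul_zero, zero_mul]
  | add x y hx hy => simp only [LinearMap.map_add, LinearEquiv.map_add, hx, hy, mul_add]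
  | mk l' m c => rw [xL_mk, hom_mk, hom_mk, ρ.actL_mul]; simp only [mul_assoc]

theorem hom_xR (m) (x : AlgX k A) : ρ.hom (xR k A m x) = ρ.actR m * ρ.hom x := by
  induction x using xInduction with
  | zero =>
    simp only [LinearMap.map_zero, LinearEquiv.map_zero, zero_tmul, tmul_zero,
      LinearMap.zero_apply, mul_zero, zero_mul]
  | add x y hx hy => simp only [LinearMap.map_add, LinearEquiv.map_add, hx, hy, mul_add]
  | mk l' m' c =>
    rw [xR_mk, hom_mk, hom_mk, ρ.actR_mul, ← mul_assoc, ← mul_assoc, ← mul_assoc,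
      (ρ.actL_actR l' m).eq]

theorem hom_xGamma (c) (x : AlgX k A) : ρ.hom (xGamma k A c x) = ρ.act c * ρ.hom x := by
  induction x using xInduction with
  | zero =>
    simp only [LinearMap.map_zero, LinearEquiv.map_zero, zero_tmul, tmul_zero,
      LinearMap.zero_apply, mul_zero, zero_mul]
  | add x y hx hy => simp only [LinearMap.map_add, LinearEquiv.map_add, hx, hy, mul_add]
  | mk l m d =>
    have h1 : ∀ t : (A ⊗[k] Aᵐᵒᵖ) ⊗[k] (A ⊗[k] Aᵐᵒᵖ),
        ρ.hom (LinearMap.mul' k _ (map (xTwistL k A).toLinearMap (xGammaR k A).toLinearMap t)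
          (xmk k A l m d)) = LinearMap.mul' k _
            (map (ρ.actL ∘ₗ (twistL k A).toLinearMap.flip l) ρ.act.toLinearMap t) *
              ρ.actR m * ρ.act d := by
      intro t
      induction t with
      | zero =>
        simp only [LinearMap.map_zero, LinearEquiv.map_zero, zero_tmul, tmul_zero,
          LinearMap.zero_apply, mul_zero, zero_mul]
      | add x y hx hy =>
        simp only [LinearMap.map_add, LinearEquiv.map_add, hx, hy, LinearMap.add_apply, add_mul]
      | tmul x y =>
        have h2 := ρ.act_actR y m
        simp only [map_tmul, LinearMap.mul'_apply, AlgHom.toLinearMap_apply, Module.End.mul_apply,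
          LinearMap.comp_apply, LinearMap.flip_apply]
        rw [mul_assoc (ρ.actL _) (ρ.act y), h2, xGammaR, convAlg_apply]
        generalize comul (R := k) y = s
        induction s with
        | zero =>
          simp only [LinearMap.map_zero, LinearEquiv.map_zero, zero_tmul, tmul_zero,
            LinearMap.zero_apply, mul_zero, zero_mul]
        | add x y hx hy =>
          simp only [LinearMap.map_add, LinearEquiv.map_add, hx, hy, LinearMap.add_apply,
            mul_add, add_mul]
        | tmul u v =>
          simp only [map_tmul, LinearMap.mul'_apply, AlgHom.toLinearMap_apply,
            Module.End.mul_apply, comm_tmul, LinearMap.comp_apply, LinearMap.flip_apply]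
          rw [xTwistR_mk, xMul_mk, xTwistL_mk, hom_mk, map_mul]
          simp only [mul_assoc]
    rw [xGamma, convAlg_apply, h1, ← ρ.act_actL, hom_mk]
    simp only [mul_assoc]

end XRep

theorem xL_xR (l c) : Commute (xL k A l) (xR k A c) :=
  xext k A fun _ _ _ => by
    simp only [Module.End.mul_apply, xL_mk, xR_mk, xMul_mk, xTwistL_mk, xTwistR_mk]

theorem xL_xMul (l c) : Commute (xL k A l) (xMul k A c) :=
  xext k A fun _ _ _ => by
    simp only [Module.End.mul_apply, xL_mk, xR_mk, xMul_mk, xTwistL_mk, xTwistR_mk]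

theorem xL_xTwistR (l c) : Commute (xL k A l) (xTwistR k A c) :=
  xext k A fun _ _ _ => by
    simp only [Module.End.mul_apply, xL_mk, xR_mk, xMul_mk, xTwistL_mk, xTwistR_mk]

theorem xR_xTwistL (l c) : Commute (xR k A l) (xTwistL k A c) :=
  xext k A fun _ _ _ => by
    simp only [Module.End.mul_apply, xL_mk, xR_mk, xMul_mk, xTwistL_mk, xTwistR_mk]

theorem xR_xMul (l c) : Commute (xR k A l) (xMul k A c) :=
  xext k A fun _ _ _ => by
    simp only [Module.End.mul_apply, xL_mk, xR_mk, xMul_mk, xTwistL_mk, xTwistR_mk]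

theorem xGamma_xL (c l) : xGamma k A c * xL k A l = LinearMap.mul' k _
    (map (xL k A ∘ₗ (twistL k A).toLinearMap.flip l) (xGamma k A).toLinearMap (comul c)) := by
  refine convAlg_mul_left (xTwistL k A) (xGammaR k A) (xTwistL_comm k A) (xL k A l)
    (convAlg_commute (xMul k A) (xTwistR k A) (xMul_comm k A) (xL k A l) (xL_xMul k A l)
      (xL_xTwistR k A l)) (xL k A ∘ₗ (twistL k A).toLinearMap.flip l)
    (LinearMap.ext fun c => xext k A fun l' m d => ?_) c
  change xmk k A (twistL k A c (dualMul k A l' l)) m d = _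
  rw [twistL_dualMul, conv_apply]
  generalize comul (R := k) c = t
  induction t with
  | zero => simp only [map_zero, LinearMap.zero_apply, xmk_zero_left]
  | add x y hx hy =>
    simp only [LinearMap.map_add, LinearEquiv.map_add, LinearMap.add_apply, xmk_add_left, hx, hy]
  | tmul y z => rfl

theorem xGamma_xR (c m) : xGamma k A c * xR k A m = LinearMap.mul' k _ (TensorProduct.comm k _ _
    (map (xGamma k A).toLinearMap (xR k A ∘ₗ (twistR k A).toLinearMap.flip m) (comul c))) := by
  refine convAlg_mul_right (xTwistL k A) (xMul k A) (xTwistR k A) (xMul_comm k A)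
    (xTwistL_comm k A) (xR k A m) (xR_xTwistL k A m) (xR_xMul k A m)
    (xR k A ∘ₗ (twistR k A).toLinearMap.flip m)
    (LinearMap.ext fun c => xext k A fun l m' d => ?_) c
  change xmk k A l (twistR k A c (dualMul k A m m')) d = _
  rw [twistR_dualMul, oconv_apply]
  generalize comul (R := k) c = t
  induction t with
  | zero => simp only [map_zero, LinearMap.zero_apply, xmk_zero_mid]
  | add x y hx hy =>
    simp only [LinearMap.map_add, LinearEquiv.map_add, LinearMap.add_apply, xmk_add_mid, hx, hy]
  | tmul y z => rfl

/-- The left regular representation of `X`. -/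
noncomputable def xReg : XRep k A (AlgX k A) where
  actL := xL k A
  actR := xR k A
  act := xGamma k A
  actL_one := xext k A fun l m c => by rw [xL_mk, dualMul_one]; rfl
  actR_one := xext k A fun l m c => by rw [xR_mk, one_dualMul]; rfl
  actL_mul l l' := xext k A fun l'' m c => by
    rw [Module.End.mul_apply, xL_mk, xL_mk, xL_mk, dualMul_assoc]
  actR_mul l l' := xext k A fun l'' m c => by
    rw [Module.End.mul_apply, xR_mk, xR_mk, xR_mk, dualMul_assoc]
  actL_actR l m := xL_xR k A l m
  act_actL := xGamma_xL k A
  act_actR := xGamma_xR k A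

namespace XRep

variable {k A} {V : Type u} [AddCommGroup V] [Module k V] (ρ : XRep k A V)

theorem hom_hom (x y : AlgX k A) : ρ.hom ((xReg k A).hom x y) = ρ.hom x * ρ.hom y := by
  induction x using xInduction with
  | zero =>
    simp only [LinearMap.map_zero, LinearEquiv.map_zero, zero_tmul, tmul_zero,
      LinearMap.zero_apply, mul_zero, zero_mul]
  | add x x' hx hy =>
    simp only [LinearMap.map_add, LinearEquiv.map_add, LinearMap.add_apply, hx, hy, add_mul]
  | mk l m c =>
    rw [hom_mk, hom_mk, Module.End.mul_apply, Module.End.mul_apply]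
    refine (ρ.hom_xL l _).trans ?_
    rw [mul_assoc, mul_assoc]
    congr 1
    refine (ρ.hom_xR m _).trans ?_
    congr 1
    exact ρ.hom_xGamma c y

end XRep

theorem xGamma_one (c : A ⊗[k] Aᵐᵒᵖ) :
    xGamma k A c (xmk k A (dualOne k A) (dualOne k A) 1) =
      xmk k A (dualOne k A) (dualOne k A) c := by
  have hR : ∀ c, xGammaR k A c (xmk k A (dualOne k A) (dualOne k A) 1) =
      xmk k A (dualOne k A) (dualOne k A) c := by
    intro c
    have h : ∀ t : (A ⊗[k] Aᵐᵒᵖ) ⊗[k] (A ⊗[k] Aᵐᵒᵖ), LinearMap.mul' k _ (map (xMul k A).toLinearMap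
        (xTwistR k A).toLinearMap t) (xmk k A (dualOne k A) (dualOne k A) 1) =
        xmk k A (dualOne k A) (dualOne k A)
          (TensorProduct.rid k _ (counit.lTensor (A ⊗[k] Aᵐᵒᵖ) t)) := by
      intro t
      induction t with
      | zero =>
        simp only [map_zero, LinearMap.zero_apply]
        exact (tmul_zero _ _).symm
      | add x y hx hy =>
        simp only [LinearMap.map_add, LinearEquiv.map_add, LinearMap.add_apply, hx, hy]
        exact (tmul_add _ _ _).symm
      | tmul x y =>
        simp only [map_tmul, LinearMap.mul'_apply, AlgHom.toLinearMap_apply,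
          Module.End.mul_apply, LinearMap.lTensor_tmul, rid_tmul]
        rw [xTwistR_mk, xMul_mk, twistR_one, xmk_smul_mid, mul_one]
        exact (tmul_smul _ _ _).symm
    rw [xGammaR, convAlg_apply, h, Coalgebra.lTensor_counit_comul, rid_tmul, one_smul]
  have h : ∀ t : (A ⊗[k] Aᵐᵒᵖ) ⊗[k] (A ⊗[k] Aᵐᵒᵖ), LinearMap.mul' k _ (map (xTwistL k A).toLinearMap
      (xGammaR k A).toLinearMap t) (xmk k A (dualOne k A) (dualOne k A) 1) =
      xmk k A (dualOne k A) (dualOne k A)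
        (TensorProduct.lid k _ (counit.rTensor (A ⊗[k] Aᵐᵒᵖ) t)) := by
    intro t
    induction t with
    | zero =>
      simp only [map_zero, LinearMap.zero_apply]
      exact (tmul_zero _ _).symm
    | add x y hx hy =>
      simp only [LinearMap.map_add, LinearEquiv.map_add, LinearMap.add_apply, hx, hy]
      exact (tmul_add _ _ _).symm
    | tmul x y =>
      simp only [map_tmul, LinearMap.mul'_apply, AlgHom.toLinearMap_apply,
        Module.End.mul_apply, LinearMap.rTensor_tmul, lid_tmul]
      rw [hR, xTwistL_mk, twistL_one, xmk_smul_left]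
      exact (tmul_smul _ _ _).symm
  rw [xGamma, convAlg_apply, h, Coalgebra.rTensor_counit_comul, lid_tmul, one_smul]

/-- The multiplication of `X`:
`((l ⊗ m) ⊗ c) x = (left mult. by l) (left mult. by m) (left mult. by c) x`. -/
noncomputable instance : Ring (AlgX k A) :=
  { (inferInstance : AddCommGroup (AlgX k A)) with
    mul := fun x y => (xReg k A).hom x y
    one := xmk k A (dualOne k A) (dualOne k A) 1
    left_distrib := fun x y z => map_add _ _ _
    right_distrib := fun x y z => by
      change (xReg k A).hom (x + y) z = (xReg k A).hom x z + (xReg k A).hom y z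
      rw [map_add, LinearMap.add_apply]
    zero_mul := fun x => by
      change (xReg k A).hom 0 x = 0
      rw [map_zero, LinearMap.zero_apply]
    mul_zero := fun x => map_zero _
    mul_assoc := fun x y z => by
      change (xReg k A).hom ((xReg k A).hom x y) z = (xReg k A).hom x ((xReg k A).hom y z)
      rw [XRep.hom_hom]
      rfl
    one_mul := fun x => by
      change (xReg k A).hom (xmk k A (dualOne k A) (dualOne k A) 1) x = x
      rw [XRep.hom_mk, (xReg k A).actL_one, (xReg k A).actR_one, map_one]
      rfl
    mul_one := fun x => by
      change (xReg k A).hom x (xmk k A (dualOne k A) (dualOne k A) 1) = x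
      induction x using xInduction with
      | zero =>
        simp only [LinearMap.map_zero, LinearEquiv.map_zero, zero_tmul, tmul_zero,
          LinearMap.zero_apply, mul_zero, zero_mul]
      | add x y hx hy =>
        simp only [LinearMap.map_add, LinearEquiv.map_add, LinearMap.add_apply, hx, hy]
      | mk l m c =>
        rw [XRep.hom_mk, Module.End.mul_apply, Module.End.mul_apply]
        change xL k A l (xR k A m (xGamma k A c _)) = _
        rw [xGamma_one, xR_mk, xL_mk, dualMul_one, one_dualMul] }

theorem xmul_def (x y : AlgX k A) : x * y = (xReg k A).hom x y := rfl

theorem xone_def : (1 : AlgX k A) = xmk k A (dualOne k A) (dualOne k A) 1 := rfl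

noncomputable instance : Algebra k (AlgX k A) :=
  Algebra.ofModule
    (fun r x y => by rw [xmul_def, xmul_def, map_smul, LinearMap.smul_apply])
    (fun r x y => by rw [xmul_def, xmul_def, map_smul])

/-- The product of `X` in terms of generators. -/
theorem xmul_mk (l m : DualA k A) (l' m' : DualA k A) (c d : A ⊗[k] Aᵐᵒᵖ) :
    xmk k A l m 1 * (xmk k A (dualOne k A) (dualOne k A) c * xmk k A l' m' d) =
      xL k A l (xR k A m (xGamma k A c (xmk k A l' m' d))) := by
  have h1 : ∀ x, xmk k A l m 1 * x = xL k A l (xR k A m x) := fun x => by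
    rw [xmul_def, XRep.hom_mk, map_one, mul_one]
    rfl
  have h2 : ∀ x, xmk k A (dualOne k A) (dualOne k A) c * x = xGamma k A c x := fun x => by
    rw [xmul_def, XRep.hom_mk, (xReg k A).actL_one, (xReg k A).actR_one, one_mul, one_mul]
    rfl
  rw [h1, h2]

/-- The algebra map `X → End V` given by a representation of `X`. -/
noncomputable def XRep.algHom {V : Type u} [AddCommGroup V] [Module k V] (ρ : XRep k A V) :
    AlgX k A →ₐ[k] Module.End k V :=
  AlgHom.ofLinearMap ρ.hom
    (by rw [xone_def, XRep.hom_mk, ρ.actL_one, ρ.actR_one, map_one, one_mul, one_mul])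
    (fun x y => by rw [xmul_def, XRep.hom_hom])

end Algebra



section Diag

variable {k C : Type u} [Field k] [Ring C] [Bialgebra k C]
  {V W V' W' : Type u} [AddCommGroup V] [Module k V] [AddCommGroup W] [Module k W]
  [AddCommGroup V'] [Module k V'] [AddCommGroup W'] [Module k W']

/-- The diagonal action `c (v ⊗ w) = ∑ c₁ v ⊗ c₂ w` of a bialgebra on a tensor product. -/
noncomputable def diag (f : C →ₐ[k] Module.End k V) (g : C →ₐ[k] Module.End k W) :
    C →ₐ[k] Module.End k (V ⊗[k] W) :=
  (Module.endTensorEndAlgHom (R := k) (S := k) (A := k)).comp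
    ((Algebra.TensorProduct.map f g).comp (Bialgebra.comulAlgHom k C))

/-- Apply `c₁ ⊗ c₂` to `V ⊗ W` through two actions. -/
noncomputable def diagAux (f : C →ₐ[k] Module.End k V) (g : C →ₐ[k] Module.End k W) :
    C ⊗[k] C →ₗ[k] Module.End k (V ⊗[k] W) :=
  ((Module.endTensorEndAlgHom (R := k) (S := k) (A := k)).comp
    (Algebra.TensorProduct.map f g)).toLinearMap

theorem diagAux_tmul (f : C →ₐ[k] Module.End k V) (g : C →ₐ[k] Module.End k W) (x y : C) :
    diagAux f g (x ⊗ₜ y) = map (f x) (g y) := rfl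

theorem diag_eq (f : C →ₐ[k] Module.End k V) (g : C →ₐ[k] Module.End k W) (c : C) :
    diag f g c = diagAux f g (comul c) := rfl

theorem map_diag {f : C →ₐ[k] Module.End k V} {g : C →ₐ[k] Module.End k W}
    {f' : C →ₐ[k] Module.End k V'} {g' : C →ₐ[k] Module.End k W'} (φ : V →ₗ[k] V')
    (ψ : W →ₗ[k] W') (hφ : ∀ c v, φ (f c v) = f' c (φ v)) (hψ : ∀ c w, ψ (g c w) = g' c (ψ w))
    (c : C) (t : V ⊗[k] W) : map φ ψ (diag f g c t) = diag f' g' c (map φ ψ t) := by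
  rw [diag_eq, diag_eq]
  generalize comul (R := k) c = s
  induction s with
  | zero =>
    simp only [LinearMap.map_zero, LinearEquiv.map_zero, zero_tmul, tmul_zero,
      LinearMap.zero_apply, mul_zero, zero_mul]
  | add x y hx hy => simp only [LinearMap.map_add, LinearEquiv.map_add, LinearMap.add_apply, hx, hy]
  | tmul x y =>
    induction t with
    | zero =>
      simp only [LinearMap.map_zero, LinearEquiv.map_zero, zero_tmul, tmul_zero,
        LinearMap.zero_apply, mul_zero, zero_mul]
    | add x y hx hy => simp only [LinearMap.map_add, LinearEquiv.map_add, hx, hy]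
    | tmul v w => simp [diagAux_tmul, hφ, hψ]

theorem assoc_diag {X : Type u} [AddCommGroup X] [Module k X] (f : C →ₐ[k] Module.End k V)
    (g : C →ₐ[k] Module.End k W) (h : C →ₐ[k] Module.End k X) (c : C) (t : (V ⊗[k] W) ⊗[k] X) :
    TensorProduct.assoc k V W X (diag (diag f g) h c t) =
      diag f (diag g h) c (TensorProduct.assoc k V W X t) := by
  induction t with
  | zero =>
    simp only [LinearMap.map_zero, LinearEquiv.map_zero, zero_tmul, tmul_zero,
      LinearMap.zero_apply, mul_zero, zero_mul]
  | add x y hx hy => simp only [LinearMap.map_add, LinearEquiv.map_add, hx, hy]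
  | tmul t x =>
  induction t with
  | zero =>
    simp only [LinearMap.map_zero, LinearEquiv.map_zero, zero_tmul, tmul_zero,
      LinearMap.zero_apply, mul_zero, zero_mul]
  | add x y hx hy => simp only [LinearMap.map_add, LinearEquiv.map_add, add_tmul, hx, hy]
  | tmul v w =>
    have h1 : ∀ s : C ⊗[k] C, TensorProduct.assoc k V W X (diagAux (diag f g) h s ((v ⊗ₜ w) ⊗ₜ x)) =
        map (f.toLinearMap.flip v) (map (g.toLinearMap.flip w) (h.toLinearMap.flip x))
          (TensorProduct.assoc k C C C (comul.rTensor C s)) := by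
      intro s
      induction s with
      | zero =>
        simp only [LinearMap.map_zero, LinearEquiv.map_zero, zero_tmul, tmul_zero,
          LinearMap.zero_apply, mul_zero, zero_mul]
      | add x y hx hy =>
        simp only [LinearMap.map_add, LinearEquiv.map_add, LinearMap.add_apply, hx, hy]
      | tmul a b =>
        rw [diagAux_tmul, map_tmul, diag_eq, LinearMap.rTensor_tmul]
        generalize comul (R := k) a = s
        induction s with
        | zero =>
          simp only [LinearMap.map_zero, LinearEquiv.map_zero, zero_tmul, tmul_zero,
            LinearMap.zero_apply, mul_zero, zero_mul]
        | add x y hx hy =>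
          simp only [LinearMap.map_add, LinearEquiv.map_add, LinearMap.add_apply, add_tmul, hx, hy]
        | tmul a b => rfl
    have h2 : ∀ s : C ⊗[k] C, diagAux f (diag g h) s (v ⊗ₜ (w ⊗ₜ x)) =
        map (f.toLinearMap.flip v) (map (g.toLinearMap.flip w) (h.toLinearMap.flip x))
          (comul.lTensor C s) := by
      intro s
      induction s with
      | zero =>
        simp only [LinearMap.map_zero, LinearEquiv.map_zero, zero_tmul, tmul_zero,
          LinearMap.zero_apply, mul_zero, zero_mul]
      | add x y hx hy =>
        simp only [LinearMap.map_add, LinearEquiv.map_add, LinearMap.add_apply, hx, hy]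
      | tmul a b =>
        rw [diagAux_tmul, map_tmul, diag_eq, LinearMap.lTensor_tmul]
        generalize comul (R := k) b = s
        induction s with
        | zero =>
          simp only [LinearMap.map_zero, LinearEquiv.map_zero, zero_tmul, tmul_zero,
            LinearMap.zero_apply, mul_zero, zero_mul]
        | add x y hx hy =>
          simp only [LinearMap.map_add, LinearEquiv.map_add, LinearMap.add_apply, tmul_add, hx, hy]
        | tmul a b => rfl
    rw [assoc_tmul, diag_eq, diag_eq, h1, h2, Coalgebra.coassoc_apply]

theorem assoc_symm_diag {X : Type u} [AddCommGroup X] [Module k X] (f : C →ₐ[k] Module.End k V)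
    (g : C →ₐ[k] Module.End k W) (h : C →ₐ[k] Module.End k X) (c : C) (t : V ⊗[k] (W ⊗[k] X)) :
    (TensorProduct.assoc k V W X).symm (diag f (diag g h) c t) =
      diag (diag f g) h c ((TensorProduct.assoc k V W X).symm t) := by
  rw [LinearEquiv.symm_apply_eq, assoc_diag, LinearEquiv.apply_symm_apply]

theorem diag_commute {C' : Type u} [Ring C'] [Bialgebra k C'] {f : C →ₐ[k] Module.End k V}
    {g : C →ₐ[k] Module.End k W} {f' : C' →ₐ[k] Module.End k V} {g' : C' →ₐ[k] Module.End k W}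
    (hf : ∀ x y, Commute (f x) (f' y)) (hg : ∀ x y, Commute (g x) (g' y)) (x : C) (y : C') :
    Commute (diag f g x) (diag f' g' y) := by
  rw [diag_eq, diag_eq]
  generalize comul (R := k) x = s
  generalize comul (R := k) y = t
  induction s with
  | zero => simp
  | add x y hx hy => simpa only [map_add] using hx.add_left hy
  | tmul a b =>
    induction t with
    | zero => simp
    | add x y hx hy => simpa only [map_add] using hx.add_right hy
    | tmul c d =>
      rw [diagAux_tmul, diagAux_tmul]
      change map (f a) (g b) * map (f' c) (g' d) = map (f' c) (g' d) * map (f a) (g b)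
      rw [Module.End.mul_eq_comp, Module.End.mul_eq_comp, ← map_comp, ← map_comp,
        ← Module.End.mul_eq_comp, ← Module.End.mul_eq_comp, (hf a c).eq, (hg b d).eq,
        Module.End.mul_eq_comp, Module.End.mul_eq_comp]

end Diag

section Algebra

variable (k A : Type u) [Field k] [Ring A] [HopfAlgebra k A]

theorem comul_leftMul (a z : A) :
    comul (leftMul k A a z) = diag (leftMul k A) (leftMul k A) a (comul (R := k) z) := by
  change comul (a * z) = _
  rw [Bialgebra.comul_mul, diag_eq]
  generalize comul (R := k) a = s
  generalize comul (R := k) z = t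
  induction s with
  | zero =>
    simp only [LinearMap.map_zero, LinearEquiv.map_zero, zero_tmul, tmul_zero,
      LinearMap.zero_apply, mul_zero, zero_mul]
  | add x y hx hy =>
    simp only [LinearMap.map_add, LinearEquiv.map_add, LinearMap.add_apply, add_mul, hx, hy]
  | tmul a b =>
    induction t with
    | zero =>
      simp only [LinearMap.map_zero, LinearEquiv.map_zero, zero_tmul, tmul_zero,
        LinearMap.zero_apply, mul_zero, zero_mul]
    | add x y hx hy => simp only [LinearMap.map_add, LinearEquiv.map_add, mul_add, hx, hy]
    | tmul c d => simp [diagAux_tmul]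

theorem comul_rightMul (b : Aᵐᵒᵖ) (z : A) :
    comul (rightMul k A b z) = diag (rightMul k A) (rightMul k A) b (comul (R := k) z) := by
  change comul (z * b.unop) = _
  rw [Bialgebra.comul_mul, diag_eq, MulOpposite.comul_def]
  simp only [LinearMap.comp_apply, LinearEquiv.coe_coe, MulOpposite.coe_opLinearEquiv_symm]
  generalize comul (R := k) b.unop = s
  generalize comul (R := k) z = t
  induction s with
  | zero =>
    simp only [LinearMap.map_zero, LinearEquiv.map_zero, zero_tmul, tmul_zero,
      LinearMap.zero_apply, mul_zero, zero_mul]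
  | add x y hx hy =>
    simp only [LinearMap.map_add, LinearEquiv.map_add, LinearMap.add_apply, mul_add, hx, hy]
  | tmul a b =>
    induction t with
    | zero =>
      simp only [LinearMap.map_zero, LinearEquiv.map_zero, zero_tmul, tmul_zero,
        LinearMap.zero_apply, mul_zero, zero_mul]
    | add x y hx hy => simp only [LinearMap.map_add, LinearEquiv.map_add, add_mul, hx, hy]
    | tmul c d => simp [diagAux_tmul]

/-- A Hopf bimodule over `A`: an `A`-bimodule and `A`-bicomodule whose coactions are morphisms of
bimodules for the diagonal actions on `A ⊗ V` and on `V ⊗ A`. -/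
structure HopfBimodule where
  /-- The underlying vector space. -/
  V : Type u
  [grp : AddCommGroup V]
  [mod : Module k V]
  /-- The left action. -/
  lact : A →ₐ[k] Module.End k V
  /-- The right action. -/
  ract : Aᵐᵒᵖ →ₐ[k] Module.End k V
  /-- The left coaction. -/
  δL : V →ₗ[k] A ⊗[k] V
  /-- The right coaction. -/
  δR : V →ₗ[k] V ⊗[k] A
  lact_ract : ∀ a b, Commute (lact a) (ract b)
  coassocL : ∀ v, TensorProduct.assoc k A A V (comul.rTensor V (δL v)) = δL.lTensor A (δL v)
  counitL : ∀ v, counit.rTensor V (δL v) = (1 : k) ⊗ₜ v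
  coassocR : ∀ v, TensorProduct.assoc k V A A (δR.rTensor A (δR v)) = comul.lTensor V (δR v)
  counitR : ∀ v, counit.lTensor V (δR v) = v ⊗ₜ (1 : k)
  bicomod : ∀ v, TensorProduct.assoc k A V A (δL.rTensor A (δR v)) = δR.lTensor A (δL v)
  δL_lact : ∀ a v, δL (lact a v) = diag (leftMul k A) lact a (δL v)
  δL_ract : ∀ b v, δL (ract b v) = diag (rightMul k A) ract b (δL v)
  δR_lact : ∀ a v, δR (lact a v) = diag lact (leftMul k A) a (δR v)
  δR_ract : ∀ b v, δR (ract b v) = diag ract (rightMul k A) b (δR v)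

attribute [instance] HopfBimodule.grp HopfBimodule.mod

variable {k A}

/-- The space of morphisms of Hopf bimodules (morphisms of bimodules and of bicomodules). -/
def HomA4 (M N : HopfBimodule k A) : Submodule k (M.V →ₗ[k] N.V) where
  carrier := {f | (∀ a v, f (M.lact a v) = N.lact a (f v)) ∧
    (∀ b v, f (M.ract b v) = N.ract b (f v)) ∧
    (∀ v, N.δL (f v) = f.lTensor A (M.δL v)) ∧
    (∀ v, N.δR (f v) = f.rTensor A (M.δR v))}
  zero_mem' := by simp
  add_mem' := by
    rintro f g ⟨h1, h2, h3, h4⟩ ⟨h1', h2', h3', h4'⟩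
    refine ⟨fun a v => ?_, fun a v => ?_, fun v => ?_, fun v => ?_⟩
    · simp [h1, h1']
    · simp [h2, h2']
    · simp [h3, h3', LinearMap.lTensor_add]
    · simp [h4, h4', LinearMap.rTensor_add]
  smul_mem' := by
    rintro r f ⟨h1, h2, h3, h4⟩
    refine ⟨fun a v => ?_, fun a v => ?_, fun v => ?_, fun v => ?_⟩
    · simp [h1]
    · simp [h2]
    · simp [h3, LinearMap.lTensor_smul]
    · simp [h4, LinearMap.rTensor_smul]

namespace HomA4

variable {L M N P : HopfBimodule k A}

theorem map_lact (f : HomA4 M N) (a v) : f.1 (M.lact a v) = N.lact a (f.1 v) := f.2.1 a v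
theorem map_ract (f : HomA4 M N) (b v) : f.1 (M.ract b v) = N.ract b (f.1 v) := f.2.2.1 b v
theorem map_δL (f : HomA4 M N) (v) : N.δL (f.1 v) = f.1.lTensor A (M.δL v) := f.2.2.2.1 v
theorem map_δR (f : HomA4 M N) (v) : N.δR (f.1 v) = f.1.rTensor A (M.δR v) := f.2.2.2.2 v

variable (M) in
/-- The identity morphism. -/
def id : HomA4 M M :=
  ⟨LinearMap.id, fun _ _ => rfl, fun _ _ => rfl, fun _ => by simp, fun _ => by simp⟩

theorem comp_mem (f : HomA4 L M) (g : HomA4 M N) : g.1 ∘ₗ f.1 ∈ HomA4 L N :=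
  ⟨fun a v => by simp [map_lact f, map_lact g], fun a v => by simp [map_ract f, map_ract g],
    fun v => by simp only [LinearMap.comp_apply, map_δL g, map_δL f, LinearMap.lTensor_comp],
    fun v => by simp only [LinearMap.comp_apply, map_δR g, map_δR f, LinearMap.rTensor_comp]⟩

variable (N) in
/-- Composition with a morphism on the right, `β ↦ β ∘ α`. -/
def precomp (α : HomA4 L M) : HomA4 M N →ₗ[k] HomA4 L N :=
  ((LinearMap.lcomp k N.V α.1) ∘ₗ (HomA4 M N).subtype).codRestrict _ fun β => comp_mem α β

variable (L) in
/-- Composition with a morphism on the left, `α ↦ β ∘ α`. -/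
def postcomp (β : HomA4 M N) : HomA4 L M →ₗ[k] HomA4 L N :=
  ((LinearMap.llcomp k L.V M.V N.V β.1) ∘ₗ (HomA4 L M).subtype).codRestrict _ fun α => comp_mem α β

theorem precomp_val (α : HomA4 L M) (β : HomA4 M N) : (precomp N α β).1 = β.1 ∘ₗ α.1 := rfl
theorem postcomp_val (α : HomA4 L M) (β : HomA4 M N) : (postcomp L β α).1 = β.1 ∘ₗ α.1 := rfl

end HomA4

end Algebra



section Contr

variable {k A : Type u} [Field k] [Ring A] [HopfAlgebra k A]
  {V W : Type u} [AddCommGroup V] [Module k V] [AddCommGroup W] [Module k W]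

variable (V) in
/-- The contraction `a ⊗ v ↦ l(a) v` by a linear form `l`. -/
noncomputable def contrL : DualA k A →ₗ[k] A ⊗[k] V →ₗ[k] V :=
  (TensorProduct.lid k V).toLinearMap.compRight k ∘ₗ LinearMap.rTensorHom V ∘ₗ
    (toForm k A).toLinearMap

variable (V) in
/-- The contraction `v ⊗ a ↦ l(a) v` by a linear form `l`. -/
noncomputable def contrR : DualA k A →ₗ[k] V ⊗[k] A →ₗ[k] V :=
  (TensorProduct.rid k V).toLinearMap.compRight k ∘ₗ LinearMap.lTensorHom V ∘ₗ
    (toForm k A).toLinearMap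

theorem contrL_tmul (l : DualA k A) (a : A) (v : V) :
    contrL V l (a ⊗ₜ v) = toForm k A l a • v := rfl

theorem contrR_tmul (l : DualA k A) (a : A) (v : V) :
    contrR V l (v ⊗ₜ a) = toForm k A l a • v := rfl

theorem contrL_nat (l : DualA k A) (f : V →ₗ[k] W) (t : A ⊗[k] V) :
    f (contrL V l t) = contrL W l (f.lTensor A t) := by
  induction t with
  | zero =>
    simp only [LinearMap.map_zero, LinearEquiv.map_zero, zero_tmul, tmul_zero,
      LinearMap.zero_apply, mul_zero, zero_mul]
  | add x y hx hy => simp only [LinearMap.map_add, LinearEquiv.map_add, hx, hy]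
  | tmul a v => simp [contrL_tmul]

theorem contrR_nat (l : DualA k A) (f : V →ₗ[k] W) (t : V ⊗[k] A) :
    f (contrR V l t) = contrR W l (f.rTensor A t) := by
  induction t with
  | zero =>
    simp only [LinearMap.map_zero, LinearEquiv.map_zero, zero_tmul, tmul_zero,
      LinearMap.zero_apply, mul_zero, zero_mul]
  | add x y hx hy => simp only [LinearMap.map_add, LinearEquiv.map_add, hx, hy]
  | tmul a v => simp [contrR_tmul]

theorem contrL_mul (l l' : DualA k A) (t : A ⊗[k] V) :
    contrL V (dualMul k A l' l) t =
      contrL V l (contrL (A ⊗[k] V) l' (TensorProduct.assoc k A A V (comul.rTensor V t))) := by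
  induction t with
  | zero =>
    simp only [LinearMap.map_zero, LinearEquiv.map_zero, zero_tmul, tmul_zero,
      LinearMap.zero_apply, mul_zero, zero_mul]
  | add x y hx hy => simp only [LinearMap.map_add, LinearEquiv.map_add, hx, hy]
  | tmul a v =>
    rw [contrL_tmul, toForm_dualMul, conv_apply, LinearMap.rTensor_tmul]
    generalize comul (R := k) a = s
    induction s with
    | zero => simp
    | add x y hx hy =>
      simp only [LinearMap.map_add, LinearEquiv.map_add, add_smul, add_tmul, hx, hy]
    | tmul a b => simp [contrL_tmul, mul_smul]

theorem contrR_mul (l l' : DualA k A) (t : V ⊗[k] A) :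
    contrR V (dualMul k A l l') t =
      contrR V l (contrR (V ⊗[k] A) l' ((TensorProduct.assoc k V A A).symm (comul.lTensor V t))) := by
  induction t with
  | zero =>
    simp only [LinearMap.map_zero, LinearEquiv.map_zero, zero_tmul, tmul_zero,
      LinearMap.zero_apply, mul_zero, zero_mul]
  | add x y hx hy => simp only [LinearMap.map_add, LinearEquiv.map_add, hx, hy]
  | tmul v a =>
    rw [contrR_tmul, toForm_dualMul, conv_apply, LinearMap.lTensor_tmul]
    generalize comul (R := k) a = s
    induction s with
    | zero => simp
    | add x y hx hy =>
      simp only [LinearMap.map_add, LinearEquiv.map_add, add_smul, tmul_add, hx, hy]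
    | tmul a b => simp only [map_tmul, LinearMap.mul'_apply, assoc_symm_tmul, contrR_tmul, map_smul, smul_smul, mul_comm]

theorem contrL_contrR (l m : DualA k A) (t : (A ⊗[k] V) ⊗[k] A) :
    contrL V l (contrR (A ⊗[k] V) m t) =
      contrR V m (contrL (V ⊗[k] A) l (TensorProduct.assoc k A V A t)) := by
  induction t with
  | zero =>
    simp only [LinearMap.map_zero, LinearEquiv.map_zero, zero_tmul, tmul_zero,
      LinearMap.zero_apply, mul_zero, zero_mul]
  | add x y hx hy => simp only [LinearMap.map_add, LinearEquiv.map_add, hx, hy]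
  | tmul s b =>
    induction s with
    | zero =>
      simp only [LinearMap.map_zero, LinearEquiv.map_zero, zero_tmul, tmul_zero,
        LinearMap.zero_apply, mul_zero, zero_mul]
    | add x y hx hy => simp only [LinearMap.map_add, LinearEquiv.map_add, add_tmul, hx, hy]
    | tmul a v => simp only [assoc_tmul, contrL_tmul, contrR_tmul, map_smul, smul_smul, mul_comm]

theorem contrL_one (t : A ⊗[k] V) :
    contrL V (dualOne k A) t = TensorProduct.lid k V (counit.rTensor V t) := rfl

theorem contrR_one (t : V ⊗[k] A) :
    contrR V (dualOne k A) t = TensorProduct.rid k V (counit.lTensor V t) := rfl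

variable {C E : Type u} [Ring C] [Bialgebra k C] [Ring E] [Algebra k E]

theorem unit_oconv (f : C →ₗ[k] E) :
    oconv f (Algebra.linearMap k E ∘ₗ counit) = f := by
  ext c
  rw [oconv_apply]
  have h : ∀ t : C ⊗[k] C, LinearMap.mul' k E (TensorProduct.comm k E E
      (map f (Algebra.linearMap k E ∘ₗ counit) t)) =
      f (TensorProduct.rid k C (counit.lTensor C t)) := by
    intro t
    induction t with
    | zero =>
      simp only [LinearMap.map_zero, LinearEquiv.map_zero, zero_tmul, tmul_zero,
        LinearMap.zero_apply, mul_zero, zero_mul]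
    | add x y hx hy => simp only [LinearMap.map_add, LinearEquiv.map_add, hx, hy]
    | tmul x y => simp [Algebra.algebraMap_eq_smul_one]
  rw [h, Coalgebra.lTensor_counit_comul, rid_tmul, one_smul]

theorem oconv_antipodeInv {H : Type u} [Ring H] [HopfAlgebra k H] [FiniteDimensional k H]
    (f : H →ₐ[k] E) :
    oconv f.toLinearMap (f.toLinearMap ∘ₗ antipodeInv k H) = Algebra.linearMap k E ∘ₗ counit := by
  ext c
  rw [oconv_apply]
  have h : ∀ t : H ⊗[k] H, LinearMap.mul' k E (TensorProduct.comm k E E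
      (map f.toLinearMap (f.toLinearMap ∘ₗ antipodeInv k H) t)) =
      f (LinearMap.mul' k H (TensorProduct.comm k H H ((antipodeInv k H).lTensor H t))) := by
    intro t
    induction t with
    | zero => simp
    | add x y hx hy => simp only [map_add, hx, hy]
    | tmul x y => simp
  rw [h, antipodeInv_mul_swap]
  simp

end Contr

section Rep

variable {k A : Type u} [Field k] [Ring A] [HopfAlgebra k A]

/-- The action `(a ⊗ b) v = a v b` of `A ⊗ Aᵒᵖ` on a Hopf bimodule. -/
noncomputable def HopfBimodule.biact (M : HopfBimodule k A) :
    A ⊗[k] Aᵐᵒᵖ →ₐ[k] Module.End k M.V :=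
  Algebra.TensorProduct.lift M.lact M.ract M.lact_ract

theorem HopfBimodule.biact_tmul (M : HopfBimodule k A) (a b) :
    M.biact (a ⊗ₜ b) = M.lact a * M.ract b := by simp [HopfBimodule.biact]

theorem diagAux_mul {C : Type u} [Ring C] [Bialgebra k C]
    {V W : Type u} [AddCommGroup V] [Module k V] [AddCommGroup W] [Module k W]
    (f : C →ₐ[k] Module.End k V) (g : C →ₐ[k] Module.End k W) (s t : C ⊗[k] C) :
    diagAux f g (s * t) = diagAux f g s * diagAux f g t := map_mul
      ((Module.endTensorEndAlgHom (R := k) (S := k) (A := k)).comp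
        (Algebra.TensorProduct.map f g)) s t

theorem diag_tensor {V W : Type u} [AddCommGroup V] [Module k V] [AddCommGroup W] [Module k W]
    {f : A →ₐ[k] Module.End k V} {f' : Aᵐᵒᵖ →ₐ[k] Module.End k V} {g : A →ₐ[k] Module.End k W}
    {g' : Aᵐᵒᵖ →ₐ[k] Module.End k W} (hf : ∀ x y, Commute (f x) (f' y))
    (hg : ∀ x y, Commute (g x) (g' y)) (a : A) (b : Aᵐᵒᵖ) :
    diag (Algebra.TensorProduct.lift f f' hf) (Algebra.TensorProduct.lift g g' hg) (a ⊗ₜ[k] b) =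
      diag f g a * diag f' g' b := by
  rw [diag_eq, diag_eq, diag_eq, TensorProduct.comul_tmul]
  generalize comul (R := k) a = s
  generalize comul (R := k) b = t
  induction s with
  | zero =>
    simp only [LinearMap.map_zero, LinearEquiv.map_zero, zero_tmul, tmul_zero,
      LinearMap.zero_apply, mul_zero, zero_mul]
  | add x y hx hy => simp only [LinearMap.map_add, LinearEquiv.map_add, add_mul, add_tmul, hx, hy]
  | tmul s₁ s₂ =>
    induction t with
    | zero =>
      simp only [LinearMap.map_zero, LinearEquiv.map_zero, zero_tmul, tmul_zero,
        LinearMap.zero_apply, mul_zero, zero_mul]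
    | add x y hx hy => simp only [LinearMap.map_add, LinearEquiv.map_add, mul_add, tmul_add, hx, hy]
    | tmul t₁ t₂ =>
      rw [AlgebraTensorModule.tensorTensorTensorComm_tmul, diagAux_tmul, diagAux_tmul,
        diagAux_tmul, Algebra.TensorProduct.lift_tmul, Algebra.TensorProduct.lift_tmul,
        Module.End.mul_eq_comp, Module.End.mul_eq_comp, map_comp, Module.End.mul_eq_comp]

theorem HopfBimodule.δL_biact (M : HopfBimodule k A) (c : A ⊗[k] Aᵐᵒᵖ) (v : M.V) :
    M.δL (M.biact c v) = diag (regAct k A) M.biact c (M.δL v) := by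
  induction c with
  | zero => simp
  | add x y hx hy => simp only [map_add, LinearMap.add_apply, hx, hy]
  | tmul a b =>
    rw [biact_tmul, Module.End.mul_apply, M.δL_lact, M.δL_ract, regAct, biact, diag_tensor,
      Module.End.mul_apply]

theorem HopfBimodule.δR_biact (M : HopfBimodule k A) (c : A ⊗[k] Aᵐᵒᵖ) (v : M.V) :
    M.δR (M.biact c v) = diag M.biact (regAct k A) c (M.δR v) := by
  induction c with
  | zero => simp
  | add x y hx hy => simp only [map_add, LinearMap.add_apply, hx, hy]
  | tmul a b =>
    rw [biact_tmul, Module.End.mul_apply, M.δR_lact, M.δR_ract, regAct, biact, diag_tensor,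
      Module.End.mul_apply]

theorem diag_toLinearMap {C : Type u} [Ring C] [Bialgebra k C]
    {V W : Type u} [AddCommGroup V] [Module k V] [AddCommGroup W] [Module k W]
    (f : C →ₐ[k] Module.End k V) (g : C →ₐ[k] Module.End k W) :
    (diag f g).toLinearMap = conv ((Module.End.rTensorAlgHom k V W).comp f).toLinearMap
      ((Module.End.lTensorAlgHom k W V).comp g).toLinearMap := by
  ext c : 1
  rw [conv_apply, AlgHom.toLinearMap_apply, diag_eq]
  generalize comul (R := k) c = s
  induction s with
  | zero =>
    simp only [LinearMap.map_zero, LinearEquiv.map_zero, zero_tmul, tmul_zero,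
      LinearMap.zero_apply, mul_zero, zero_mul]
  | add x y hx hy => simp only [LinearMap.map_add, LinearEquiv.map_add, hx, hy]
  | tmul x y => 
    rw [diagAux_tmul]
    refine TensorProduct.ext' fun v w => rfl

variable [FiniteDimensional k A]

/-- The action of `X` on a Hopf bimodule `M`: `l ∈ A*ᵒᵖ` acts by `v ↦ ∑ l(v₋₁) v₀`, `m ∈ A*` acts by
`v ↦ ∑ m(v₁) v₀`, and `a ⊗ b ∈ A ⊗ Aᵒᵖ` acts by `v ↦ a v b`. -/
noncomputable def HopfBimodule.xRep (M : HopfBimodule k A) : XRep k A M.V where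
  actL := LinearMap.lcomp k M.V M.δL ∘ₗ contrL M.V
  actR := LinearMap.lcomp k M.V M.δR ∘ₗ contrR M.V
  act := M.biact
  actL_one := LinearMap.ext fun v => by
    change contrL M.V _ (M.δL v) = v
    rw [contrL_one, M.counitL, lid_tmul, one_smul]
  actR_one := LinearMap.ext fun v => by
    change contrR M.V _ (M.δR v) = v
    rw [contrR_one, M.counitR, rid_tmul, one_smul]
  actL_mul l l' := LinearMap.ext fun v => by
    change contrL M.V _ (M.δL v) = contrL M.V _ (M.δL (contrL M.V _ (M.δL v)))
    rw [contrL_mul, contrL_nat l' M.δL, M.coassocL]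
  actR_mul l l' := LinearMap.ext fun v => by
    change contrR M.V _ (M.δR v) = contrR M.V _ (M.δR (contrR M.V _ (M.δR v)))
    rw [contrR_mul, contrR_nat l' M.δR, ← M.coassocR, LinearEquiv.symm_apply_apply]
  actL_actR l m := LinearMap.ext fun v => by
    change contrL M.V _ (M.δL (contrR M.V _ (M.δR v))) =
      contrR M.V _ (M.δR (contrL M.V _ (M.δL v)))
    rw [contrL_nat, contrR_nat, contrL_contrR, M.bicomod]
  act_actL c l := by
    set p₁ := (Module.End.rTensorAlgHom k A M.V).comp (regAct k A)
    set p₂ := (Module.End.lTensorAlgHom k M.V A).comp M.biact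
    have h : ∀ (t : (A ⊗[k] Aᵐᵒᵖ) ⊗[k] (A ⊗[k] Aᵐᵒᵖ)) v,
        LinearMap.mul' k _ (map ((LinearMap.lcomp k M.V M.δL ∘ₗ contrL M.V) ∘ₗ
          (twistL k A).toLinearMap.flip l) M.biact.toLinearMap t) v =
        contrL M.V l (LinearMap.mul' k (Module.End k (A ⊗[k] M.V)) (map (p₁.toLinearMap ∘ₗ antipode k)
          (diag (regAct k A) M.biact).toLinearMap t) (M.δL v)) := by
      intro t v
      induction t with
      | zero =>
        simp only [LinearMap.map_zero, LinearEquiv.map_zero, zero_tmul, tmul_zero,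
          LinearMap.zero_apply, mul_zero, zero_mul]
      | add x y hx hy =>
        simp only [LinearMap.map_add, LinearEquiv.map_add, LinearMap.add_apply, hx, hy]
      | tmul x y =>
        change contrL M.V (twistL k A x l) (M.δL (M.biact y v)) =
          contrL M.V l (p₁ (antipode k x) (diag (regAct k A) M.biact y (M.δL v)))
        rw [M.δL_biact]
        generalize (diag (regAct k A) M.biact y) (M.δL v) = z
        induction z with
        | zero =>
          simp only [LinearMap.map_zero, LinearEquiv.map_zero, zero_tmul, tmul_zero,
            LinearMap.zero_apply, mul_zero, zero_mul]
        | add x y hx hy => simp only [LinearMap.map_add, LinearEquiv.map_add, hx, hy]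
        | tmul a w => rfl
    refine LinearMap.ext fun v => ?_
    rw [h, ← conv_apply, diag_toLinearMap, ← conv_assoc, antipode_conv, unit_conv]
    exact contrL_nat _ _ _
  act_actR c m := by
    set q₁ := (Module.End.rTensorAlgHom k M.V A).comp M.biact
    set q₂ := (Module.End.lTensorAlgHom k A M.V).comp (regAct k A)
    have hq : conv q₁.toLinearMap q₂.toLinearMap = oconv q₁.toLinearMap q₂.toLinearMap :=
      conv_eq_oconv _ _ fun x y => TensorProduct.ext' fun v w => rfl
    have h : ∀ (t : (A ⊗[k] Aᵐᵒᵖ) ⊗[k] (A ⊗[k] Aᵐᵒᵖ)) v,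
        LinearMap.mul' k _ (TensorProduct.comm k _ _ (map M.biact.toLinearMap
          ((LinearMap.lcomp k M.V M.δR ∘ₗ contrR M.V) ∘ₗ (twistR k A).toLinearMap.flip m) t)) v =
        contrR M.V m (LinearMap.mul' k (Module.End k (M.V ⊗[k] A)) (TensorProduct.comm k _ _
          (map (oconv q₁.toLinearMap q₂.toLinearMap) (q₂.toLinearMap ∘ₗ antipodeInv k _) t))
            (M.δR v)) := by
      intro t v
      induction t with
      | zero =>
        simp only [LinearMap.map_zero, LinearEquiv.map_zero, zero_tmul, tmul_zero,
          LinearMap.zero_apply, mul_zero, zero_mul]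
      | add x y hx hy =>
        simp only [LinearMap.map_add, LinearEquiv.map_add, LinearMap.add_apply, hx, hy]
      | tmul x y =>
        rw [← hq, ← diag_toLinearMap]
        change contrR M.V (twistR k A y m) (M.δR (M.biact x v)) =
          contrR M.V m (q₂ (antipodeInv k _ y) (diag M.biact (regAct k A) x (M.δR v)))
        rw [M.δR_biact]
        generalize (diag M.biact (regAct k A) x) (M.δR v) = z
        induction z with
        | zero =>
          simp only [LinearMap.map_zero, LinearEquiv.map_zero, zero_tmul, tmul_zero,
            LinearMap.zero_apply, mul_zero, zero_mul]
        | add x y hx hy => simp only [LinearMap.map_add, LinearEquiv.map_add, hx, hy]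
        | tmul a w => rfl
    refine LinearMap.ext fun v => ?_
    rw [h, ← oconv_apply, oconv_assoc, oconv_antipodeInv, unit_oconv]
    exact contrR_nat _ _ _

/-- A Hopf bimodule as an `X`-module. -/
def HopfBimodule.XMod (M : HopfBimodule k A) : Type u := M.V

noncomputable instance (M : HopfBimodule k A) : AddCommGroup M.XMod := M.grp
noncomputable instance (M : HopfBimodule k A) : Module (AlgX k A) M.XMod :=
  Module.compHom M.V M.xRep.algHom.toRingHom

theorem HopfBimodule.smul_def (M : HopfBimodule k A) (x : AlgX k A) (v : M.V) :
    (show M.V from (x • (show M.XMod from v))) = M.xRep.hom x v := rfl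

theorem HomA4.map_hom {M N : HopfBimodule k A} (f : HomA4 M N) (x : AlgX k A) (v : M.V) :
    f.1 (M.xRep.hom x v) = N.xRep.hom x (f.1 v) := by
  induction x using xInduction with
  | zero =>
    simp only [LinearMap.map_zero, LinearEquiv.map_zero, zero_tmul, tmul_zero,
      LinearMap.zero_apply, mul_zero, zero_mul]
  | add x y hx hy => simp only [LinearMap.map_add, LinearEquiv.map_add, LinearMap.add_apply, hx, hy]
  | mk l m c =>
    simp only [XRep.hom_mk, Module.End.mul_apply]
    change f.1 (contrL M.V l (M.δL (contrR M.V m (M.δR (M.biact c v))))) =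
      contrL N.V l (N.δL (contrR N.V m (N.δR (N.biact c (f.1 v)))))
    have hc : f.1 (M.biact c v) = N.biact c (f.1 v) := by
      induction c with
      | zero => simp
      | add x y hx hy => simp only [map_add, LinearMap.add_apply, hx, hy]
      | tmul a b => simp [HopfBimodule.biact_tmul, HomA4.map_lact f, HomA4.map_ract f]
    rw [← hc, HomA4.map_δR f, ← contrR_nat, HomA4.map_δL f, ← contrL_nat]

/-- A Hopf bimodule as an object of the category of `X`-modules. -/
noncomputable def toX (M : HopfBimodule k A) : ModuleCat.{u} (AlgX k A) :=
  ModuleCat.of (AlgX k A) M.XMod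

/-- A morphism of Hopf bimodules as a morphism of `X`-modules. -/
noncomputable def toXMap {M N : HopfBimodule k A} (f : HomA4 M N) : toX M ⟶ toX N :=
  ModuleCat.ofHom (X := M.XMod) (Y := N.XMod)
    { toFun := f.1
      map_add' := f.1.map_add
      map_smul' := HomA4.map_hom f }

/-- `0 → L → M → N → 0` is a short exact sequence of Hopf bimodules. -/
structure IsShortExact {L M N : HopfBimodule k A} (i : HomA4 L M) (p : HomA4 M N) : Prop where
  inj : Function.Injective i.1
  exact : Function.Exact i.1 p.1
  surj : Function.Surjective p.1

theorem IsShortExact.zero {L M N : HopfBimodule k A} {i : HomA4 L M} {p : HomA4 M N}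
    (h : IsShortExact i p) : toXMap i ≫ toXMap p = 0 :=
  ModuleCat.hom_ext (LinearMap.ext fun x => h.exact.apply_apply_eq_zero x)

/-- The short complex of `X`-modules given by a short exact sequence of Hopf bimodules. -/
noncomputable def IsShortExact.toX {L M N : HopfBimodule k A} {i : HomA4 L M} {p : HomA4 M N}
    (h : IsShortExact i p) : ShortComplex (ModuleCat.{u} (AlgX k A)) :=
  ShortComplex.mk (toXMap i) (toXMap p) h.zero

theorem IsShortExact.shortExact {L M N : HopfBimodule k A} {i : HomA4 L M} {p : HomA4 M N}
    (h : IsShortExact i p) : h.toX.ShortExact :=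
  ModuleCat.shortComplex_shortExact h.toX h.exact h.inj h.surj

/-- The class in `Ext_X^1(N, L)` of a short exact sequence `0 → L → M → N → 0` of Hopf bimodules. -/
noncomputable def IsShortExact.extClass {L M N : HopfBimodule k A} {i : HomA4 L M} {p : HomA4 M N}
    (h : IsShortExact i p) : Ext (HopfBimod.toX N) (HopfBimod.toX L) 1 := h.shortExact.extClass

end Rep



section Codiag

variable {k A : Type u} [Field k] [Ring A] [HopfAlgebra k A]
  {V W V' W' : Type u} [AddCommGroup V] [Module k V] [AddCommGroup W] [Module k W]
  [AddCommGroup V'] [Module k V'] [AddCommGroup W'] [Module k W']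

variable (A V W) in
/-- `(a ⊗ v) ⊗ (b ⊗ w) ↦ ab ⊗ (v ⊗ w)` -/
noncomputable def shufL : (A ⊗[k] V) ⊗[k] (A ⊗[k] W) →ₗ[k] A ⊗[k] (V ⊗[k] W) :=
  map (LinearMap.mul' k A) LinearMap.id ∘ₗ (tensorTensorTensorComm k A V A W).toLinearMap

variable (A V W) in
/-- `(v ⊗ a) ⊗ (w ⊗ b) ↦ (v ⊗ w) ⊗ ab` -/
noncomputable def shufR : (V ⊗[k] A) ⊗[k] (W ⊗[k] A) →ₗ[k] (V ⊗[k] W) ⊗[k] A :=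
  map LinearMap.id (LinearMap.mul' k A) ∘ₗ (tensorTensorTensorComm k V A W A).toLinearMap

theorem shufL_tmul (a b : A) (v : V) (w : W) :
    shufL A V W ((a ⊗ₜ[k] v) ⊗ₜ[k] (b ⊗ₜ[k] w)) = (a * b) ⊗ₜ (v ⊗ₜ w) := rfl

theorem shufR_tmul (a b : A) (v : V) (w : W) :
    shufR A V W ((v ⊗ₜ[k] a) ⊗ₜ[k] (w ⊗ₜ[k] b)) = (v ⊗ₜ w) ⊗ₜ (a * b) := rfl

/-- The codiagonal left coaction `v ⊗ w ↦ ∑ v₋₁ w₋₁ ⊗ (v₀ ⊗ w₀)`. -/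
noncomputable def codiagL (δ : V →ₗ[k] A ⊗[k] V) (δ' : W →ₗ[k] A ⊗[k] W) :
    V ⊗[k] W →ₗ[k] A ⊗[k] (V ⊗[k] W) :=
  shufL A V W ∘ₗ map δ δ'

/-- The codiagonal right coaction `v ⊗ w ↦ ∑ (v₀ ⊗ w₀) ⊗ v₁ w₁`. -/
noncomputable def codiagR (δ : V →ₗ[k] V ⊗[k] A) (δ' : W →ₗ[k] W ⊗[k] A) :
    V ⊗[k] W →ₗ[k] (V ⊗[k] W) ⊗[k] A :=
  shufR A V W ∘ₗ map δ δ'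

theorem codiagL_tmul (δ : V →ₗ[k] A ⊗[k] V) (δ' : W →ₗ[k] A ⊗[k] W) (v w) :
    codiagL δ δ' (v ⊗ₜ w) = shufL A V W (δ v ⊗ₜ δ' w) := rfl

theorem codiagR_tmul (δ : V →ₗ[k] V ⊗[k] A) (δ' : W →ₗ[k] W ⊗[k] A) (v w) :
    codiagR δ δ' (v ⊗ₜ w) = shufR A V W (δ v ⊗ₜ δ' w) := rfl

theorem shufL_nat (f : V →ₗ[k] V') (g : W →ₗ[k] W') (s : A ⊗[k] V) (t : A ⊗[k] W) :
    (map f g).lTensor A (shufL A V W (s ⊗ₜ t)) =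
      shufL A V' W' (f.lTensor A s ⊗ₜ g.lTensor A t) := by
  induction s with
  | zero =>
    simp only [LinearMap.map_zero, LinearEquiv.map_zero, zero_tmul, tmul_zero,
      LinearMap.zero_apply, mul_zero, zero_mul]
  | add x y hx hy => simp only [LinearMap.map_add, LinearEquiv.map_add, add_tmul, hx, hy]
  | tmul a v =>
    induction t with
    | zero =>
      simp only [LinearMap.map_zero, LinearEquiv.map_zero, zero_tmul, tmul_zero,
        LinearMap.zero_apply, mul_zero, zero_mul]
    | add x y hx hy => simp only [LinearMap.map_add, LinearEquiv.map_add, tmul_add, hx, hy]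
    | tmul b w => rfl

theorem shufR_nat (f : V →ₗ[k] V') (g : W →ₗ[k] W') (s : V ⊗[k] A) (t : W ⊗[k] A) :
    (map f g).rTensor A (shufR A V W (s ⊗ₜ t)) =
      shufR A V' W' (f.rTensor A s ⊗ₜ g.rTensor A t) := by
  induction s with
  | zero =>
    simp only [LinearMap.map_zero, LinearEquiv.map_zero, zero_tmul, tmul_zero,
      LinearMap.zero_apply, mul_zero, zero_mul]
  | add x y hx hy => simp only [LinearMap.map_add, LinearEquiv.map_add, add_tmul, hx, hy]
  | tmul a v =>
    induction t with
    | zero =>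
      simp only [LinearMap.map_zero, LinearEquiv.map_zero, zero_tmul, tmul_zero,
        LinearMap.zero_apply, mul_zero, zero_mul]
    | add x y hx hy => simp only [LinearMap.map_add, LinearEquiv.map_add, tmul_add, hx, hy]
    | tmul b w => rfl

theorem shufL_comul (s : A ⊗[k] V) (t : A ⊗[k] W) :
    TensorProduct.assoc k A A _ (comul.rTensor _ (shufL A V W (s ⊗ₜ t))) =
      (shufL A V W).lTensor A (shufL A _ _ (TensorProduct.assoc k A A V (comul.rTensor _ s) ⊗ₜ
        TensorProduct.assoc k A A W (comul.rTensor _ t))) := by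
  induction s with
  | zero =>
    simp only [LinearMap.map_zero, LinearEquiv.map_zero, zero_tmul, tmul_zero,
      LinearMap.zero_apply, mul_zero, zero_mul]
  | add x y hx hy => simp only [LinearMap.map_add, LinearEquiv.map_add, add_tmul, hx, hy]
  | tmul a v =>
    induction t with
    | zero =>
      simp only [LinearMap.map_zero, LinearEquiv.map_zero, zero_tmul, tmul_zero,
        LinearMap.zero_apply, mul_zero, zero_mul]
    | add x y hx hy => simp only [LinearMap.map_add, LinearEquiv.map_add, tmul_add, hx, hy]
    | tmul b w =>
      rw [shufL_tmul, LinearMap.rTensor_tmul, LinearMap.rTensor_tmul, LinearMap.rTensor_tmul,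
        Bialgebra.comul_mul]
      generalize comul (R := k) a = s
      generalize comul (R := k) b = t
      induction s with
      | zero =>
        simp only [LinearMap.map_zero, LinearEquiv.map_zero, zero_tmul, tmul_zero,
          LinearMap.zero_apply, mul_zero, zero_mul]
      | add x y hx hy =>
        simp only [LinearMap.map_add, LinearEquiv.map_add, add_tmul, add_mul, hx, hy]
      | tmul a v =>
        induction t with
        | zero =>
          simp only [LinearMap.map_zero, LinearEquiv.map_zero, zero_tmul, tmul_zero,
            LinearMap.zero_apply, mul_zero, zero_mul]
        | add x y hx hy =>
          simp only [LinearMap.map_add, LinearEquiv.map_add, tmul_add, add_tmul, mul_add, hx, hy]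
        | tmul b w => rw [Algebra.TensorProduct.tmul_mul_tmul]; rfl

theorem shufR_comul (s : V ⊗[k] A) (t : W ⊗[k] A) :
    (TensorProduct.assoc k _ A A).symm (comul.lTensor _ (shufR A V W (s ⊗ₜ t))) =
      (shufR A V W).rTensor A (shufR A _ _ ((TensorProduct.assoc k V A A).symm (comul.lTensor _ s)
        ⊗ₜ (TensorProduct.assoc k W A A).symm (comul.lTensor _ t))) := by
  induction s with
  | zero =>
    simp only [LinearMap.map_zero, LinearEquiv.map_zero, zero_tmul, tmul_zero,
      LinearMap.zero_apply, mul_zero, zero_mul]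
  | add x y hx hy => simp only [LinearMap.map_add, LinearEquiv.map_add, add_tmul, hx, hy]
  | tmul v a =>
    induction t with
    | zero =>
      simp only [LinearMap.map_zero, LinearEquiv.map_zero, zero_tmul, tmul_zero,
        LinearMap.zero_apply, mul_zero, zero_mul]
    | add x y hx hy => simp only [LinearMap.map_add, LinearEquiv.map_add, tmul_add, hx, hy]
    | tmul w b =>
      rw [shufR_tmul, LinearMap.lTensor_tmul, LinearMap.lTensor_tmul, LinearMap.lTensor_tmul,
        Bialgebra.comul_mul]
      generalize comul (R := k) a = s
      generalize comul (R := k) b = t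
      induction s with
      | zero =>
        simp only [LinearMap.map_zero, LinearEquiv.map_zero, zero_tmul, tmul_zero,
          LinearMap.zero_apply, mul_zero, zero_mul]
      | add x y hx hy =>
        simp only [LinearMap.map_add, LinearEquiv.map_add, add_tmul, tmul_add, add_mul, hx, hy]
      | tmul a v =>
        induction t with
        | zero =>
          simp only [LinearMap.map_zero, LinearEquiv.map_zero, zero_tmul, tmul_zero,
            LinearMap.zero_apply, mul_zero, zero_mul]
        | add x y hx hy =>
          simp only [LinearMap.map_add, LinearEquiv.map_add, tmul_add, mul_add, hx, hy]
        | tmul b w => rw [Algebra.TensorProduct.tmul_mul_tmul]; rfl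

theorem shufL_counit (s : A ⊗[k] V) (t : A ⊗[k] W) :
    TensorProduct.lid k _ (counit.rTensor _ (shufL A V W (s ⊗ₜ t))) =
      TensorProduct.lid k _ (counit.rTensor _ s) ⊗ₜ TensorProduct.lid k _ (counit.rTensor _ t) := by
  induction s with
  | zero =>
    simp only [LinearMap.map_zero, LinearEquiv.map_zero, zero_tmul, tmul_zero,
      LinearMap.zero_apply, mul_zero, zero_mul]
  | add x y hx hy => simp only [LinearMap.map_add, LinearEquiv.map_add, add_tmul, hx, hy]
  | tmul a v =>
    induction t with
    | zero =>
      simp only [LinearMap.map_zero, LinearEquiv.map_zero, zero_tmul, tmul_zero,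
        LinearMap.zero_apply, mul_zero, zero_mul]
    | add x y hx hy => simp only [LinearMap.map_add, LinearEquiv.map_add, tmul_add, hx, hy]
    | tmul b w => simp [shufL_tmul, smul_tmul', smul_smul, mul_comm]

theorem shufR_counit (s : V ⊗[k] A) (t : W ⊗[k] A) :
    TensorProduct.rid k _ (counit.lTensor _ (shufR A V W (s ⊗ₜ t))) =
      TensorProduct.rid k _ (counit.lTensor _ s) ⊗ₜ TensorProduct.rid k _ (counit.lTensor _ t) := by
  induction s with
  | zero =>
    simp only [LinearMap.map_zero, LinearEquiv.map_zero, zero_tmul, tmul_zero,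
      LinearMap.zero_apply, mul_zero, zero_mul]
  | add x y hx hy => simp only [LinearMap.map_add, LinearEquiv.map_add, add_tmul, hx, hy]
  | tmul a v =>
    induction t with
    | zero =>
      simp only [LinearMap.map_zero, LinearEquiv.map_zero, zero_tmul, tmul_zero,
        LinearMap.zero_apply, mul_zero, zero_mul]
    | add x y hx hy => simp only [LinearMap.map_add, LinearEquiv.map_add, tmul_add, hx, hy]
    | tmul b w => simp [shufR_tmul, smul_tmul', smul_smul, mul_comm]

theorem codiagL_coassoc {δ : V →ₗ[k] A ⊗[k] V} {δ' : W →ₗ[k] A ⊗[k] W}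
    (h : ∀ v, TensorProduct.assoc k A A V (comul.rTensor V (δ v)) = δ.lTensor A (δ v))
    (h' : ∀ v, TensorProduct.assoc k A A W (comul.rTensor W (δ' v)) = δ'.lTensor A (δ' v)) (x) :
    TensorProduct.assoc k A A _ (comul.rTensor _ (codiagL δ δ' x)) =
      (codiagL δ δ').lTensor A (codiagL δ δ' x) := by
  induction x with
  | zero =>
    simp only [LinearMap.map_zero, LinearEquiv.map_zero, zero_tmul, tmul_zero,
      LinearMap.zero_apply, mul_zero, zero_mul]
  | add x y hx hy => simp only [LinearMap.map_add, LinearEquiv.map_add, hx, hy]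
  | tmul v w =>
    rw [codiagL_tmul, shufL_comul, h, h', codiagL, LinearMap.lTensor_comp_apply, shufL_nat]

theorem codiagR_coassoc {δ : V →ₗ[k] V ⊗[k] A} {δ' : W →ₗ[k] W ⊗[k] A}
    (h : ∀ v, TensorProduct.assoc k V A A (δ.rTensor A (δ v)) = comul.lTensor V (δ v))
    (h' : ∀ v, TensorProduct.assoc k W A A (δ'.rTensor A (δ' v)) = comul.lTensor W (δ' v)) (x) :
    TensorProduct.assoc k _ A A ((codiagR δ δ').rTensor A (codiagR δ δ' x)) =
      comul.lTensor _ (codiagR δ δ' x) := by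
  rw [← LinearEquiv.eq_symm_apply]
  induction x with
  | zero =>
    simp only [LinearMap.map_zero, LinearEquiv.map_zero, zero_tmul, tmul_zero,
      LinearMap.zero_apply, mul_zero, zero_mul]
  | add x y hx hy => simp only [LinearMap.map_add, LinearEquiv.map_add, hx, hy]
  | tmul v w =>
    rw [codiagR_tmul, shufR_comul, ← h, ← h', codiagR, LinearMap.rTensor_comp_apply, shufR_nat,
      LinearEquiv.symm_apply_apply, LinearEquiv.symm_apply_apply]

theorem codiagL_counit {δ : V →ₗ[k] A ⊗[k] V} {δ' : W →ₗ[k] A ⊗[k] W}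
    (h : ∀ v, counit.rTensor V (δ v) = (1 : k) ⊗ₜ v)
    (h' : ∀ v, counit.rTensor W (δ' v) = (1 : k) ⊗ₜ v) (x) :
    counit.rTensor _ (codiagL δ δ' x) = (1 : k) ⊗ₜ x := by
  apply (TensorProduct.lid k _).injective
  induction x with
  | zero =>
    simp only [LinearMap.map_zero, LinearEquiv.map_zero, zero_tmul, tmul_zero,
      LinearMap.zero_apply, mul_zero, zero_mul]
  | add x y hx hy => simp only [LinearMap.map_add, LinearEquiv.map_add, tmul_add, hx, hy]
  | tmul v w => rw [codiagL_tmul, shufL_counit, h, h']; simp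

theorem codiagR_counit {δ : V →ₗ[k] V ⊗[k] A} {δ' : W →ₗ[k] W ⊗[k] A}
    (h : ∀ v, counit.lTensor V (δ v) = v ⊗ₜ (1 : k))
    (h' : ∀ v, counit.lTensor W (δ' v) = v ⊗ₜ (1 : k)) (x) :
    counit.lTensor _ (codiagR δ δ' x) = x ⊗ₜ (1 : k) := by
  apply (TensorProduct.rid k _).injective
  induction x with
  | zero =>
    simp only [LinearMap.map_zero, LinearEquiv.map_zero, zero_tmul, tmul_zero,
      LinearMap.zero_apply, mul_zero, zero_mul]
  | add x y hx hy => simp only [LinearMap.map_add, LinearEquiv.map_add, add_tmul, hx, hy]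
  | tmul v w => rw [codiagR_tmul, shufR_counit, h, h']; simp

theorem shuf_bicomod (δ : V →ₗ[k] A ⊗[k] V) (δ' : W →ₗ[k] A ⊗[k] W) (s : V ⊗[k] A) (t : W ⊗[k] A) :
    TensorProduct.assoc k A _ A ((codiagL δ δ').rTensor A (shufR A V W (s ⊗ₜ t))) =
      (shufR A V W).lTensor A (shufL A _ _ (TensorProduct.assoc k A V A (δ.rTensor A s) ⊗ₜ
        TensorProduct.assoc k A W A (δ'.rTensor A t))) := by
  induction s with
  | zero =>
    simp only [LinearMap.map_zero, LinearEquiv.map_zero, zero_tmul, tmul_zero,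
      LinearMap.zero_apply, mul_zero, zero_mul]
  | add x y hx hy => simp only [LinearMap.map_add, LinearEquiv.map_add, add_tmul, hx, hy]
  | tmul v a =>
    induction t with
    | zero =>
      simp only [LinearMap.map_zero, LinearEquiv.map_zero, zero_tmul, tmul_zero,
        LinearMap.zero_apply, mul_zero, zero_mul]
    | add x y hx hy => simp only [LinearMap.map_add, LinearEquiv.map_add, tmul_add, hx, hy]
    | tmul w b =>
      rw [shufR_tmul, LinearMap.rTensor_tmul, LinearMap.rTensor_tmul, LinearMap.rTensor_tmul,
        codiagL_tmul]
      generalize δ v = s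
      generalize δ' w = t
      induction s with
      | zero =>
        simp only [LinearMap.map_zero, LinearEquiv.map_zero, zero_tmul, tmul_zero,
          LinearMap.zero_apply, mul_zero, zero_mul]
      | add x y hx hy => simp only [LinearMap.map_add, LinearEquiv.map_add, add_tmul, hx, hy]
      | tmul c v =>
        induction t with
        | zero =>
          simp only [LinearMap.map_zero, LinearEquiv.map_zero, zero_tmul, tmul_zero,
            LinearMap.zero_apply, mul_zero, zero_mul]
        | add x y hx hy =>
          simp only [LinearMap.map_add, LinearEquiv.map_add, tmul_add, add_tmul, hx, hy]
        | tmul d w => rfl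

theorem codiag_bicomod {δL : V →ₗ[k] A ⊗[k] V} {δL' : W →ₗ[k] A ⊗[k] W} {δR : V →ₗ[k] V ⊗[k] A}
    {δR' : W →ₗ[k] W ⊗[k] A}
    (h : ∀ v, TensorProduct.assoc k A V A (δL.rTensor A (δR v)) = δR.lTensor A (δL v))
    (h' : ∀ v, TensorProduct.assoc k A W A (δL'.rTensor A (δR' v)) = δR'.lTensor A (δL' v)) (x) :
    TensorProduct.assoc k A _ A ((codiagL δL δL').rTensor A (codiagR δR δR' x)) =
      (codiagR δR δR').lTensor A (codiagL δL δL' x) := by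
  induction x with
  | zero =>
    simp only [LinearMap.map_zero, LinearEquiv.map_zero, zero_tmul, tmul_zero,
      LinearMap.zero_apply, mul_zero, zero_mul]
  | add x y hx hy => simp only [LinearMap.map_add, LinearEquiv.map_add, hx, hy]
  | tmul v w =>
    rw [codiagR_tmul, shuf_bicomod, h, h', codiagL_tmul, codiagR, LinearMap.lTensor_comp_apply,
      shufL_nat]

theorem shufL_lact (f : A →ₐ[k] Module.End k V) (a : A) (s : A ⊗[k] V) (t : A ⊗[k] W) :
    shufL A V W (diag (leftMul k A) f a s ⊗ₜ t) =
      diag (leftMul k A) ((Module.End.rTensorAlgHom k V W).comp f) a (shufL A V W (s ⊗ₜ t)) := by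
  rw [diag_eq, diag_eq]
  generalize comul (R := k) a = c
  induction c with
  | zero =>
    simp only [LinearMap.map_zero, LinearEquiv.map_zero, zero_tmul, tmul_zero,
      LinearMap.zero_apply, mul_zero, zero_mul]
  | add x y hx hy =>
    simp only [LinearMap.map_add, LinearEquiv.map_add, add_tmul, LinearMap.add_apply, hx, hy]
  | tmul a b =>
  induction s with
  | zero =>
    simp only [LinearMap.map_zero, LinearEquiv.map_zero, zero_tmul, tmul_zero,
      LinearMap.zero_apply, mul_zero, zero_mul]
  | add x y hx hy => simp only [LinearMap.map_add, LinearEquiv.map_add, add_tmul, hx, hy]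
  | tmul a v =>
    induction t with
    | zero =>
      simp only [LinearMap.map_zero, LinearEquiv.map_zero, zero_tmul, tmul_zero,
        LinearMap.zero_apply, mul_zero, zero_mul]
    | add x y hx hy => simp only [LinearMap.map_add, LinearEquiv.map_add, tmul_add, hx, hy]
    | tmul b w => simp only [diagAux_tmul, map_tmul, shufL_tmul, AlgHom.comp_apply, Algebra.coe_lmul_eq_mul,
        LinearMap.mul_apply', Algebra.lsmul_coe, MulOpposite.smul_eq_mul_unop, mul_assoc]; rfl

theorem shufR_lact (f : A →ₐ[k] Module.End k V) (a : A) (s : V ⊗[k] A) (t : W ⊗[k] A) :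
    shufR A V W (diag f (leftMul k A) a s ⊗ₜ t) =
      diag ((Module.End.rTensorAlgHom k V W).comp f) (leftMul k A) a (shufR A V W (s ⊗ₜ t)) := by
  rw [diag_eq, diag_eq]
  generalize comul (R := k) a = c
  induction c with
  | zero =>
    simp only [LinearMap.map_zero, LinearEquiv.map_zero, zero_tmul, tmul_zero,
      LinearMap.zero_apply, mul_zero, zero_mul]
  | add x y hx hy =>
    simp only [LinearMap.map_add, LinearEquiv.map_add, add_tmul, LinearMap.add_apply, hx, hy]
  | tmul a b =>
  induction s with
  | zero =>
    simp only [LinearMap.map_zero, LinearEquiv.map_zero, zero_tmul, tmul_zero,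
      LinearMap.zero_apply, mul_zero, zero_mul]
  | add x y hx hy => simp only [LinearMap.map_add, LinearEquiv.map_add, add_tmul, hx, hy]
  | tmul a v =>
    induction t with
    | zero =>
      simp only [LinearMap.map_zero, LinearEquiv.map_zero, zero_tmul, tmul_zero,
        LinearMap.zero_apply, mul_zero, zero_mul]
    | add x y hx hy => simp only [LinearMap.map_add, LinearEquiv.map_add, tmul_add, hx, hy]
    | tmul b w => simp only [diagAux_tmul, map_tmul, shufR_tmul, AlgHom.comp_apply, Algebra.coe_lmul_eq_mul,
        LinearMap.mul_apply', Algebra.lsmul_coe, MulOpposite.smul_eq_mul_unop, mul_assoc]; rfl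

theorem shufL_ract (f : Aᵐᵒᵖ →ₐ[k] Module.End k W) (a : Aᵐᵒᵖ) (s : A ⊗[k] V) (t : A ⊗[k] W) :
    shufL A V W (s ⊗ₜ diag (rightMul k A) f a t) =
      diag (rightMul k A) ((Module.End.lTensorAlgHom k W V).comp f) a (shufL A V W (s ⊗ₜ t)) := by
  rw [diag_eq, diag_eq]
  generalize comul (R := k) a = c
  induction c with
  | zero =>
    simp only [LinearMap.map_zero, LinearEquiv.map_zero, zero_tmul, tmul_zero,
      LinearMap.zero_apply, mul_zero, zero_mul]
  | add x y hx hy =>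
    simp only [LinearMap.map_add, LinearEquiv.map_add, tmul_add, LinearMap.add_apply, hx, hy]
  | tmul a b =>
  induction s with
  | zero =>
    simp only [LinearMap.map_zero, LinearEquiv.map_zero, zero_tmul, tmul_zero,
      LinearMap.zero_apply, mul_zero, zero_mul]
  | add x y hx hy => simp only [LinearMap.map_add, LinearEquiv.map_add, add_tmul, hx, hy]
  | tmul a v =>
    induction t with
    | zero =>
      simp only [LinearMap.map_zero, LinearEquiv.map_zero, zero_tmul, tmul_zero,
        LinearMap.zero_apply, mul_zero, zero_mul]
    | add x y hx hy => simp only [LinearMap.map_add, LinearEquiv.map_add, tmul_add, hx, hy]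
    | tmul b w => simp only [diagAux_tmul, map_tmul, shufL_tmul, AlgHom.comp_apply, Algebra.coe_lmul_eq_mul,
        LinearMap.mul_apply', Algebra.lsmul_coe, MulOpposite.smul_eq_mul_unop, mul_assoc]; rfl

theorem shufR_ract (f : Aᵐᵒᵖ →ₐ[k] Module.End k W) (a : Aᵐᵒᵖ) (s : V ⊗[k] A) (t : W ⊗[k] A) :
    shufR A V W (s ⊗ₜ diag f (rightMul k A) a t) =
      diag ((Module.End.lTensorAlgHom k W V).comp f) (rightMul k A) a (shufR A V W (s ⊗ₜ t)) := by
  rw [diag_eq, diag_eq]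
  generalize comul (R := k) a = c
  induction c with
  | zero =>
    simp only [LinearMap.map_zero, LinearEquiv.map_zero, zero_tmul, tmul_zero,
      LinearMap.zero_apply, mul_zero, zero_mul]
  | add x y hx hy =>
    simp only [LinearMap.map_add, LinearEquiv.map_add, tmul_add, LinearMap.add_apply, hx, hy]
  | tmul a b =>
  induction s with
  | zero =>
    simp only [LinearMap.map_zero, LinearEquiv.map_zero, zero_tmul, tmul_zero,
      LinearMap.zero_apply, mul_zero, zero_mul]
  | add x y hx hy => simp only [LinearMap.map_add, LinearEquiv.map_add, add_tmul, hx, hy]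
  | tmul a v =>
    induction t with
    | zero =>
      simp only [LinearMap.map_zero, LinearEquiv.map_zero, zero_tmul, tmul_zero,
        LinearMap.zero_apply, mul_zero, zero_mul]
    | add x y hx hy => simp only [LinearMap.map_add, LinearEquiv.map_add, tmul_add, hx, hy]
    | tmul b w => simp only [diagAux_tmul, map_tmul, shufR_tmul, AlgHom.comp_apply, Algebra.coe_lmul_eq_mul,
        LinearMap.mul_apply', Algebra.lsmul_coe, MulOpposite.smul_eq_mul_unop, mul_assoc]; rfl

end Codiag

section Functors

variable {k A : Type u} [Field k] [Ring A] [HopfAlgebra k A]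

/-- The Hopf bimodule `M ⊗ A` with the standard actions `a (m ⊗ b) c = am ⊗ bc` and the codiagonal
coactions. -/
noncomputable def tensA (M : HopfBimodule k A) : HopfBimodule k A where
  V := M.V ⊗[k] A
  lact := (Module.End.rTensorAlgHom k M.V A).comp M.lact
  ract := (Module.End.lTensorAlgHom k A M.V).comp (rightMul k A)
  δL := codiagL M.δL comul
  δR := codiagR M.δR comul
  lact_ract a b := TensorProduct.ext' fun _ _ => rfl
  coassocL := codiagL_coassoc M.coassocL fun a => Coalgebra.coassoc_apply a
  counitL := codiagL_counit M.counitL fun a => Coalgebra.rTensor_counit_comul a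
  coassocR := codiagR_coassoc M.coassocR fun a => Coalgebra.coassoc_apply a
  counitR := codiagR_counit M.counitR fun a => Coalgebra.lTensor_counit_comul a
  bicomod := codiag_bicomod M.bicomod fun a => Coalgebra.coassoc_apply a
  δL_lact a x := by
    induction x with
    | zero =>
      simp only [LinearMap.map_zero, LinearEquiv.map_zero, zero_tmul, tmul_zero,
        LinearMap.zero_apply, mul_zero, zero_mul]
    | add x y hx hy => simp only [LinearMap.map_add, LinearEquiv.map_add, hx, hy]
    | tmul v b =>
      change codiagL M.δL comul (M.lact a v ⊗ₜ b) = _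
      rw [codiagL_tmul, M.δL_lact, shufL_lact, codiagL_tmul]
  δL_ract b x := by
    induction x with
    | zero =>
      simp only [LinearMap.map_zero, LinearEquiv.map_zero, zero_tmul, tmul_zero,
        LinearMap.zero_apply, mul_zero, zero_mul]
    | add x y hx hy => simp only [LinearMap.map_add, LinearEquiv.map_add, hx, hy]
    | tmul v a =>
      change codiagL M.δL comul (v ⊗ₜ rightMul k A b a) = _
      rw [codiagL_tmul, comul_rightMul, shufL_ract, codiagL_tmul]
  δR_lact a x := by
    induction x with
    | zero =>
      simp only [LinearMap.map_zero, LinearEquiv.map_zero, zero_tmul, tmul_zero,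
        LinearMap.zero_apply, mul_zero, zero_mul]
    | add x y hx hy => simp only [LinearMap.map_add, LinearEquiv.map_add, hx, hy]
    | tmul v b =>
      change codiagR M.δR comul (M.lact a v ⊗ₜ b) = _
      rw [codiagR_tmul, M.δR_lact, shufR_lact, codiagR_tmul]
  δR_ract b x := by
    induction x with
    | zero =>
      simp only [LinearMap.map_zero, LinearEquiv.map_zero, zero_tmul, tmul_zero,
        LinearMap.zero_apply, mul_zero, zero_mul]
    | add x y hx hy => simp only [LinearMap.map_add, LinearEquiv.map_add, hx, hy]
    | tmul v a =>
      change codiagR M.δR comul (v ⊗ₜ rightMul k A b a) = _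
      rw [codiagR_tmul, comul_rightMul, shufR_ract, codiagR_tmul]

/-- The Hopf bimodule `A ⊗ N` with the diagonal actions and the standard coactions
`b ⊗ n ↦ ∑ b₁ ⊗ (b₂ ⊗ n)` and `b ⊗ n ↦ ∑ (b ⊗ n₀) ⊗ n₁`. -/
noncomputable def aTens (N : HopfBimodule k A) : HopfBimodule k A where
  V := A ⊗[k] N.V
  lact := diag (leftMul k A) N.lact
  ract := diag (rightMul k A) N.ract
  δL := (TensorProduct.assoc k A A N.V).toLinearMap ∘ₗ comul.rTensor N.V
  δR := (TensorProduct.assoc k A N.V A).symm.toLinearMap ∘ₗ N.δR.lTensor A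
  lact_ract := diag_commute (leftMul_rightMul_comm k A) N.lact_ract
  coassocL x := by
    induction x with
    | zero =>
      simp only [LinearMap.map_zero, LinearEquiv.map_zero, zero_tmul, tmul_zero,
        LinearMap.zero_apply, mul_zero, zero_mul]
    | add x y hx hy => simp only [LinearMap.map_add, LinearEquiv.map_add, hx, hy]
    | tmul a n =>
      have h1 : ∀ s : A ⊗[k] A, TensorProduct.assoc k A A (A ⊗[k] N.V) (comul.rTensor (A ⊗[k] N.V)
          (TensorProduct.assoc k A A N.V (s ⊗ₜ n))) =
          (((TensorProduct.mk k A N.V).flip n).lTensor A).lTensor A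
            (TensorProduct.assoc k A A A (comul.rTensor A s)) := by
        intro s
        induction s with
        | zero =>
          simp only [LinearMap.map_zero, LinearEquiv.map_zero, zero_tmul, tmul_zero,
            LinearMap.zero_apply, mul_zero, zero_mul]
        | add x y hx hy => simp only [LinearMap.map_add, LinearEquiv.map_add, add_tmul, hx, hy]
        | tmul c d =>
          simp only [assoc_tmul, LinearMap.rTensor_tmul]
          generalize comul (R := k) c = s
          induction s with
          | zero =>
            simp only [LinearMap.map_zero, LinearEquiv.map_zero, zero_tmul, tmul_zero,
              LinearMap.zero_apply, mul_zero, zero_mul]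
          | add x y hx hy => simp only [LinearMap.map_add, LinearEquiv.map_add, add_tmul, hx, hy]
          | tmul c d => rfl
      have h2 : ∀ s : A ⊗[k] A, ((TensorProduct.assoc k A A N.V).toLinearMap ∘ₗ
          comul.rTensor N.V).lTensor A (TensorProduct.assoc k A A N.V (s ⊗ₜ n)) =
          (((TensorProduct.mk k A N.V).flip n).lTensor A).lTensor A (comul.lTensor A s) := by
        intro s
        induction s with
        | zero =>
          simp only [LinearMap.map_zero, LinearEquiv.map_zero, zero_tmul, tmul_zero,
            LinearMap.zero_apply, mul_zero, zero_mul]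
        | add x y hx hy => simp only [LinearMap.map_add, LinearEquiv.map_add, add_tmul, hx, hy]
        | tmul c d =>
          simp only [assoc_tmul, LinearMap.lTensor_tmul, LinearMap.comp_apply,
            LinearMap.rTensor_tmul, LinearEquiv.coe_coe]
          generalize comul (R := k) d = s
          induction s with
          | zero =>
            simp only [LinearMap.map_zero, LinearEquiv.map_zero, zero_tmul, tmul_zero,
              LinearMap.zero_apply, mul_zero, zero_mul]
          | add x y hx hy =>
            simp only [LinearMap.map_add, LinearEquiv.map_add, add_tmul, tmul_add, hx, hy]
          | tmul c d => rfl
      rw [LinearMap.comp_apply, LinearMap.rTensor_tmul, LinearEquiv.coe_coe, h1, h2,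
        Coalgebra.coassoc_apply]
  counitL x := by
    induction x with
    | zero =>
      simp only [LinearMap.map_zero, LinearEquiv.map_zero, zero_tmul, tmul_zero,
        LinearMap.zero_apply, mul_zero, zero_mul]
    | add x y hx hy => simp only [LinearMap.map_add, LinearEquiv.map_add, tmul_add, hx, hy]
    | tmul a n =>
      have h : ∀ s : A ⊗[k] A, counit.rTensor (A ⊗[k] N.V)
          (TensorProduct.assoc k A A N.V (s ⊗ₜ n)) =
          ((TensorProduct.mk k A N.V).flip n).lTensor k (counit.rTensor A s) := by
        intro s
        induction s with
        | zero =>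
          simp only [LinearMap.map_zero, LinearEquiv.map_zero, zero_tmul, tmul_zero,
            LinearMap.zero_apply, mul_zero, zero_mul]
        | add x y hx hy => simp only [LinearMap.map_add, LinearEquiv.map_add, add_tmul, hx, hy]
        | tmul c d => rfl
      rw [LinearMap.comp_apply, LinearMap.rTensor_tmul, LinearEquiv.coe_coe, h,
        Coalgebra.rTensor_counit_comul]
      rfl
  coassocR x := by
    induction x with
    | zero =>
      simp only [LinearMap.map_zero, LinearEquiv.map_zero, zero_tmul, tmul_zero,
        LinearMap.zero_apply, mul_zero, zero_mul]
    | add x y hx hy => simp only [LinearMap.map_add, LinearEquiv.map_add, hx, hy]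
    | tmul a n =>
      have h1 : ∀ s : N.V ⊗[k] A, TensorProduct.assoc k (A ⊗[k] N.V) A A
          (((TensorProduct.assoc k A N.V A).symm.toLinearMap ∘ₗ N.δR.lTensor A).rTensor A
            ((TensorProduct.assoc k A N.V A).symm (a ⊗ₜ s))) =
          (TensorProduct.mk k A N.V a).rTensor (A ⊗[k] A)
            (TensorProduct.assoc k N.V A A (N.δR.rTensor A s)) := by
        intro s
        induction s with
        | zero =>
          simp only [LinearMap.map_zero, LinearEquiv.map_zero, zero_tmul, tmul_zero,
            LinearMap.zero_apply, mul_zero, zero_mul]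
        | add x y hx hy => simp only [LinearMap.map_add, LinearEquiv.map_add, tmul_add, hx, hy]
        | tmul m b =>
          simp only [assoc_symm_tmul, LinearMap.lTensor_tmul, LinearMap.comp_apply,
            LinearMap.rTensor_tmul, LinearEquiv.coe_coe]
          generalize N.δR m = s
          induction s with
          | zero =>
            simp only [LinearMap.map_zero, LinearEquiv.map_zero, zero_tmul, tmul_zero,
              LinearMap.zero_apply, mul_zero, zero_mul]
          | add x y hx hy =>
            simp only [LinearMap.map_add, LinearEquiv.map_add, add_tmul, tmul_add, hx, hy]
          | tmul c d => rfl
      have h2 : ∀ s : N.V ⊗[k] A, comul.lTensor (A ⊗[k] N.V)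
          ((TensorProduct.assoc k A N.V A).symm (a ⊗ₜ s)) =
          (TensorProduct.mk k A N.V a).rTensor (A ⊗[k] A) (comul.lTensor N.V s) := by
        intro s
        induction s with
        | zero =>
          simp only [LinearMap.map_zero, LinearEquiv.map_zero, zero_tmul, tmul_zero,
            LinearMap.zero_apply, mul_zero, zero_mul]
        | add x y hx hy => simp only [LinearMap.map_add, LinearEquiv.map_add, tmul_add, hx, hy]
        | tmul m b => rfl
      rw [LinearMap.comp_apply, LinearMap.lTensor_tmul, LinearEquiv.coe_coe, h1, h2, N.coassocR]
  counitR x := by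
    induction x with
    | zero =>
      simp only [LinearMap.map_zero, LinearEquiv.map_zero, zero_tmul, tmul_zero,
        LinearMap.zero_apply, mul_zero, zero_mul]
    | add x y hx hy => simp only [LinearMap.map_add, LinearEquiv.map_add, add_tmul, hx, hy]
    | tmul a n =>
      have h : ∀ s : N.V ⊗[k] A, counit.lTensor (A ⊗[k] N.V)
          ((TensorProduct.assoc k A N.V A).symm (a ⊗ₜ s)) =
          (TensorProduct.mk k A N.V a).rTensor k (counit.lTensor N.V s) := by
        intro s
        induction s with
        | zero =>
          simp only [LinearMap.map_zero, LinearEquiv.map_zero, zero_tmul, tmul_zero,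
            LinearMap.zero_apply, mul_zero, zero_mul]
        | add x y hx hy => simp only [LinearMap.map_add, LinearEquiv.map_add, tmul_add, hx, hy]
        | tmul c d => rfl
      rw [LinearMap.comp_apply, LinearMap.lTensor_tmul, LinearEquiv.coe_coe, h, N.counitR]
      rfl
  bicomod x := by
    induction x with
    | zero =>
      simp only [LinearMap.map_zero, LinearEquiv.map_zero, zero_tmul, tmul_zero,
        LinearMap.zero_apply, mul_zero, zero_mul]
    | add x y hx hy => simp only [LinearMap.map_add, LinearEquiv.map_add, hx, hy]
    | tmul a n =>
      simp only [LinearMap.comp_apply, LinearMap.lTensor_tmul, LinearMap.rTensor_tmul,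
        LinearEquiv.coe_coe]
      have h1 : ∀ c : A ⊗[k] A, ((TensorProduct.assoc k A N.V A).symm.toLinearMap ∘ₗ
          N.δR.lTensor A).lTensor A (TensorProduct.assoc k A A N.V (c ⊗ₜ n)) =
          (TensorProduct.assoc k A N.V A).symm.toLinearMap.lTensor A
            (TensorProduct.assoc k A A (N.V ⊗[k] A) (c ⊗ₜ N.δR n)) := by
        intro c
        induction c with
        | zero =>
          simp only [LinearMap.map_zero, LinearEquiv.map_zero, zero_tmul, tmul_zero,
            LinearMap.zero_apply, mul_zero, zero_mul]
        | add x y hx hy => simp only [LinearMap.map_add, LinearEquiv.map_add, add_tmul, hx, hy]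
        | tmul c d => rfl
      rw [h1]
      generalize N.δR n = s
      induction s with
      | zero =>
        simp only [LinearMap.map_zero, LinearEquiv.map_zero, zero_tmul, tmul_zero,
          LinearMap.zero_apply, mul_zero, zero_mul]
      | add x y hx hy => simp only [LinearMap.map_add, LinearEquiv.map_add, tmul_add, hx, hy]
      | tmul m b =>
        simp only [LinearMap.comp_apply, LinearMap.rTensor_tmul, LinearEquiv.coe_coe,
          assoc_symm_tmul]
        generalize comul (R := k) a = c
        induction c with
        | zero =>
          simp only [LinearMap.map_zero, LinearEquiv.map_zero, zero_tmul, tmul_zero,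
            LinearMap.zero_apply, mul_zero, zero_mul]
        | add x y hx hy => simp only [LinearMap.map_add, LinearEquiv.map_add, add_tmul, hx, hy]
        | tmul c d => rfl
  δL_lact a x := by
    have h := map_diag (f := leftMul k A) (f' := diag (leftMul k A) (leftMul k A)) (g := N.lact)
      (g' := N.lact) comul LinearMap.id (comul_leftMul k A) (fun _ _ => rfl) a x
    change TensorProduct.assoc k A A N.V (map comul LinearMap.id _) = _
    rw [h, assoc_diag]
    rfl
  δL_ract a x := by
    have h := map_diag (f := rightMul k A) (f' := diag (rightMul k A) (rightMul k A)) (g := N.ract)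
      (g' := N.ract) comul LinearMap.id (comul_rightMul k A) (fun _ _ => rfl) a x
    change TensorProduct.assoc k A A N.V (map comul LinearMap.id _) = _
    rw [h, assoc_diag]
    rfl
  δR_lact a x := by
    have h := map_diag (f := leftMul k A) (f' := leftMul k A) (g := N.lact)
      (g' := diag N.lact (leftMul k A)) LinearMap.id N.δR (fun _ _ => rfl) N.δR_lact a x
    change (TensorProduct.assoc k A N.V A).symm (map LinearMap.id N.δR _) = _
    rw [h, assoc_symm_diag]
    rfl
  δR_ract a x := by
    have h := map_diag (f := rightMul k A) (f' := rightMul k A) (g := N.ract)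
      (g' := diag N.ract (rightMul k A)) LinearMap.id N.δR (fun _ _ => rfl) N.δR_ract a x
    change (TensorProduct.assoc k A N.V A).symm (map LinearMap.id N.δR _) = _
    rw [h, assoc_symm_diag]
    rfl

theorem tensA_ext {M : HopfBimodule k A} {Z : Type u} [AddCommGroup Z] [Module k Z]
    (F G : (tensA M).V →ₗ[k] Z)
    (h : ∀ (m : M.V) (a : A), F (m ⊗ₜ[k] a : M.V ⊗[k] A) = G (m ⊗ₜ[k] a : M.V ⊗[k] A)) (x) :
    F x = G x :=
  LinearMap.congr_fun (show F = G from TensorProduct.ext' (M := M.V) (N := A) h) x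

theorem aTens_ext {M : HopfBimodule k A} {Z : Type u} [AddCommGroup Z] [Module k Z]
    (F G : (aTens M).V →ₗ[k] Z)
    (h : ∀ (a : A) (m : M.V), F (a ⊗ₜ[k] m : A ⊗[k] M.V) = G (a ⊗ₜ[k] m : A ⊗[k] M.V)) (x) :
    F x = G x :=
  LinearMap.congr_fun (show F = G from TensorProduct.ext' (M := A) (N := M.V) h) x

/-- The morphism `M ⊗ A → N ⊗ A` induced by a morphism `M → N`. -/
noncomputable def tensAMap {M N : HopfBimodule k A} (f : HomA4 M N) : HomA4 (tensA M) (tensA N) :=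
  let g : (tensA M).V →ₗ[k] (tensA N).V := f.1.rTensor A
  ⟨g, by
    refine ⟨fun a => tensA_ext (g ∘ₗ (tensA M).lact a) ((tensA N).lact a ∘ₗ g) fun v b => ?_,
      fun a => tensA_ext (g ∘ₗ (tensA M).ract a) ((tensA N).ract a ∘ₗ g) fun v b => ?_,
      tensA_ext ((tensA N).δL ∘ₗ g) (g.lTensor A ∘ₗ (tensA M).δL) fun v b => ?_,
      tensA_ext ((tensA N).δR ∘ₗ g) (g.rTensor A ∘ₗ (tensA M).δR) fun v b => ?_⟩
    · change f.1 (M.lact a v) ⊗ₜ b = N.lact a (f.1 v) ⊗ₜ b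
      rw [HomA4.map_lact f]
    · rfl
    · change codiagL N.δL comul (f.1 v ⊗ₜ b) = LinearMap.lTensor A (map f.1 LinearMap.id)
        (codiagL M.δL comul (v ⊗ₜ b))
      rw [codiagL_tmul, codiagL_tmul, shufL_nat, HomA4.map_δL f, LinearMap.lTensor_id]
      rfl
    · change codiagR N.δR comul (f.1 v ⊗ₜ b) = LinearMap.rTensor A (map f.1 LinearMap.id)
        (codiagR M.δR comul (v ⊗ₜ b))
      rw [codiagR_tmul, codiagR_tmul, shufR_nat, HomA4.map_δR f, LinearMap.rTensor_id]
      rfl⟩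

/-- The morphism `A ⊗ M → A ⊗ N` induced by a morphism `M → N`. -/
noncomputable def aTensMap {M N : HopfBimodule k A} (f : HomA4 M N) : HomA4 (aTens M) (aTens N) :=
  let g : (aTens M).V →ₗ[k] (aTens N).V := f.1.lTensor A
  ⟨g, by
    refine ⟨fun a x => ?_, fun a x => ?_,
      aTens_ext ((aTens N).δL ∘ₗ g) (g.lTensor A ∘ₗ (aTens M).δL) fun b v => ?_,
      aTens_ext ((aTens N).δR ∘ₗ g) (g.rTensor A ∘ₗ (aTens M).δR) fun b v => ?_⟩
    · exact map_diag LinearMap.id f.1 (fun _ _ => rfl) (HomA4.map_lact f) a x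
    · exact map_diag LinearMap.id f.1 (fun _ _ => rfl) (HomA4.map_ract f) a x
    · change TensorProduct.assoc k A A N.V (comul b ⊗ₜ f.1 v) =
        (f.1.lTensor A).lTensor A (TensorProduct.assoc k A A M.V (comul b ⊗ₜ v))
      generalize comul (R := k) b = s
      induction s with
      | zero =>
        simp only [LinearMap.map_zero, LinearEquiv.map_zero, zero_tmul, tmul_zero,
          LinearMap.zero_apply, mul_zero, zero_mul]
      | add x y hx hy => simp only [LinearMap.map_add, LinearEquiv.map_add, add_tmul, hx, hy]
      | tmul c d => rfl
    · change (TensorProduct.assoc k A N.V A).symm (b ⊗ₜ N.δR (f.1 v)) =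
        (f.1.lTensor A).rTensor A ((TensorProduct.assoc k A M.V A).symm (b ⊗ₜ M.δR v))
      rw [HomA4.map_δR f]
      generalize M.δR v = s
      induction s with
      | zero =>
        simp only [LinearMap.map_zero, LinearEquiv.map_zero, zero_tmul, tmul_zero,
          LinearMap.zero_apply, mul_zero, zero_mul]
      | add x y hx hy => simp only [LinearMap.map_add, LinearEquiv.map_add, tmul_add, hx, hy]
      | tmul c d => rfl⟩

/-- The linear map `M ⊗ A → M` given by the right action. -/
noncomputable def actLin (M : HopfBimodule k A) : M.V ⊗[k] A →ₗ[k] M.V :=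
  TensorProduct.lift (M.ract.toLinearMap ∘ₗ (MulOpposite.opLinearEquiv k).toLinearMap).flip

theorem actLin_tmul (M : HopfBimodule k A) (m : M.V) (a : A) :
    actLin M (m ⊗ₜ a) = M.ract (MulOpposite.op a) m := rfl

/-- The morphism `M ⊗ A → M` given by the right action. -/
noncomputable def actMap (M : HopfBimodule k A) : HomA4 (tensA M) M :=
  let g : (tensA M).V →ₗ[k] M.V := actLin M
  ⟨g, by
    refine ⟨fun a => tensA_ext (g ∘ₗ (tensA M).lact a) (M.lact a ∘ₗ g) fun v b => ?_,
      fun a => tensA_ext (g ∘ₗ (tensA M).ract a) (M.ract a ∘ₗ g) fun v b => ?_,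
      tensA_ext (M.δL ∘ₗ g) (g.lTensor A ∘ₗ (tensA M).δL) fun v b => ?_,
      tensA_ext (M.δR ∘ₗ g) (g.rTensor A ∘ₗ (tensA M).δR) fun v b => ?_⟩
    · exact (LinearMap.congr_fun (M.lact_ract a (MulOpposite.op b)).eq v).symm
    · change M.ract (MulOpposite.op (b * a.unop)) v = M.ract a (M.ract (MulOpposite.op b) v)
      rw [MulOpposite.op_mul, map_mul]
      rfl
    · change M.δL (M.ract (MulOpposite.op b) v) = LinearMap.lTensor A (actLin M)
        (codiagL M.δL comul (v ⊗ₜ b))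
      rw [M.δL_ract, codiagL_tmul, diag_eq, MulOpposite.comul_def]
      simp only [LinearMap.comp_apply, LinearEquiv.coe_coe, MulOpposite.coe_opLinearEquiv_symm,
        MulOpposite.unop_op]
      generalize comul (R := k) b = s
      generalize M.δL v = t
      induction s with
      | zero =>
        simp only [LinearMap.map_zero, LinearEquiv.map_zero, zero_tmul, tmul_zero,
          LinearMap.zero_apply, mul_zero, zero_mul]
      | add x y hx hy =>
        simp only [LinearMap.map_add, LinearEquiv.map_add, tmul_add, LinearMap.add_apply, hx, hy]
      | tmul c d =>
        induction t with
        | zero =>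
          simp only [LinearMap.map_zero, LinearEquiv.map_zero, zero_tmul, tmul_zero,
            LinearMap.zero_apply, mul_zero, zero_mul]
        | add x y hx hy => simp only [LinearMap.map_add, LinearEquiv.map_add, add_tmul, hx, hy]
        | tmul c d => rfl
    · change M.δR (M.ract (MulOpposite.op b) v) = LinearMap.rTensor A (actLin M)
        (codiagR M.δR comul (v ⊗ₜ b))
      rw [M.δR_ract, codiagR_tmul, diag_eq, MulOpposite.comul_def]
      simp only [LinearMap.comp_apply, LinearEquiv.coe_coe, MulOpposite.coe_opLinearEquiv_symm,
        MulOpposite.unop_op]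
      generalize comul (R := k) b = s
      generalize M.δR v = t
      induction s with
      | zero =>
        simp only [LinearMap.map_zero, LinearEquiv.map_zero, zero_tmul, tmul_zero,
          LinearMap.zero_apply, mul_zero, zero_mul]
      | add x y hx hy =>
        simp only [LinearMap.map_add, LinearEquiv.map_add, tmul_add, LinearMap.add_apply, hx, hy]
      | tmul c d =>
        induction t with
        | zero =>
          simp only [LinearMap.map_zero, LinearEquiv.map_zero, zero_tmul, tmul_zero,
            LinearMap.zero_apply, mul_zero, zero_mul]
        | add x y hx hy => simp only [LinearMap.map_add, LinearEquiv.map_add, add_tmul, hx, hy]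
        | tmul c d => rfl⟩

/-- The morphism `N → A ⊗ N` given by the left coaction. -/
noncomputable def coactMap (N : HopfBimodule k A) : HomA4 N (aTens N) :=
  ⟨N.δL, N.δL_lact, N.δL_ract, N.coassocL, fun x =>
    (LinearEquiv.symm_apply_eq _).mpr (N.bicomod x).symm⟩

end Functors



section Complex

variable {k A : Type u} [Field k] [Ring A] [HopfAlgebra k A]

theorem homA4_ext {M N : HopfBimodule k A} {f g : HomA4 M N} (h : ∀ v, f.1 v = g.1 v) : f = g :=
  Subtype.ext (LinearMap.ext h)

/-- Composition of morphisms of Hopf bimodules. -/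
def compH {L M N : HopfBimodule k A} (g : HomA4 M N) (f : HomA4 L M) : HomA4 L N :=
  ⟨g.1 ∘ₗ f.1, HomA4.comp_mem f g⟩

theorem compH_apply {L M N : HopfBimodule k A} (g : HomA4 M N) (f : HomA4 L M) (v : L.V) :
    (compH g f).1 v = g.1 (f.1 v) := rfl

/-- The morphism `f ⊗ 1 + r μ_R : W ⊗ A ⊗ A → W ⊗ A`. -/
noncomputable def barStep {W : HopfBimodule k A} (r : k) (f : HomA4 (tensA W) W) :
    HomA4 (tensA (tensA W)) (tensA W) :=
  tensAMap f + r • actMap (tensA W)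

/-- The morphism `δ_L - 1 ⊗ f : A ⊗ W → A ⊗ A ⊗ W`. -/
noncomputable def cobarStep {W : HopfBimodule k A} (f : HomA4 W (aTens W)) :
    HomA4 (aTens W) (aTens (aTens W)) :=
  coactMap (aTens W) - aTensMap f

variable (M N : HopfBimodule k A)

/-- `M ⊗ A^{⊗ q}` with the standard actions and the codiagonal coactions. -/
noncomputable def tpow : ℕ → HopfBimodule k A
  | 0 => M
  | q + 1 => tensA (tpow q)

/-- `A^{⊗ p} ⊗ N` with the diagonal actions and the standard coactions. -/
noncomputable def upow : ℕ → HopfBimodule k A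
  | 0 => N
  | p + 1 => aTens (upow p)

/-- The bar differential `λ_{q-1} : M ⊗ A^{⊗ q+1} → M ⊗ A^{⊗ q}`,
`m ⊗ a₀ ⊗ ⋯ ⊗ a_q ↦ m a₀ ⊗ a₁ ⊗ ⋯ ⊗ a_q + ∑ i < q, (-1)^{i+1} m ⊗ ⋯ ⊗ a_i a_{i+1} ⊗ ⋯ ⊗ a_q`. -/
noncomputable def barMap : ∀ q : ℕ, HomA4 (tpow M (q + 1)) (tpow M q)
  | 0 => actMap M
  | q + 1 => barStep ((-1) ^ (q + 1)) (barMap q)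

/-- The cobar differential `ρ_{p-1} : A^{⊗ p} ⊗ N → A^{⊗ p+1} ⊗ N`,
`x ↦ ∑ i < p, (-1)^i Δ_i x + (-1)^p (1^{⊗ p} ⊗ δ_L) x`. -/
noncomputable def cobarMap : ∀ p : ℕ, HomA4 (upow N p) (upow N (p + 1))
  | 0 => coactMap N
  | p + 1 => cobarStep (cobarMap p)

/-- The space `K^{pq}(M, N) = Hom_{A4}(M ⊗ A^{⊗ q+1}, A^{⊗ p+1} ⊗ N)`. -/
abbrev KK (p q : ℕ) : Type u := HomA4 (tpow M (q + 1)) (upow N (p + 1))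

/-- `d_h α = α ∘ λ` -/
noncomputable def dh (p q : ℕ) : KK M N p q →ₗ[k] KK M N p (q + 1) :=
  HomA4.precomp (upow N (p + 1)) (barMap M (q + 1))

/-- `d_c α = (-1)^q ρ ∘ α` -/
noncomputable def dc (p q : ℕ) : KK M N p q →ₗ[k] KK M N (p + 1) q :=
  (-1 : k) ^ q • HomA4.postcomp (tpow M (q + 1)) (cobarMap N (p + 1))

/-- The total complex in degree `n`. -/
def Cochain (n : ℕ) : Type u := ∀ x : {x : ℕ × ℕ // x.1 + x.2 = n}, KK M N x.1.1 x.1.2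

noncomputable instance (n : ℕ) : AddCommGroup (Cochain M N n) :=
  inferInstanceAs (AddCommGroup (∀ x : {x : ℕ × ℕ // x.1 + x.2 = n}, KK M N x.1.1 x.1.2))
noncomputable instance (n : ℕ) : Module k (Cochain M N n) :=
  inferInstanceAs (Module k (∀ x : {x : ℕ × ℕ // x.1 + x.2 = n}, KK M N x.1.1 x.1.2))

variable {M N}

theorem cochain_ext {n : ℕ} {F G : Cochain M N n} (h : ∀ p q h, F ⟨(p, q), h⟩ = G ⟨(p, q), h⟩) :
    F = G := funext fun x => h x.1.1 x.1.2 x.2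

theorem cochain_add {n : ℕ} (F G : Cochain M N n) (x) : (F + G) x = F x + G x := rfl

theorem cochain_smul {n : ℕ} (r : k) (F : Cochain M N n) (x) : (r • F) x = r • F x := rfl

/-- The contribution of `d_h` to `D`. -/
noncomputable def hPart {n : ℕ} (F : Cochain M N n) : ∀ p q : ℕ, p + q = n + 1 → KK M N p q
  | _, 0, _ => 0
  | p, q + 1, h => dh M N p q (F ⟨(p, q), by omega⟩)

/-- The contribution of `d_c` to `D`. -/
noncomputable def cPart {n : ℕ} (F : Cochain M N n) : ∀ p q : ℕ, p + q = n + 1 → KK M N p q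
  | 0, _, _ => 0
  | p + 1, q, h => dc M N p q (F ⟨(p, q), by omega⟩)

variable (M N)

/-- The total differential `D = d_h + d_c`. -/
noncomputable def D (n : ℕ) : Cochain M N n →ₗ[k] Cochain M N (n + 1) where
  toFun F := fun x => hPart F x.1.1 x.1.2 x.2 + cPart F x.1.1 x.1.2 x.2
  map_add' F G := cochain_ext fun p q h => by
    change hPart (F + G) p q h + cPart (F + G) p q h =
      (hPart F p q h + cPart F p q h) + (hPart G p q h + cPart G p q h)
    have h1 : hPart (F + G) p q h = hPart F p q h + hPart G p q h := by
      cases q with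
      | zero => exact (add_zero _).symm
      | succ q => exact map_add (dh M N p q) _ _
    have h2 : cPart (F + G) p q h = cPart F p q h + cPart G p q h := by
      cases p with
      | zero => exact (add_zero _).symm
      | succ p => exact map_add (dc M N p q) _ _
    rw [h1, h2]
    abel
  map_smul' r F := cochain_ext fun p q h => by
    change hPart (r • F) p q h + cPart (r • F) p q h = r • (hPart F p q h + cPart F p q h)
    have h1 : hPart (r • F) p q h = r • hPart F p q h := by
      cases q with
      | zero => exact (smul_zero _).symm
      | succ q => exact map_smul (dh M N p q) _ _
    have h2 : cPart (r • F) p q h = r • cPart F p q h := by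
      cases p with
      | zero => exact (smul_zero _).symm
      | succ p => exact map_smul (dc M N p q) _ _
    rw [h1, h2, smul_add]

variable {M N}

theorem actMap_nat {M N : HopfBimodule k A} (f : HomA4 M N) (x : (tensA M).V) :
    (actMap N).1 ((tensAMap f).1 x) = f.1 ((actMap M).1 x) :=
  tensA_ext ((actMap N).1 ∘ₗ (tensAMap f).1) (f.1 ∘ₗ (actMap M).1)
    (fun m a => (HomA4.map_ract f (MulOpposite.op a) m).symm) x

theorem coactMap_nat {M N : HopfBimodule k A} (f : HomA4 M N) (x : M.V) :
    (coactMap N).1 (f.1 x) = (aTensMap f).1 ((coactMap M).1 x) := HomA4.map_δL f x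

theorem tensAMap_comp {L M N : HopfBimodule k A} (g : HomA4 M N) (f : HomA4 L M) (x) :
    (tensAMap g).1 ((tensAMap f).1 x) = (tensAMap (compH g f)).1 x :=
  tensA_ext ((tensAMap g).1 ∘ₗ (tensAMap f).1) (tensAMap (compH g f)).1 (fun _ _ => rfl) x

theorem aTensMap_comp {L M N : HopfBimodule k A} (g : HomA4 M N) (f : HomA4 L M) (x) :
    (aTensMap g).1 ((aTensMap f).1 x) = (aTensMap (compH g f)).1 x :=
  aTens_ext ((aTensMap g).1 ∘ₗ (aTensMap f).1) (aTensMap (compH g f)).1 (fun _ _ => rfl) x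

theorem tensAMap_zero {L M : HopfBimodule k A} : tensAMap (0 : HomA4 L M) = 0 :=
  homA4_ext <| tensA_ext (tensAMap (0 : HomA4 L M)).1 0 fun _ _ => zero_tmul _ _

theorem aTensMap_zero {L M : HopfBimodule k A} : aTensMap (0 : HomA4 L M) = 0 :=
  homA4_ext <| aTens_ext (aTensMap (0 : HomA4 L M)).1 0 fun _ _ => tmul_zero _ _

theorem barStep_apply {W : HopfBimodule k A} (r : k) (f : HomA4 (tensA W) W) (x) :
    (barStep r f).1 x = (tensAMap f).1 x + r • (actMap (tensA W)).1 x := rfl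

theorem cobarStep_apply {W : HopfBimodule k A} (f : HomA4 W (aTens W)) (x) :
    (cobarStep f).1 x = (coactMap (aTens W)).1 x - (aTensMap f).1 x := rfl

theorem barStep_zero {W : HopfBimodule k A} (x) :
    (actMap W).1 ((barStep (-1) (actMap W)).1 x) = 0 := by
  rw [barStep_apply, map_add, map_smul, actMap_nat, neg_one_smul, add_neg_cancel]

theorem barStep_succ {W : HopfBimodule k A} (r r' : k) (hr : r * r = 1) (hr' : r' = -r)
    (f : HomA4 (tensA W) W) (h : ∀ x, f.1 ((barStep r f).1 x) = 0) (x) :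
    (barStep r f).1 ((barStep r' (barStep r f)).1 x) = 0 := by
  subst hr'
  have hc : compH f (barStep r f) = 0 := homA4_ext h
  have h1 : (tensAMap f).1 ((tensAMap (barStep r f)).1 x) = 0 := by
    rw [tensAMap_comp, hc, tensAMap_zero]
    rfl
  have h2 := actMap_nat (barStep r f) x
  rw [barStep_apply r f ((actMap (tensA (tensA W))).1 x)] at h2
  rw [barStep_apply (-r), barStep_apply r f, map_add, map_add, map_smul, map_smul, h1, h2,
    smul_add, smul_add, smul_smul, smul_smul, mul_neg, hr]
  module

theorem cobarStep_zero {W : HopfBimodule k A} (x) :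
    (cobarStep (coactMap W)).1 ((coactMap W).1 x) = 0 := by
  rw [cobarStep_apply, coactMap_nat, sub_self]

theorem cobarStep_succ {W : HopfBimodule k A} (f : HomA4 W (aTens W))
    (h : ∀ x, (cobarStep f).1 (f.1 x) = 0) (x) :
    (cobarStep (cobarStep f)).1 ((cobarStep f).1 x) = 0 := by
  have hc : compH (cobarStep f) f = 0 := homA4_ext h
  have h1 : (aTensMap (cobarStep f)).1 ((aTensMap f).1 x) = 0 := by
    rw [aTensMap_comp, hc, aTensMap_zero]
    rfl
  rw [cobarStep_apply (cobarStep f), coactMap_nat, ← map_sub, cobarStep_apply f, sub_sub_cancel, h1]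

theorem barMap_barMap (q : ℕ) (x : (tpow M (q + 2)).V) :
    (barMap M q).1 ((barMap M (q + 1)).1 x) = 0 := by
  induction q with
  | zero =>
    change (actMap M).1 ((barStep ((-1) ^ 1) (actMap M)).1 x) = 0
    rw [pow_one]
    exact barStep_zero x
  | succ q ih =>
    exact barStep_succ ((-1) ^ (q + 1)) ((-1) ^ (q + 2)) (by rw [← mul_pow]; simp)
      (by ring) (barMap M q) ih x

theorem cobarMap_cobarMap (p : ℕ) (x : (upow N p).V) :
    (cobarMap N (p + 1)).1 ((cobarMap N p).1 x) = 0 := by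
  induction p with
  | zero => exact cobarStep_zero x
  | succ p ih => exact cobarStep_succ (cobarMap N p) ih x

theorem dh_dh (p q : ℕ) (α : KK M N p q) : dh M N p (q + 1) (dh M N p q α) = 0 :=
  homA4_ext fun x => by
    change α.1 ((barMap M (q + 1)).1 ((barMap M (q + 1 + 1)).1 x)) = 0
    rw [barMap_barMap, map_zero]

theorem dc_dc (p q : ℕ) (α : KK M N p q) : dc M N (p + 1) q (dc M N p q α) = 0 :=
  homA4_ext fun x => by
    change (-1 : k) ^ q • (cobarMap N (p + 1 + 1)).1 ((-1 : k) ^ q •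
      (cobarMap N (p + 1)).1 (α.1 x)) = 0
    rw [map_smul, cobarMap_cobarMap, smul_zero, smul_zero]

theorem dh_dc (p q : ℕ) (α : KK M N p q) :
    dh M N (p + 1) q (dc M N p q α) + dc M N p (q + 1) (dh M N p q α) = 0 :=
  homA4_ext fun x => by
    change (-1 : k) ^ q • (cobarMap N (p + 1)).1 (α.1 ((barMap M (q + 1)).1 x)) +
      (-1 : k) ^ (q + 1) • (cobarMap N (p + 1)).1 (α.1 ((barMap M (q + 1)).1 x)) = 0
    rw [pow_succ, mul_neg_one, neg_smul]
    exact add_neg_cancel _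

theorem dh_dc' (p q : ℕ) (α : KK M N p q) {β : KK M N (p + 1) q} {γ : KK M N p (q + 1)}
    (hβ : dh M N (p + 1) q β = 0) (hγ : dc M N p (q + 1) γ = 0) :
    dh M N (p + 1) q (β + dc M N p q α) + dc M N p (q + 1) (dh M N p q α + γ) = 0 := by
  rw [map_add, map_add, hβ, hγ, zero_add, add_zero, dh_dc]

theorem hPart_cPart {n : ℕ} (F : Cochain M N n) (p q : ℕ) (h : p + 1 + (q + 1) = n + 1 + 1) :
    hPart (D M N n F) (p + 1) (q + 1) h + cPart (D M N n F) (p + 1) (q + 1) h =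
      dh M N (p + 1) q (hPart F (p + 1) q (by omega) + cPart F (p + 1) q (by omega)) +
        dc M N p (q + 1) (hPart F p (q + 1) (by omega) + cPart F p (q + 1) (by omega)) := rfl

/-- The total differential squares to zero. -/
theorem D_D (n : ℕ) (F : Cochain M N n) : D M N (n + 1) (D M N n F) = 0 := by
  refine cochain_ext fun p q h => ?_
  have hh : ∀ p q h, dh M N p q (hPart F p q h) = 0 := fun p q h => by
    cases q with
    | zero => exact map_zero _
    | succ q => exact dh_dh p q _
  have hc : ∀ p q h, dc M N p q (cPart F p q h) = 0 := fun p q h => by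
    cases p with
    | zero => exact map_zero _
    | succ p => exact dc_dc p q _
  rcases p with _ | p <;> rcases q with _ | q
  · omega
  · have h1 := hh 0 q (by omega)
    rw [← add_zero (hPart F 0 q _)] at h1
    exact (add_zero _).trans h1
  · have h1 := hc p 0 (by omega)
    rw [← zero_add (cPart F p 0 _)] at h1
    exact (zero_add _).trans h1
  · refine (hPart_cPart F p q h).trans ?_
    exact dh_dc' p q (F ⟨(p, q), by omega⟩) (hh (p + 1) q (by omega)) (hc p (q + 1) (by omega))

variable (M N)

/-- The cocycles of degree `n`. -/
noncomputable def Cocycle (n : ℕ) : Submodule k (Cochain M N n) := LinearMap.ker (D M N n)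

/-- The coboundaries of degree `n`. -/
noncomputable def Coboundary : ∀ n : ℕ, Submodule k (Cochain M N n)
  | 0 => ⊥
  | n + 1 => LinearMap.range (D M N n)

/-- The Hopf bimodule cohomology `H_{A4}^n(M, N)`. -/
abbrev HA4 (n : ℕ) : Type u := Cocycle M N n ⧸ (Coboundary M N n).submoduleOf (Cocycle M N n)

variable {M N}

/-- The cohomology class of a cocycle. -/
noncomputable def cls {n : ℕ} : Cocycle M N n →ₗ[k] HA4 M N n := Submodule.mkQ _

/-- The map `M ⊗ A^{⊗ q} → M' ⊗ A^{⊗ q}` induced by a morphism `M → M'`. -/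
noncomputable def tpowMap {M M' : HopfBimodule k A} (f : HomA4 M M') :
    ∀ q : ℕ, HomA4 (tpow M q) (tpow M' q)
  | 0 => f
  | q + 1 => tensAMap (tpowMap f q)

theorem tensAMap_barStep {W W' : HopfBimodule k A} (r : k) (b : HomA4 (tensA W) W)
    (b' : HomA4 (tensA W') W') (f : HomA4 W W')
    (h : ∀ x, f.1 (b.1 x) = b'.1 ((tensAMap f).1 x)) (x) :
    (tensAMap f).1 ((barStep r b).1 x) = (barStep r b').1 ((tensAMap (tensAMap f)).1 x) := by
  have hc : compH f b = compH b' (tensAMap f) := homA4_ext h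
  rw [barStep_apply, barStep_apply, map_add, map_smul, tensAMap_comp, hc, tensAMap_comp,
    actMap_nat]

theorem tpowMap_barMap {M M' : HopfBimodule k A} (f : HomA4 M M') (q : ℕ) (x) :
    (tpowMap f q).1 ((barMap M q).1 x) = (barMap M' q).1 ((tpowMap f (q + 1)).1 x) := by
  induction q with
  | zero => exact (actMap_nat f x).symm
  | succ q ih => exact tensAMap_barStep _ _ _ (tpowMap f q) ih x

variable (N) in
/-- The pullback of cochains along a morphism `M → M'`. -/
noncomputable def pullC {M M' : HopfBimodule k A} (f : HomA4 M M') (n : ℕ) :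
    Cochain M' N n →ₗ[k] Cochain M N n where
  toFun F := fun x => HomA4.precomp (upow N (x.1.1 + 1)) (tpowMap f (x.1.2 + 1)) (F x)
  map_add' _ _ := cochain_ext fun _ _ _ => homA4_ext fun _ => rfl
  map_smul' _ _ := cochain_ext fun _ _ _ => homA4_ext fun _ => rfl

theorem pullC_D {M M' : HopfBimodule k A} (f : HomA4 M M') (n : ℕ) (F : Cochain M' N n) :
    pullC N f (n + 1) (D M' N n F) = D M N n (pullC N f n F) := by
  have hh : ∀ p q (α : KK M' N p q), HomA4.precomp (upow N (p + 1)) (tpowMap f (q + 2))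
      (dh M' N p q α) = dh M N p q (HomA4.precomp (upow N (p + 1)) (tpowMap f (q + 1)) α) :=
    fun p q α => homA4_ext fun x => by
      change α.1 ((barMap M' (q + 1)).1 ((tpowMap f (q + 1 + 1)).1 x)) =
        α.1 ((tpowMap f (q + 1)).1 ((barMap M (q + 1)).1 x))
      rw [tpowMap_barMap]
  have hc : ∀ p q (α : KK M' N p q), HomA4.precomp (upow N (p + 2)) (tpowMap f (q + 1))
      (dc M' N p q α) = dc M N p q (HomA4.precomp (upow N (p + 1)) (tpowMap f (q + 1)) α) :=
    fun p q α => rfl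
  refine cochain_ext fun p q h => ?_
  change HomA4.precomp (upow N (p + 1)) (tpowMap f (q + 1)) (hPart F p q h + cPart F p q h) =
    hPart (pullC N f n F) p q h + cPart (pullC N f n F) p q h
  rw [map_add]
  congr 1
  · cases q with
    | zero => exact map_zero _
    | succ q => exact hh p q _
  · cases p with
    | zero => exact map_zero _
    | succ p => exact hc p q _

variable (N) in
/-- The pullback of cocycles along a morphism `M → M'`. -/
noncomputable def pullZ {M M' : HopfBimodule k A} (f : HomA4 M M') (n : ℕ) :
    Cocycle M' N n →ₗ[k] Cocycle M N n :=
  (pullC N f n).restrict fun F hF => by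
    rw [Cocycle, LinearMap.mem_ker] at hF ⊢
    rw [← pullC_D, hF, map_zero]

theorem pullC_coboundary {M M' : HopfBimodule k A} (f : HomA4 M M') (n : ℕ)
    (F : Cochain M' N n) (hF : F ∈ Coboundary M' N n) : pullC N f n F ∈ Coboundary M N n := by
  cases n with
  | zero =>
    change F = 0 at hF
    rw [hF, map_zero]
    exact zero_mem _
  | succ n =>
    obtain ⟨G, rfl⟩ := hF
    exact ⟨pullC N f n G, (pullC_D f n G).symm⟩

variable (N) in
/-- The map `H_{A4}^n(M', N) → H_{A4}^n(M, N)` induced by a morphism `M → M'`. -/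
noncomputable def pullH {M M' : HopfBimodule k A} (f : HomA4 M M') (n : ℕ) :
    HA4 M' N n →ₗ[k] HA4 M N n :=
  Submodule.mapQ _ _ (pullZ N f n) fun F hF => pullC_coboundary f n F.1 hF

/-- The `0`-cochain `δ_L ∘ β ∘ μ_R` that corresponds to a morphism `β : M → N`. -/
noncomputable def unitCochain (β : HomA4 M N) : Cochain M N 0 := fun x =>
  match x with
  | ⟨(0, 0), _⟩ => compH (compH (coactMap N) β) (actMap M)
  | ⟨(p + 1, _), h⟩ => absurd h (by simp)
  | ⟨(0, q + 1), h⟩ => absurd h (by simp)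

theorem unitCochain_mem (β : HomA4 M N) : unitCochain β ∈ LinearMap.ker (D M N 0) := by
  refine LinearMap.mem_ker.mpr (cochain_ext fun p q h => ?_)
  rcases p with _ | p <;> rcases q with _ | q
  · omega
  · obtain rfl : q = 0 := by omega
    refine (add_zero _).trans (homA4_ext fun x => ?_)
    change (coactMap N).1 (β.1 ((actMap M).1 ((barMap M 1).1 x))) = 0
    have h1 : (actMap M).1 ((barMap M 1).1 x) = 0 := barMap_barMap 0 x
    rw [h1, map_zero, map_zero]
  · obtain rfl : p = 0 := by omega
    refine (zero_add _).trans (homA4_ext fun x => ?_)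
    refine (congrArg ((-1 : k) ^ 0 • ·) (cobarMap_cobarMap (N := N) 0 (β.1 ((actMap M).1 x)))).trans ?_
    exact smul_zero _
  · omega

/-- The `0`-cocycle `δ_L ∘ β ∘ μ_R` that corresponds to a morphism `β : M → N`. -/
noncomputable def unitCocycle (β : HomA4 M N) : Cocycle M N 0 :=
  ⟨unitCochain β, unitCochain_mem β⟩

end Complex



section Extension

variable {k A : Type u} [Field k] [Ring A] [HopfAlgebra k A] {M N : HopfBimodule k A}

variable (M N) in
/-- Left linear and right colinear maps `f₀ : M ⊗ A → N` and `f₁ : M → A ⊗ N` for which the matrices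
`(μ_R^N, f₀; 0, μ_R^M)` and `(δ_L^N, f₁; 0, δ_L^M)` define a Hopf bimodule on `N ⊕ M`. -/
structure ExtData where
  f₀ : M.V ⊗[k] A →ₗ[k] N.V
  f₁ : M.V →ₗ[k] A ⊗[k] N.V
  f₀_lact : ∀ a m b, f₀ (M.lact a m ⊗ₜ b) = N.lact a (f₀ (m ⊗ₜ b))
  f₀_δR : ∀ x, N.δR (f₀ x) = f₀.rTensor A (codiagR M.δR comul x)
  f₁_lact : ∀ a m, f₁ (M.lact a m) = diag (leftMul k A) N.lact a (f₁ m)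
  f₁_δR : ∀ m, (TensorProduct.assoc k A N.V A).symm (N.δR.lTensor A (f₁ m)) =
    f₁.rTensor A (M.δR m)
  eq₀₂ : ∀ m a b, f₀ (M.ract (MulOpposite.op a) m ⊗ₜ b) + N.ract (MulOpposite.op b) (f₀ (m ⊗ₜ a)) =
    f₀ (m ⊗ₜ (a * b))
  eq₁₁ : ∀ m a, f₁ (M.ract (MulOpposite.op a) m) + N.δL (f₀ (m ⊗ₜ a)) =
    diag (rightMul k A) N.ract (MulOpposite.op a) (f₁ m) +
      f₀.lTensor A (codiagL M.δL comul (m ⊗ₜ a))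
  eq₂₀ : ∀ m, TensorProduct.assoc k A A N.V (comul.rTensor N.V (f₁ m)) =
    f₁.lTensor A (M.δL m) + N.δL.lTensor A (f₁ m)

namespace ExtData

variable (f : ExtData M N)

theorem f₀_one (m : M.V) : f.f₀ (m ⊗ₜ 1) = 0 := by
  have h := f.eq₀₂ m 1 1
  rw [MulOpposite.op_one, map_one, map_one, mul_one, Module.End.one_apply, Module.End.one_apply]
    at h
  simpa using h

theorem f₁_counit (m : M.V) : counit.rTensor N.V (f.f₁ m) = 0 := by
  let e : A ⊗[k] (A ⊗[k] N.V) →ₗ[k] k ⊗[k] (k ⊗[k] N.V) := map counit (counit.rTensor N.V)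
  have h := congrArg (fun t => TensorProduct.lid k _ (e t)) (f.eq₂₀ m)
  have h1 : ∀ t : A ⊗[k] N.V, TensorProduct.lid k _
      (e (TensorProduct.assoc k A A N.V (comul.rTensor N.V t))) = counit.rTensor N.V t := by
    intro t
    induction t with
    | zero =>
      simp only [LinearMap.map_zero, LinearEquiv.map_zero, zero_tmul, tmul_zero,
        LinearMap.zero_apply, mul_zero, zero_mul]
    | add x y hx hy => simp only [LinearMap.map_add, LinearEquiv.map_add, hx, hy]
    | tmul a n =>
      have h2 : ∀ s : A ⊗[k] A, TensorProduct.lid k _ (e (TensorProduct.assoc k A A N.V (s ⊗ₜ n))) =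
          counit (R := k) (TensorProduct.lid k A (counit.rTensor A s)) ⊗ₜ n := by
        intro s
        induction s with
        | zero =>
          simp only [LinearMap.map_zero, LinearEquiv.map_zero, zero_tmul, tmul_zero,
            LinearMap.zero_apply, mul_zero, zero_mul]
        | add x y hx hy => simp only [LinearMap.map_add, LinearEquiv.map_add, add_tmul, hx, hy]
        | tmul b c => simp [e, smul_tmul']
      rw [LinearMap.rTensor_tmul, h2, Coalgebra.rTensor_counit_comul, LinearMap.rTensor_tmul]
      simp
  have h2 : ∀ t : A ⊗[k] M.V, TensorProduct.lid k _ (e (f.f₁.lTensor A t)) =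
      counit.rTensor N.V (f.f₁ (TensorProduct.lid k _ (counit.rTensor M.V t))) := by
    intro t
    induction t with
    | zero =>
      simp only [LinearMap.map_zero, LinearEquiv.map_zero, zero_tmul, tmul_zero,
        LinearMap.zero_apply, mul_zero, zero_mul]
    | add x y hx hy => simp only [LinearMap.map_add, LinearEquiv.map_add, hx, hy]
    | tmul a n => simp [e]
  have h3 : ∀ t : A ⊗[k] N.V, TensorProduct.lid k _ (e (N.δL.lTensor A t)) =
      counit.rTensor N.V t := by
    intro t
    induction t with
    | zero =>
      simp only [LinearMap.map_zero, LinearEquiv.map_zero, zero_tmul, tmul_zero,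
        LinearMap.zero_apply, mul_zero, zero_mul]
    | add x y hx hy => simp only [LinearMap.map_add, LinearEquiv.map_add, hx, hy]
    | tmul a n => simp [e, N.counitL, smul_tmul']
  simp only [map_add] at h
  rw [h1, h2, h3, M.counitL] at h
  simpa using h

/-- The map `n + m ↦ (n b + f₀(m ⊗ b)) + m b`. -/
noncomputable def ractLin : Aᵐᵒᵖ →ₗ[k] Module.End k (N.V × M.V) :=
  LinearMap.mk₂ k (fun b v => (N.ract b v.1 + f.f₀ (v.2 ⊗ₜ b.unop), M.ract b v.2))
    (by intros; ext <;> simp [tmul_add]; abel)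
    (by intros; ext <;> simp)
    (by intros; ext <;> simp [add_tmul]; abel)
    (by
      intro r b v
      refine Prod.ext ?_ (map_smul (M.ract b) r v.2)
      change N.ract b (r • v.1) + f.f₀ ((r • v.2) ⊗ₜ b.unop) =
        r • (N.ract b v.1 + f.f₀ (v.2 ⊗ₜ b.unop))
      rw [map_smul, ← smul_tmul', map_smul, smul_add])

/-- The right action with matrix `(μ_R^N, f₀; 0, μ_R^M)`. -/
noncomputable def ractE : Aᵐᵒᵖ →ₐ[k] Module.End k (N.V × M.V) :=
  AlgHom.ofLinearMap f.ractLin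
    (by
      refine LinearMap.ext fun v => ?_
      change (N.ract 1 v.1 + f.f₀ (v.2 ⊗ₜ 1), M.ract 1 v.2) = v
      rw [f₀_one, map_one, map_one, add_zero]
      rfl)
    (by
      intro b c
      refine LinearMap.ext fun v => ?_
      change (N.ract (b * c) v.1 + f.f₀ (v.2 ⊗ₜ (c.unop * b.unop)), M.ract (b * c) v.2) =
        (N.ract b (N.ract c v.1 + f.f₀ (v.2 ⊗ₜ c.unop)) + f.f₀ (M.ract c v.2 ⊗ₜ b.unop),
          M.ract b (M.ract c v.2))
      rw [← f.eq₀₂, map_mul, map_mul, map_add]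
      simp only [MulOpposite.op_unop, Module.End.mul_apply]
      congr 1
      abel)

theorem ractE_apply (b : Aᵐᵒᵖ) (v : N.V × M.V) :
    f.ractE b v = (N.ract b v.1 + f.f₀ (v.2 ⊗ₜ b.unop), M.ract b v.2) := rfl

variable (M N) in
/-- The left action with matrix `(μ_L^N, 0; 0, μ_L^M)`. -/
noncomputable def lactE : A →ₐ[k] Module.End k (N.V × M.V) :=
  (LinearMap.prodMapAlgHom k N.V M.V).comp (AlgHom.prod N.lact M.lact)

theorem lactE_apply (a : A) (v : N.V × M.V) : lactE M N a v = (N.lact a v.1, M.lact a v.2) := rfl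

variable (M N) in
/-- The inclusion `N → N ⊕ M`. -/
abbrev ι : N.V →ₗ[k] N.V × M.V := LinearMap.inl k N.V M.V

variable (M N) in
/-- The linear section `M → N ⊕ M`. -/
abbrev κ : M.V →ₗ[k] N.V × M.V := LinearMap.inr k N.V M.V

/-- The left coaction with matrix `(δ_L^N, f₁; 0, δ_L^M)`. -/
noncomputable def δLE : N.V × M.V →ₗ[k] A ⊗[k] (N.V × M.V) :=
  LinearMap.coprod ((ι M N).lTensor A ∘ₗ N.δL)
    ((ι M N).lTensor A ∘ₗ f.f₁ + (κ M N).lTensor A ∘ₗ M.δL)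

variable (M N) in
/-- The right coaction with matrix `(δ_R^N, 0; 0, δ_R^M)`. -/
noncomputable def δRE : N.V × M.V →ₗ[k] (N.V × M.V) ⊗[k] A :=
  LinearMap.coprod ((ι M N).rTensor A ∘ₗ N.δR) ((κ M N).rTensor A ∘ₗ M.δR)

theorem δLE_ι (n : N.V) : f.δLE (ι M N n) = (ι M N).lTensor A (N.δL n) := by simp [δLE]
theorem δLE_κ (m : M.V) : f.δLE (κ M N m) =
    (ι M N).lTensor A (f.f₁ m) + (κ M N).lTensor A (M.δL m) := by simp [δLE]
theorem δRE_ι (n : N.V) : δRE M N (ι M N n) = (ι M N).rTensor A (N.δR n) := by simp [δRE]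
theorem δRE_κ (m : M.V) : δRE M N (κ M N m) = (κ M N).rTensor A (M.δR m) := by simp [δRE]
theorem lactE_ι (a) (n : N.V) : lactE M N a (ι M N n) = ι M N (N.lact a n) := by simp [lactE_apply]
theorem lactE_κ (a) (m : M.V) : lactE M N a (κ M N m) = κ M N (M.lact a m) := by simp [lactE_apply]
theorem ractE_ι (b) (n : N.V) : f.ractE b (ι M N n) = ι M N (N.ract b n) := by simp [ractE_apply]
theorem ractE_κ (b) (m : M.V) : f.ractE b (κ M N m) =
    ι M N (f.f₀ (m ⊗ₜ b.unop)) + κ M N (M.ract b m) := by simp [ractE_apply]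

theorem ext_ικ {Z : Type u} [AddCommGroup Z] [Module k Z] {F G : N.V × M.V →ₗ[k] Z}
    (h : ∀ n, F (ι M N n) = G (ι M N n)) (h' : ∀ m, F (κ M N m) = G (κ M N m)) (v) : F v = G v :=
  LinearMap.congr_fun (LinearMap.prod_ext (LinearMap.ext h) (LinearMap.ext h')) v

theorem rTensor_lTensor {U V W Z : Type u} [AddCommGroup U] [Module k U] [AddCommGroup V]
    [Module k V] [AddCommGroup W] [Module k W] [AddCommGroup Z] [Module k Z]
    (g : U →ₗ[k] V) (j : W →ₗ[k] Z) (t : U ⊗[k] W) :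
    g.rTensor Z (j.lTensor U t) = j.lTensor V (g.rTensor W t) := by
  rw [← LinearMap.comp_apply, ← LinearMap.comp_apply, LinearMap.rTensor_comp_lTensor,
    LinearMap.lTensor_comp_rTensor]

theorem comul_lTensor {V W : Type u} [AddCommGroup V] [Module k V] [AddCommGroup W] [Module k W]
    (j : V →ₗ[k] W) (t : A ⊗[k] V) :
    TensorProduct.assoc k A A W (comul.rTensor W (j.lTensor A t)) =
      (j.lTensor A).lTensor A (TensorProduct.assoc k A A V (comul.rTensor V t)) := by
  induction t with
  | zero =>
    simp only [LinearMap.map_zero, LinearEquiv.map_zero, zero_tmul, tmul_zero,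
      LinearMap.zero_apply, mul_zero, zero_mul]
  | add x y hx hy => simp only [LinearMap.map_add, LinearEquiv.map_add, hx, hy]
  | tmul a v =>
    simp only [LinearMap.lTensor_tmul, LinearMap.rTensor_tmul]
    generalize comul (R := k) a = s
    induction s with
    | zero =>
      simp only [LinearMap.map_zero, LinearEquiv.map_zero, zero_tmul, tmul_zero,
        LinearMap.zero_apply, mul_zero, zero_mul]
    | add x y hx hy => simp only [LinearMap.map_add, LinearEquiv.map_add, add_tmul, hx, hy]
    | tmul b c => rfl

theorem assoc_rTensor {V W : Type u} [AddCommGroup V] [Module k V] [AddCommGroup W] [Module k W]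
    (j : V →ₗ[k] W) (t : (V ⊗[k] A) ⊗[k] A) :
    TensorProduct.assoc k W A A ((j.rTensor A).rTensor A t) =
      j.rTensor (A ⊗[k] A) (TensorProduct.assoc k V A A t) := by
  induction t with
  | zero =>
    simp only [LinearMap.map_zero, LinearEquiv.map_zero, zero_tmul, tmul_zero,
      LinearMap.zero_apply, mul_zero, zero_mul]
  | add x y hx hy => simp only [LinearMap.map_add, LinearEquiv.map_add, hx, hy]
  | tmul s a =>
    induction s with
    | zero =>
      simp only [LinearMap.map_zero, LinearEquiv.map_zero, zero_tmul, tmul_zero,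
        LinearMap.zero_apply, mul_zero, zero_mul]
    | add x y hx hy => simp only [LinearMap.map_add, LinearEquiv.map_add, add_tmul, hx, hy]
    | tmul b c => rfl

theorem assoc_mid {V W : Type u} [AddCommGroup V] [Module k V] [AddCommGroup W] [Module k W]
    (j : V →ₗ[k] W) (t : (A ⊗[k] V) ⊗[k] A) :
    TensorProduct.assoc k A W A ((j.lTensor A).rTensor A t) =
      (j.rTensor A).lTensor A (TensorProduct.assoc k A V A t) := by
  induction t with
  | zero =>
    simp only [LinearMap.map_zero, LinearEquiv.map_zero, zero_tmul, tmul_zero,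
      LinearMap.zero_apply, mul_zero, zero_mul]
  | add x y hx hy => simp only [LinearMap.map_add, LinearEquiv.map_add, hx, hy]
  | tmul s a =>
    induction s with
    | zero =>
      simp only [LinearMap.map_zero, LinearEquiv.map_zero, zero_tmul, tmul_zero,
        LinearMap.zero_apply, mul_zero, zero_mul]
    | add x y hx hy => simp only [LinearMap.map_add, LinearEquiv.map_add, add_tmul, hx, hy]
    | tmul b c => rfl

theorem lTensor_congr {U V W : Type u} [AddCommGroup V] [Module k V] [AddCommGroup W] [Module k W]
    [AddCommGroup U] [Module k U]
    {g : V →ₗ[k] W} {j : U →ₗ[k] V} {h : U →ₗ[k] W} (hg : ∀ v, g (j v) = h v) (t : A ⊗[k] U) :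
    g.lTensor A (j.lTensor A t) = h.lTensor A t := by
  rw [← LinearMap.lTensor_comp_apply, LinearMap.ext (f := g ∘ₗ j) (g := h) hg]

theorem rTensor_congr {U V W : Type u} [AddCommGroup V] [Module k V] [AddCommGroup W] [Module k W]
    [AddCommGroup U] [Module k U]
    {g : V →ₗ[k] W} {j : U →ₗ[k] V} {h : U →ₗ[k] W} (hg : ∀ v, g (j v) = h v) (t : U ⊗[k] A) :
    g.rTensor A (j.rTensor A t) = h.rTensor A t := by
  rw [← LinearMap.rTensor_comp_apply, LinearMap.ext (f := g ∘ₗ j) (g := h) hg]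

theorem diag_κL (b : Aᵐᵒᵖ) (t : A ⊗[k] M.V) :
    diag (rightMul k A) f.ractE b ((κ M N).lTensor A t) =
      (κ M N).lTensor A (diag (rightMul k A) M.ract b t) +
        (ι M N).lTensor A (f.f₀.lTensor A (shufL A M.V A (t ⊗ₜ comul b.unop))) := by
  rw [diag_eq, diag_eq, MulOpposite.comul_def]
  simp only [LinearMap.comp_apply, LinearEquiv.coe_coe, MulOpposite.coe_opLinearEquiv_symm]
  generalize comul (R := k) b.unop = s
  induction s with
  | zero => simp
  | add x y hx hy =>
    simp only [LinearMap.map_add, LinearEquiv.map_add, tmul_add, LinearMap.add_apply, hx, hy]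
    abel
  | tmul c d =>
    induction t with
    | zero => simp
    | add x y hx hy =>
      simp only [LinearMap.map_add, LinearEquiv.map_add, add_tmul, hx, hy]
      abel
    | tmul a m =>
      simp only [map_tmul, LinearMap.lTensor_tmul, diagAux_tmul, shufL_tmul, LinearEquiv.coe_coe,
        MulOpposite.coe_opLinearEquiv, ractE_κ, tmul_add, MulOpposite.unop_op]
      rw [add_comm]
      rfl

theorem diag_κR (b : Aᵐᵒᵖ) (t : M.V ⊗[k] A) :
    diag f.ractE (rightMul k A) b ((κ M N).rTensor A t) =
      (κ M N).rTensor A (diag M.ract (rightMul k A) b t) +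
        (ι M N).rTensor A (f.f₀.rTensor A (shufR A M.V A (t ⊗ₜ comul b.unop))) := by
  rw [diag_eq, diag_eq, MulOpposite.comul_def]
  simp only [LinearMap.comp_apply, LinearEquiv.coe_coe, MulOpposite.coe_opLinearEquiv_symm]
  generalize comul (R := k) b.unop = s
  induction s with
  | zero => simp
  | add x y hx hy =>
    simp only [LinearMap.map_add, LinearEquiv.map_add, tmul_add, LinearMap.add_apply, hx, hy]
    abel
  | tmul c d =>
    induction t with
    | zero => simp
    | add x y hx hy =>
      simp only [LinearMap.map_add, LinearEquiv.map_add, add_tmul, hx, hy]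
      abel
    | tmul m a =>
      simp only [map_tmul, LinearMap.rTensor_tmul, diagAux_tmul, shufR_tmul, LinearEquiv.coe_coe,
        MulOpposite.coe_opLinearEquiv, ractE_κ, add_tmul, MulOpposite.unop_op]
      rw [add_comm]
      rfl

/-- The Hopf bimodule `N ⊕ M` given by `f₀` and `f₁`: the right action is
`(n + m) b = (n b + f₀(m ⊗ b)) + m b`, the left coaction is `n + m ↦ δ_L n + f₁ m + δ_L m`, and the
left action and the right coaction are those of the direct sum. -/
noncomputable def total : HopfBimodule k A where
  V := N.V × M.V
  lact := lactE M N
  ract := f.ractE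
  δL := f.δLE
  δR := δRE M N
  lact_ract a b := LinearMap.ext fun v => by
    rw [Module.End.mul_apply, Module.End.mul_apply, lactE_apply, lactE_apply, ractE_apply,
      ractE_apply, map_add, f.f₀_lact]
    exact Prod.ext (congrArg (· + _) (LinearMap.congr_fun (N.lact_ract a b).eq v.1))
      (LinearMap.congr_fun (M.lact_ract a b).eq v.2)
  coassocL := ext_ικ (F := (TensorProduct.assoc k A A _).toLinearMap ∘ₗ comul.rTensor _ ∘ₗ f.δLE)
    (G := f.δLE.lTensor A ∘ₗ f.δLE)
    (fun n => by
      simp only [LinearMap.comp_apply, LinearEquiv.coe_coe, δLE_ι, comul_lTensor, N.coassocL]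
      rw [lTensor_congr (h := (ι M N).lTensor A ∘ₗ N.δL) f.δLE_ι, LinearMap.lTensor_comp_apply])
    (fun m => by
      simp only [LinearMap.comp_apply, LinearEquiv.coe_coe, δLE_κ, map_add, comul_lTensor,
        M.coassocL, f.eq₂₀]
      rw [lTensor_congr (h := (ι M N).lTensor A ∘ₗ N.δL) f.δLE_ι,
        lTensor_congr (h := (ι M N).lTensor A ∘ₗ f.f₁ + (κ M N).lTensor A ∘ₗ M.δL) f.δLE_κ,
        LinearMap.lTensor_add, LinearMap.add_apply, LinearMap.lTensor_comp_apply,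
        LinearMap.lTensor_comp_apply, LinearMap.lTensor_comp_apply]
      abel)
  counitL := ext_ικ (F := counit.rTensor _ ∘ₗ f.δLE) (G := TensorProduct.mk k k _ 1)
    (fun n => by
      rw [LinearMap.comp_apply, δLE_ι, ← LinearMap.comp_apply, LinearMap.rTensor_comp_lTensor,
        ← LinearMap.lTensor_comp_rTensor, LinearMap.comp_apply, N.counitL]
      rfl)
    (fun m => by
      rw [LinearMap.comp_apply, δLE_κ, map_add, ← LinearMap.comp_apply,
        LinearMap.rTensor_comp_lTensor,
        ← LinearMap.lTensor_comp_rTensor, LinearMap.comp_apply, f.f₁_counit, map_zero, zero_add,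
        ← LinearMap.comp_apply, LinearMap.rTensor_comp_lTensor,
        ← LinearMap.lTensor_comp_rTensor, LinearMap.comp_apply, M.counitL]
      rfl)
  coassocR := ext_ικ (F := (TensorProduct.assoc k _ A A).toLinearMap ∘ₗ (δRE M N).rTensor A ∘ₗ
      δRE M N) (G := comul.lTensor _ ∘ₗ δRE M N)
    (fun n => by
      simp only [LinearMap.comp_apply, LinearEquiv.coe_coe, δRE_ι]
      rw [rTensor_congr (h := (ι M N).rTensor A ∘ₗ N.δR) δRE_ι, LinearMap.rTensor_comp_apply,
        assoc_rTensor, N.coassocR]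
      exact rTensor_lTensor _ _ _)
    (fun n => by
      simp only [LinearMap.comp_apply, LinearEquiv.coe_coe, δRE_κ]
      rw [rTensor_congr (h := (κ M N).rTensor A ∘ₗ M.δR) δRE_κ, LinearMap.rTensor_comp_apply,
        assoc_rTensor, M.coassocR]
      exact rTensor_lTensor _ _ _)
  counitR := ext_ικ (F := counit.lTensor _ ∘ₗ δRE M N) (G := (TensorProduct.mk k _ k).flip 1)
    (fun n => by
      rw [LinearMap.comp_apply, δRE_ι, ← LinearMap.comp_apply, LinearMap.lTensor_comp_rTensor,
        ← LinearMap.rTensor_comp_lTensor, LinearMap.comp_apply, N.counitR]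
      rfl)
    (fun n => by
      rw [LinearMap.comp_apply, δRE_κ, ← LinearMap.comp_apply, LinearMap.lTensor_comp_rTensor,
        ← LinearMap.rTensor_comp_lTensor, LinearMap.comp_apply, M.counitR]
      rfl)
  bicomod := ext_ικ (F := (TensorProduct.assoc k A _ A).toLinearMap ∘ₗ f.δLE.rTensor A ∘ₗ δRE M N)
      (G := (δRE M N).lTensor A ∘ₗ f.δLE)
    (fun n => by
      simp only [LinearMap.comp_apply, LinearEquiv.coe_coe, δRE_ι, δLE_ι]
      rw [rTensor_congr (h := (ι M N).lTensor A ∘ₗ N.δL) f.δLE_ι,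
        lTensor_congr (h := (ι M N).rTensor A ∘ₗ N.δR) δRE_ι, LinearMap.rTensor_comp_apply,
        LinearMap.lTensor_comp_apply, assoc_mid, N.bicomod])
    (fun m => by
      have h := f.f₁_δR m
      rw [LinearEquiv.symm_apply_eq] at h
      simp only [LinearMap.comp_apply, LinearEquiv.coe_coe, δRE_κ, δLE_κ, map_add]
      rw [rTensor_congr (h := (ι M N).lTensor A ∘ₗ f.f₁ + (κ M N).lTensor A ∘ₗ M.δL) f.δLE_κ,
        lTensor_congr (h := (ι M N).rTensor A ∘ₗ N.δR) δRE_ι,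
        lTensor_congr (h := (κ M N).rTensor A ∘ₗ M.δR) δRE_κ, LinearMap.rTensor_add,
        LinearMap.add_apply, map_add, LinearMap.rTensor_comp_apply, LinearMap.rTensor_comp_apply,
        LinearMap.lTensor_comp_apply, LinearMap.lTensor_comp_apply, assoc_mid, assoc_mid,
        M.bicomod, h])
  δL_lact a := ext_ικ (F := f.δLE ∘ₗ lactE M N a)
      (G := diag (leftMul k A) (lactE M N) a ∘ₗ f.δLE)
    (fun n => by
      rw [LinearMap.comp_apply, LinearMap.comp_apply, lactE_ι, δLE_ι, δLE_ι, N.δL_lact]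
      exact map_diag LinearMap.id (ι M N) (fun _ _ => rfl) (fun a n => (lactE_ι a n).symm) _ _)
    (fun n => by
      rw [LinearMap.comp_apply, LinearMap.comp_apply, lactE_κ, δLE_κ, δLE_κ, M.δL_lact, f.f₁_lact,
        map_add]
      exact congrArg₂ (· + ·)
        (map_diag LinearMap.id (ι M N) (fun _ _ => rfl) (fun a n => (lactE_ι a n).symm) _ _)
        (map_diag LinearMap.id (κ M N) (fun _ _ => rfl) (fun a n => (lactE_κ a n).symm) _ _))
  δL_ract b := ext_ικ (F := f.δLE ∘ₗ f.ractE b)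
      (G := diag (rightMul k A) f.ractE b ∘ₗ f.δLE)
    (fun n => by
      rw [LinearMap.comp_apply, LinearMap.comp_apply, ractE_ι, δLE_ι, δLE_ι, N.δL_ract]
      exact map_diag LinearMap.id (ι M N) (fun _ _ => rfl) (fun a n => (f.ractE_ι a n).symm) _ _)
    (fun m => by
      have h := f.eq₁₁ m b.unop
      rw [MulOpposite.op_unop, codiagL_tmul] at h
      have h1 := congrArg ((ι M N).lTensor A) h
      rw [map_add, map_add] at h1
      have h2 : (ι M N).lTensor A (diag (rightMul k A) N.ract b (f.f₁ m)) =
          diag (rightMul k A) f.ractE b ((ι M N).lTensor A (f.f₁ m)) :=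
        map_diag LinearMap.id (ι M N) (fun _ _ => rfl) (fun a n => (f.ractE_ι a n).symm) _ _
      rw [LinearMap.comp_apply, LinearMap.comp_apply, ractE_κ, map_add, δLE_ι, δLE_κ, δLE_κ,
        M.δL_ract, map_add, diag_κL, ← h2, ← add_assoc, add_comm ((ι M N).lTensor A (N.δL _)), h1]
      abel)
  δR_lact a := ext_ικ (F := δRE M N ∘ₗ lactE M N a)
      (G := diag (lactE M N) (leftMul k A) a ∘ₗ δRE M N)
    (fun n => by
      rw [LinearMap.comp_apply, LinearMap.comp_apply, lactE_ι, δRE_ι, δRE_ι, N.δR_lact]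
      exact map_diag (ι M N) LinearMap.id (fun a n => (lactE_ι a n).symm) (fun _ _ => rfl) _ _)
    (fun n => by
      rw [LinearMap.comp_apply, LinearMap.comp_apply, lactE_κ, δRE_κ, δRE_κ, M.δR_lact]
      exact map_diag (κ M N) LinearMap.id (fun a n => (lactE_κ a n).symm) (fun _ _ => rfl) _ _)
  δR_ract b := ext_ικ (F := δRE M N ∘ₗ f.ractE b)
      (G := diag f.ractE (rightMul k A) b ∘ₗ δRE M N)
    (fun n => by
      rw [LinearMap.comp_apply, LinearMap.comp_apply, ractE_ι, δRE_ι, δRE_ι, N.δR_ract]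
      exact map_diag (ι M N) LinearMap.id (fun a n => (f.ractE_ι a n).symm) (fun _ _ => rfl) _ _)
    (fun m => by
      rw [LinearMap.comp_apply, LinearMap.comp_apply, ractE_κ, map_add, δRE_ι, δRE_κ, δRE_κ,
        M.δR_ract, diag_κR, f.f₀_δR, codiagR_tmul, add_comm])

/-- The inclusion `N → N ⊕ M` as a morphism of Hopf bimodules. -/
noncomputable def incl : HomA4 N f.total :=
  ⟨ι M N, fun a n => (lactE_ι a n).symm, fun b n => (f.ractE_ι b n).symm, f.δLE_ι, δRE_ι⟩

/-- The projection `N ⊕ M → M` as a morphism of Hopf bimodules. -/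
noncomputable def proj : HomA4 f.total M :=
  ⟨LinearMap.snd k N.V M.V, fun a n => rfl, fun b n => rfl,
    ext_ικ (F := M.δL ∘ₗ LinearMap.snd k N.V M.V)
      (G := (LinearMap.snd k N.V M.V).lTensor A ∘ₗ f.δLE)
      (fun n => by
        rw [LinearMap.comp_apply, LinearMap.comp_apply, δLE_ι, lTensor_congr (h := 0) (fun _ => rfl)]
        simp)
      (fun m => by
        rw [LinearMap.comp_apply, LinearMap.comp_apply, δLE_κ, map_add,
          lTensor_congr (h := 0) (fun _ => rfl), lTensor_congr (h := LinearMap.id) (fun _ => rfl)]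
        simp),
    ext_ικ (F := M.δR ∘ₗ LinearMap.snd k N.V M.V)
      (G := (LinearMap.snd k N.V M.V).rTensor A ∘ₗ δRE M N)
      (fun n => by
        rw [LinearMap.comp_apply, LinearMap.comp_apply, δRE_ι, rTensor_congr (h := 0) (fun _ => rfl)]
        simp)
      (fun m => by
        rw [LinearMap.comp_apply, LinearMap.comp_apply, δRE_κ,
          rTensor_congr (h := LinearMap.id) (fun _ => rfl)]
        simp)⟩

/-- The sequence `0 → N → N ⊕ M → M → 0` is exact. -/
theorem isShortExact [FiniteDimensional k A] : IsShortExact f.incl f.proj where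
  inj := LinearMap.inl_injective
  exact := Function.Exact.inl_snd
  surj := LinearMap.snd_surjective

end ExtData

variable (A) in
/-- The linear map `A ⊗ Z → Z`, `a ⊗ z ↦ ε(a) z`. -/
noncomputable def counitLin (Z : Type u) [AddCommGroup Z] [Module k Z] : A ⊗[k] Z →ₗ[k] Z :=
  (TensorProduct.lid k Z).toLinearMap ∘ₗ counit.rTensor Z

section CounitLin

variable {Y Z : Type u} [AddCommGroup Z] [Module k Z] [AddCommGroup Y] [Module k Y]

theorem counitLin_tmul (a : A) (z : Z) :
    counitLin A Z (a ⊗ₜ[k] z) = counit (R := k) a • z := rfl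

theorem counitLin_diag {C : Type u} [Ring C] [Bialgebra k C]
    (f : C →ₐ[k] Module.End k A)
    (hf : ∀ c a, counit (R := k) (f c a) = counit (R := k) c * counit (R := k) a)
    (g : C →ₐ[k] Module.End k Z) (c : C) (t : A ⊗[k] Z) :
    counitLin A Z (diag f g c t) = g c (counitLin A Z t) := by
  induction t with
  | zero =>
    simp only [LinearMap.map_zero, LinearEquiv.map_zero, zero_tmul, tmul_zero,
      LinearMap.zero_apply, mul_zero, zero_mul]
  | add x y hx hy => simp only [LinearMap.map_add, LinearEquiv.map_add, hx, hy]
  | tmul a z =>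
    have h : ∀ s : C ⊗[k] C, counitLin A Z (diagAux f g s (a ⊗ₜ z)) =
        counit (R := k) a • g (TensorProduct.lid k C (counit.rTensor C s)) z := by
      intro s
      induction s with
      | zero => simp
      | add x y hx hy => simp only [map_add, LinearMap.add_apply, smul_add, hx, hy]
      | tmul x y =>
        rw [diagAux_tmul, map_tmul, counitLin_tmul, hf, LinearMap.rTensor_tmul, lid_tmul, map_smul,
          LinearMap.smul_apply, smul_smul, mul_comm]
    rw [diag_eq, h, Coalgebra.rTensor_counit_comul, lid_tmul, one_smul, counitLin_tmul, map_smul]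

theorem counitLin_lact (g : A →ₐ[k] Module.End k Z) (a : A) (t : A ⊗[k] Z) :
    counitLin A Z (diag (leftMul k A) g a t) = g a (counitLin A Z t) :=
  counitLin_diag _ (fun c a => Bialgebra.counit_mul c a) _ _ _

theorem counitLin_ract (g : Aᵐᵒᵖ →ₐ[k] Module.End k Z) (b : Aᵐᵒᵖ) (t : A ⊗[k] Z) :
    counitLin A Z (diag (rightMul k A) g b t) = g b (counitLin A Z t) :=
  counitLin_diag _ (fun c a => by
    refine (Bialgebra.counit_mul a c.unop).trans ?_
    rw [mul_comm]
    rfl) _ _ _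

theorem counitLin_comul (t : A ⊗[k] Z) :
    counitLin A (A ⊗[k] Z) (TensorProduct.assoc k A A Z (comul.rTensor Z t)) = t := by
  induction t with
  | zero =>
    simp only [LinearMap.map_zero, LinearEquiv.map_zero, zero_tmul, tmul_zero,
      LinearMap.zero_apply, mul_zero, zero_mul]
  | add x y hx hy => simp only [LinearMap.map_add, LinearEquiv.map_add, hx, hy]
  | tmul a z =>
    have h : ∀ s : A ⊗[k] A, counitLin A (A ⊗[k] Z) (TensorProduct.assoc k A A Z (s ⊗ₜ z)) =
        (TensorProduct.lid k A (counit.rTensor A s)) ⊗ₜ[k] z := by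
      intro s
      induction s with
      | zero =>
        simp only [LinearMap.map_zero, LinearEquiv.map_zero, zero_tmul, tmul_zero,
          LinearMap.zero_apply, mul_zero, zero_mul]
      | add x y hx hy => simp only [LinearMap.map_add, LinearEquiv.map_add, add_tmul, hx, hy]
      | tmul b c => rfl
    rw [LinearMap.rTensor_tmul, h, Coalgebra.rTensor_counit_comul, lid_tmul, one_smul]

theorem counitLin_lTensor_comul (t : A ⊗[k] Z) :
    (counitLin A Z).lTensor A (TensorProduct.assoc k A A Z (comul.rTensor Z t)) = t := by
  induction t with
  | zero =>
    simp only [LinearMap.map_zero, LinearEquiv.map_zero, zero_tmul, tmul_zero,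
      LinearMap.zero_apply, mul_zero, zero_mul]
  | add x y hx hy => simp only [LinearMap.map_add, LinearEquiv.map_add, hx, hy]
  | tmul a z =>
    have h : ∀ s : A ⊗[k] A, (counitLin A Z).lTensor A (TensorProduct.assoc k A A Z (s ⊗ₜ z)) =
        (TensorProduct.rid k A (counit.lTensor A s)) ⊗ₜ[k] z := by
      intro s
      induction s with
      | zero =>
        simp only [LinearMap.map_zero, LinearEquiv.map_zero, zero_tmul, tmul_zero,
          LinearMap.zero_apply, mul_zero, zero_mul]
      | add x y hx hy => simp only [LinearMap.map_add, LinearEquiv.map_add, add_tmul, hx, hy]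
      | tmul b c => simp [counitLin_tmul, smul_tmul']
    rw [LinearMap.rTensor_tmul, h, Coalgebra.lTensor_counit_comul, rid_tmul, one_smul]

theorem counitLin_rTensor (δ : Z →ₗ[k] Z ⊗[k] A) (t : A ⊗[k] Z) :
    (counitLin A Z).rTensor A ((TensorProduct.assoc k A Z A).symm (δ.lTensor A t)) =
      δ (counitLin A Z t) := by
  induction t with
  | zero =>
    simp only [LinearMap.map_zero, LinearEquiv.map_zero, zero_tmul, tmul_zero,
      LinearMap.zero_apply, mul_zero, zero_mul]
  | add x y hx hy => simp only [LinearMap.map_add, LinearEquiv.map_add, hx, hy]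
  | tmul a z =>
    rw [LinearMap.lTensor_tmul, counitLin_tmul, map_smul]
    generalize δ z = s
    induction s with
    | zero => simp
    | add x y hx hy =>
      simp only [LinearMap.map_add, LinearEquiv.map_add, tmul_add, smul_add, hx, hy]
    | tmul y b => rfl

theorem counitLin_nat (g : Y →ₗ[k] Z) (t : A ⊗[k] Y) :
    counitLin A Z (g.lTensor A t) = g (counitLin A Y t) := by
  induction t with
  | zero =>
    simp only [LinearMap.map_zero, LinearEquiv.map_zero, zero_tmul, tmul_zero,
      LinearMap.zero_apply, mul_zero, zero_mul]
  | add x y hx hy => simp only [LinearMap.map_add, LinearEquiv.map_add, hx, hy]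
  | tmul a z => rw [LinearMap.lTensor_tmul, counitLin_tmul, counitLin_tmul, map_smul]

end CounitLin

/-- The linear map `W → Z`, `w ↦ (ε ⊗ 1) α(w ⊗ 1)`, that corresponds to a morphism
`α : W ⊗ A → A ⊗ Z`. -/
noncomputable def flat {W Z : HopfBimodule k A} (α : HomA4 (tensA W) (aTens Z)) : W.V →ₗ[k] Z.V :=
  counitLin A Z.V ∘ₗ α.1 ∘ₗ (TensorProduct.mk k W.V A).flip 1

section Flat

variable {W Z : HopfBimodule k A} (α : HomA4 (tensA W) (aTens Z))

theorem flat_apply (w : W.V) : flat α w = counitLin A Z.V (α.1 (w ⊗ₜ[k] (1 : A) : W.V ⊗[k] A)) := rfl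

theorem flat_lact (a : A) (w : W.V) : flat α (W.lact a w) = Z.lact a (flat α w) := by
  have h := HomA4.map_lact α a (w ⊗ₜ[k] (1 : A) : W.V ⊗[k] A)
  refine (congrArg (counitLin A Z.V) h).trans ?_
  exact counitLin_lact _ a _

theorem flat_ract (b : A) (w : W.V) : counitLin A Z.V (α.1 (w ⊗ₜ[k] b : W.V ⊗[k] A)) =
    Z.ract (MulOpposite.op b) (flat α w) := by
  have h := HomA4.map_ract α (MulOpposite.op b) (w ⊗ₜ[k] (1 : A) : W.V ⊗[k] A)
  have h1 : (tensA W).ract (MulOpposite.op b) (w ⊗ₜ[k] (1 : A) : W.V ⊗[k] A) =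
      (w ⊗ₜ[k] b : W.V ⊗[k] A) := by
    change w ⊗ₜ[k] ((1 : A) * b) = w ⊗ₜ[k] b
    rw [one_mul]
  rw [h1] at h
  refine (congrArg (counitLin A Z.V) h).trans ?_
  exact counitLin_ract _ _ _

theorem comul_one_shufL (t : A ⊗[k] W.V) :
    shufL A W.V A (t ⊗ₜ[k] comul (1 : A)) = ((TensorProduct.mk k W.V A).flip 1).lTensor A t := by
  rw [Bialgebra.comul_one]
  induction t with
  | zero =>
    simp only [LinearMap.map_zero, LinearEquiv.map_zero, zero_tmul, tmul_zero,
      LinearMap.zero_apply, mul_zero, zero_mul]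
  | add x y hx hy => simp only [LinearMap.map_add, LinearEquiv.map_add, add_tmul, hx, hy]
  | tmul a w =>
    change shufL A W.V A ((a ⊗ₜ w) ⊗ₜ ((1 : A) ⊗ₜ[k] (1 : A))) = _
    rw [shufL_tmul, mul_one]
    rfl

theorem comul_one_shufR (t : W.V ⊗[k] A) :
    shufR A W.V A (t ⊗ₜ[k] comul (1 : A)) = ((TensorProduct.mk k W.V A).flip 1).rTensor A t := by
  rw [Bialgebra.comul_one]
  induction t with
  | zero =>
    simp only [LinearMap.map_zero, LinearEquiv.map_zero, zero_tmul, tmul_zero,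
      LinearMap.zero_apply, mul_zero, zero_mul]
  | add x y hx hy => simp only [LinearMap.map_add, LinearEquiv.map_add, add_tmul, hx, hy]
  | tmul w a =>
    change shufR A W.V A ((w ⊗ₜ a) ⊗ₜ ((1 : A) ⊗ₜ[k] (1 : A))) = _
    rw [shufR_tmul, mul_one]
    rfl

theorem flat_one (w : W.V) : α.1 (w ⊗ₜ[k] (1 : A) : W.V ⊗[k] A) = (flat α).lTensor A (W.δL w) := by
  have h := HomA4.map_δL α (w ⊗ₜ[k] (1 : A) : W.V ⊗[k] A)
  have h1 : (tensA W).δL (w ⊗ₜ[k] (1 : A) : W.V ⊗[k] A) =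
      ((TensorProduct.mk k W.V A).flip 1).lTensor A (W.δL w) := comul_one_shufL _
  rw [h1] at h
  have h2 := congrArg ((counitLin A Z.V).lTensor A) h
  refine (counitLin_lTensor_comul _).symm.trans (h2.trans ?_)
  let g : W.V ⊗[k] A →ₗ[k] A ⊗[k] Z.V := α.1
  change (counitLin A Z.V).lTensor A (g.lTensor A (((TensorProduct.mk k W.V A).flip 1).lTensor A
    (W.δL w))) = _
  rw [← LinearMap.lTensor_comp_apply, ← LinearMap.lTensor_comp_apply]
  rfl

theorem flat_δR (w : W.V) : Z.δR (flat α w) = (flat α).rTensor A (W.δR w) := by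
  have h := HomA4.map_δR α (w ⊗ₜ[k] (1 : A) : W.V ⊗[k] A)
  have h1 : (tensA W).δR (w ⊗ₜ[k] (1 : A) : W.V ⊗[k] A) =
      ((TensorProduct.mk k W.V A).flip 1).rTensor A (W.δR w) := comul_one_shufR _
  rw [h1] at h
  have h2 := congrArg ((counitLin A Z.V).rTensor A) h
  refine (counitLin_rTensor Z.δR _).symm.trans (h2.trans ?_)
  let g : W.V ⊗[k] A →ₗ[k] A ⊗[k] Z.V := α.1
  change (counitLin A Z.V).rTensor A (g.rTensor A (((TensorProduct.mk k W.V A).flip 1).rTensor A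
    (W.δR w))) = _
  rw [← LinearMap.rTensor_comp_apply, ← LinearMap.rTensor_comp_apply]
  rfl

end Flat

section OfCocycle

variable (F : Cocycle M N 1)

/-- The component of a `1`-cocycle in `K^{01}(M, N) = Hom_{A4}(M ⊗ A ⊗ A, A ⊗ N)`. -/
noncomputable def comp₀ : HomA4 (tensA (tensA M)) (aTens N) := F.1 ⟨(0, 1), rfl⟩

/-- The component of a `1`-cocycle in `K^{10}(M, N) = Hom_{A4}(M ⊗ A, A ⊗ A ⊗ N)`. -/
noncomputable def comp₁ : HomA4 (tensA M) (aTens (aTens N)) := F.1 ⟨(1, 0), rfl⟩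

/-- `f₀ : M ⊗ A → N`, `m ⊗ a ↦ (ε ⊗ 1) F₀(m ⊗ a ⊗ 1)` -/
noncomputable def cocycle₀ : M.V ⊗[k] A →ₗ[k] N.V := flat (comp₀ F)

/-- `f₁ : M → A ⊗ N`, `m ↦ (ε ⊗ 1 ⊗ 1) F₁(m ⊗ 1)` -/
noncomputable def cocycle₁ : M.V →ₗ[k] A ⊗[k] N.V := flat (comp₁ F)

theorem cocycle_eq₀₂ (x : (tensA (tensA (tensA M))).V) :
    (comp₀ F).1 ((barStep ((-1) ^ 2) (barStep ((-1) ^ 1) (actMap M))).1 x) = 0 := by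
  have h := congrArg (fun G : Cochain M N 2 => (G ⟨(0, 2), rfl⟩).1 x) (LinearMap.mem_ker.mp F.2)
  exact (add_zero _).symm.trans h

theorem cocycle_eq₁₁ (x : (tensA (tensA M)).V) :
    (comp₁ F).1 ((barStep ((-1) ^ 1) (actMap M)).1 x) +
      (-1 : k) ^ 1 • (cobarStep (coactMap N)).1 ((comp₀ F).1 x) = 0 :=
  congrArg (fun G : Cochain M N 2 => (G ⟨(1, 1), rfl⟩).1 x) (LinearMap.mem_ker.mp F.2)

theorem cocycle_eq₂₀ (x : (tensA M).V) :
    (cobarStep (cobarStep (coactMap N))).1 ((comp₁ F).1 x) = 0 := by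
  have h := congrArg (fun G : Cochain M N 2 => (G ⟨(2, 0), rfl⟩).1 x) (LinearMap.mem_ker.mp F.2)
  have h1 := (zero_add _).symm.trans h
  exact (one_smul k _).symm.trans ((congrArg (· • _) (pow_zero (-1 : k)).symm).trans h1)

end OfCocycle

end Extension



section Main

variable {k A : Type u} [Field k] [Ring A] [HopfAlgebra k A] {M N : HopfBimodule k A}

section Components

variable (F : Cocycle M N 1)

theorem cocycle₀_ract (x : M.V ⊗[k] A) (b : A) :
    counitLin A N.V ((comp₀ F).1 (x ⊗ₜ[k] b : (M.V ⊗[k] A) ⊗[k] A)) =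
      N.ract (MulOpposite.op b) (cocycle₀ F x) :=
  flat_ract (comp₀ F) b x

theorem cocycle₁_ract (m : M.V) (b : A) :
    counitLin A (A ⊗[k] N.V) ((comp₁ F).1 (m ⊗ₜ[k] b : M.V ⊗[k] A)) =
      diag (rightMul k A) N.ract (MulOpposite.op b) (cocycle₁ F m) :=
  flat_ract (comp₁ F) b m

theorem cocycle₀_eq (m : M.V) (a b : A) :
    cocycle₀ F (M.ract (MulOpposite.op a) m ⊗ₜ b) +
      N.ract (MulOpposite.op b) (cocycle₀ F (m ⊗ₜ a)) = cocycle₀ F (m ⊗ₜ (a * b)) := by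
  have h := congrArg (counitLin A N.V) (cocycle_eq₀₂ F (((m ⊗ₜ[k] a) ⊗ₜ[k] b) ⊗ₜ[k] (1 : A) :
    ((M.V ⊗[k] A) ⊗[k] A) ⊗[k] A))
  let g : (M.V ⊗[k] A) ⊗[k] A →ₗ[k] A ⊗[k] N.V := (comp₀ F).1
  have h1 : (barStep ((-1 : k) ^ 2) (barStep ((-1) ^ 1) (actMap M))).1
      (((m ⊗ₜ[k] a) ⊗ₜ[k] b) ⊗ₜ[k] (1 : A) : ((M.V ⊗[k] A) ⊗[k] A) ⊗[k] A) =
      ((M.ract (MulOpposite.op a) m ⊗ₜ[k] b + (-1 : k) ^ 1 • (m ⊗ₜ[k] (a * b))) ⊗ₜ[k] (1 : A) +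
        (-1 : k) ^ 2 • ((m ⊗ₜ[k] a) ⊗ₜ[k] (b * 1)) : (M.V ⊗[k] A) ⊗[k] A) := rfl
  rw [h1] at h
  change counitLin A N.V (g _) = counitLin A N.V 0 at h
  rw [map_add, map_add, map_smul, map_smul, map_zero, mul_one] at h
  have h2 : ∀ (x : M.V ⊗[k] A) (b : A), counitLin A N.V (g (x ⊗ₜ[k] b)) =
    N.ract (MulOpposite.op b) (cocycle₀ F x) := cocycle₀_ract F
  rw [h2, h2, MulOpposite.op_one, map_one, Module.End.one_apply, map_add, map_smul] at h
  have e1 : (-1 : k) ^ 1 = -1 := pow_one _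
  have e2 : (-1 : k) ^ 2 = 1 := by ring
  rw [e1, e2, one_smul, neg_one_smul] at h
  rw [← sub_eq_zero, ← h]
  abel

theorem cocycle₁₁_eq (m : M.V) (a : A) :
    cocycle₁ F (M.ract (MulOpposite.op a) m) + N.δL (cocycle₀ F (m ⊗ₜ a)) =
      diag (rightMul k A) N.ract (MulOpposite.op a) (cocycle₁ F m) +
        (cocycle₀ F).lTensor A (codiagL M.δL comul (m ⊗ₜ a)) := by
  let g₀ : (M.V ⊗[k] A) ⊗[k] A →ₗ[k] A ⊗[k] N.V := (comp₀ F).1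
  let g₁ : M.V ⊗[k] A →ₗ[k] A ⊗[k] (A ⊗[k] N.V) := (comp₁ F).1
  let c : A ⊗[k] N.V →ₗ[k] A ⊗[k] (A ⊗[k] N.V) := (cobarStep (coactMap N)).1
  have h3 : ∀ t : A ⊗[k] N.V, c t =
    (TensorProduct.assoc k A A N.V (comul.rTensor N.V t) - N.δL.lTensor A t :
      A ⊗[k] (A ⊗[k] N.V)) := fun t => rfl
  have hz : counitLin (k := k) A (A ⊗[k] N.V) 0 = 0 := map_zero _
  have hn : ∀ t : A ⊗[k] N.V, (-1 : k) • t = -t := fun t => neg_one_smul k t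
  have h : counitLin A (A ⊗[k] N.V) (g₁ (M.ract (MulOpposite.op a) m ⊗ₜ[k] (1 : A) +
      (-1 : k) ^ 1 • (m ⊗ₜ[k] (a * 1))) + (-1 : k) ^ 1 • c (g₀ ((m ⊗ₜ[k] a) ⊗ₜ[k] (1 : A)))) = 0 :=
    Eq.trans (congrArg (counitLin A (A ⊗[k] N.V)) (cocycle_eq₁₁ F ((m ⊗ₜ[k] a) ⊗ₜ[k] (1 : A) :
      (M.V ⊗[k] A) ⊗[k] A))) hz
  have h2 : ∀ (m : M.V) (b : A), counitLin A (A ⊗[k] N.V) (g₁ (m ⊗ₜ[k] b)) =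
      diag (rightMul k A) N.ract (MulOpposite.op b) (cocycle₁ F m) := cocycle₁_ract F
  have h4 : g₀ ((m ⊗ₜ[k] a) ⊗ₜ[k] (1 : A)) =
      (cocycle₀ F).lTensor A (codiagL M.δL comul (m ⊗ₜ a)) :=
    flat_one (comp₀ F) (m ⊗ₜ[k] a : M.V ⊗[k] A)
  have h5 : counitLin A N.V (g₀ ((m ⊗ₜ[k] a) ⊗ₜ[k] (1 : A))) = cocycle₀ F (m ⊗ₜ a) := rfl
  rw [h3, map_add, map_smul, map_add, map_add, map_smul, map_smul, map_sub, mul_one,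
    h2, h2, MulOpposite.op_one, map_one, Module.End.one_apply, counitLin_comul, counitLin_nat,
    h5, h4, pow_one, hn, hn] at h
  rw [← sub_eq_zero, ← h]
  abel

theorem cocycle₁_eq (m : M.V) : TensorProduct.assoc k A A N.V (comul.rTensor N.V (cocycle₁ F m)) =
    (cocycle₁ F).lTensor A (M.δL m) + N.δL.lTensor A (cocycle₁ F m) := by
  let g₁ : M.V ⊗[k] A →ₗ[k] A ⊗[k] (A ⊗[k] N.V) := (comp₁ F).1
  let c : A ⊗[k] N.V →ₗ[k] A ⊗[k] (A ⊗[k] N.V) :=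
    (TensorProduct.assoc k A A N.V).toLinearMap ∘ₗ comul.rTensor N.V - N.δL.lTensor A
  let d : A ⊗[k] (A ⊗[k] N.V) →ₗ[k] A ⊗[k] (A ⊗[k] (A ⊗[k] N.V)) :=
    (cobarStep (cobarStep (coactMap N))).1
  have h3 : ∀ t : A ⊗[k] (A ⊗[k] N.V), d t =
    (TensorProduct.assoc k A A (A ⊗[k] N.V) (comul.rTensor (A ⊗[k] N.V) t) - c.lTensor A t :
      A ⊗[k] (A ⊗[k] (A ⊗[k] N.V))) := fun t => rfl
  have hz : counitLin (k := k) A (A ⊗[k] (A ⊗[k] N.V)) 0 = 0 := map_zero _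
  have h : counitLin A (A ⊗[k] (A ⊗[k] N.V)) (d (g₁ (m ⊗ₜ[k] (1 : A)))) = 0 :=
    Eq.trans (congrArg (counitLin A (A ⊗[k] (A ⊗[k] N.V)))
      (cocycle_eq₂₀ F (m ⊗ₜ[k] (1 : A) : M.V ⊗[k] A))) hz
  have h4 : g₁ (m ⊗ₜ[k] (1 : A)) = (cocycle₁ F).lTensor A (M.δL m) := flat_one (comp₁ F) m
  have h5 : counitLin A (A ⊗[k] N.V) (g₁ (m ⊗ₜ[k] (1 : A))) = cocycle₁ F m := rfl
  rw [h3, map_sub, counitLin_comul, counitLin_nat, h5, h4] at h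
  have h6 : c (cocycle₁ F m) = TensorProduct.assoc k A A N.V (comul.rTensor N.V (cocycle₁ F m)) -
    N.δL.lTensor A (cocycle₁ F m) := rfl
  rw [h6, sub_eq_zero] at h
  rw [h]
  abel

end Components

/-- The Hopf bimodule structure on `N ⊕ M` given by a `1`-cocycle. -/
noncomputable def cocycleExtData (F : Cocycle M N 1) : ExtData M N where
  f₀ := cocycle₀ F
  f₁ := cocycle₁ F
  f₀_lact a m b := flat_lact (comp₀ F) a (m ⊗ₜ[k] b : M.V ⊗[k] A)
  f₀_δR x := flat_δR (comp₀ F) x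
  f₁_lact a m := flat_lact (comp₁ F) a m
  f₁_δR m := flat_δR (comp₁ F) m
  eq₀₂ := cocycle₀_eq F
  eq₁₁ := cocycle₁₁_eq F
  eq₂₀ := cocycle₁_eq F

variable [FiniteDimensional k A]

/-- The class in `Ext_X^1(M, N)` of the extension `0 → N → N ⊕ M → M → 0` given by a `1`-cocycle. -/
noncomputable def extensionClass (F : Cocycle M N 1) : Ext (toX M) (toX N) 1 :=
  (cocycleExtData F).isShortExact.extClass

/-- For an exact sequence `0 → M' → M → M'' → 0` of Hopf bimodules with maps `i` and `p`, the class
of `c` is the image of the class of `z` under the connecting map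
`H_{A4}^n(M', N) → H_{A4}^{n+1}(M'', N)`: there is a cochain `g` on `M` with `i^* g = z` and
`D g = p^* c`. -/
def IsConnecting {M' M M'' N : HopfBimodule k A} (i : HomA4 M' M) (p : HomA4 M M'') {n : ℕ}
    (z : Cocycle M' N n) (c : Cocycle M'' N (n + 1)) : Prop :=
  ∃ g : Cochain M N n, pullC N i n g = z.1 ∧ D M N n g = pullC N p (n + 1) c.1

/-- `φ` is a map of (contravariant) `δ`-functors `H_{A4}^*(-, N) → Ext_X^*(-, N)` that extends the
identity of `Hom_{A4}(-, N)`. -/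
structure IsDeltaMap (N : HopfBimodule k A)
    (φ : ∀ (M : HopfBimodule k A) (n : ℕ), HA4 M N n →ₗ[k] Ext (toX M) (toX N) n) : Prop where
  natural : ∀ {M M' : HopfBimodule k A} (f : HomA4 M M') (n : ℕ) (x : HA4 M' N n),
    φ M n (pullH N f n x) = (Ext.mk₀ (toXMap f)).comp (φ M' n x) (zero_add n)
  degree_zero : ∀ {M : HopfBimodule k A} (β : HomA4 M N),
    φ M 0 (cls (unitCocycle β)) = Ext.mk₀ (toXMap β)
  connecting : ∀ {M' M M'' : HopfBimodule k A} {i : HomA4 M' M} {p : HomA4 M M''}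
    (h : IsShortExact i p) {n : ℕ} {z : Cocycle M' N n} {c : Cocycle M'' N (n + 1)},
    IsConnecting i p z c →
      φ M'' (n + 1) (cls c) = h.extClass.comp (φ M' n (cls z)) (add_comm 1 n)

end Main

end HopfBimod

/-! The functors `H_{A4}^*(-, N)` and `Ext_X^*(-, N)` are both universal `δ`-functors, and they
agree in degree zero; this forces everything else.

Exactness. The functor `- ⊗ A` is left adjoint to forgetting the right action and `A ⊗ -` is right
adjoint to forgetting the left coaction, so a morphism `W ⊗ A → A ⊗ Z` amounts to a left linear and
right colinear map `W → Z` (`flat`, `sharp`). Left-right Hopf modules are governed by their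
coinvariants, hence such maps extend along injections (`IsLR.exists_extension`). So every `K^{pq}(-,
N)` is exact, a short exact sequence of Hopf bimodules gives a short exact sequence of total
complexes, and the snake lemma yields the connecting maps of (a).

Vanishing. Since `A` is finite dimensional, a coaction is the same as an action of the dual, and the
straightening relations of `X` say precisely that the coactions are bimodule maps. Hopf bimodules
are therefore all the `X`-modules (`ofX`, `toXEquiv`), and there are enough `X`-projective ones. On
a projective `P` the action `P ⊗ A → P` splits, so the bar direction is contractible
(`barHtpy_spec`) and a cocycle of positive degree can be moved into the column `q = 0`. There it
comes from a map out of `P` that the cobar differential kills; the cobar complex is exact because of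
the counit (`cobarStep_exact`), and projectivity lifts the map through the preceding differential.
Thus `cls_eq_zero_of_projective`.

Comparison. Under `flat`, `d_h` measures the failure of right linearity and `d_c` the failure of
left colinearity, so degree zero cohomology is `Hom_{A4} = Hom_X`. Both theories being effaced by
projectives, a presentation `0 → K → P → M → 0` makes degree `n + 1` at `M` the cokernel of degree
`n` at `P → K`. Dimension shifting then gives existence, uniqueness and bijectivity of `φ`
(`exists_succ`, `bijective_succ`, `eq_of_isCompatible`).

Degree one. A `1`-cocycle `F` is the image of the identity of `N` under the connecting map of the
very extension that `F` defines: the linear projection `N ⊕ M → N` is left linear and right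
colinear, so it gives a `0`-cochain, and its failures of right linearity and left colinearity are
`f₀` and `f₁` (`isConnecting_cocycleExtData`). Compatibility with connecting maps then sends `[F]`
to the class of the extension. That `ψ` is well defined, linear and bijective follows without any
computation with Baer sums. -/

namespace HopfBimod

/-! ### Left-right Hopf modules: coinvariants and the extension of maps -/

section FundamentalTheorem

variable {k A : Type u} [Field k] [Ring A] [HopfAlgebra k A] {W Z : HopfBimodule k A}

/-- A linear map that is left linear and right colinear. -/
structure IsLR (π : W.V →ₗ[k] Z.V) : Prop where
  map_lact : ∀ a v, π (W.lact a v) = Z.lact a (π v)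
  map_δR : ∀ v, Z.δR (π v) = π.rTensor A (W.δR v)

/-- The linear map `w ⊗ a ↦ j(a) w`. -/
noncomputable def actBy (W : HopfBimodule k A) (j : A →ₗ[k] A) : W.V ⊗[k] A →ₗ[k] W.V :=
  TensorProduct.lift (W.lact.toLinearMap ∘ₗ j).flip

theorem actBy_tmul (j : A →ₗ[k] A) (w : W.V) (a : A) : actBy W j (w ⊗ₜ a) = W.lact (j a) w := rfl

theorem actBy_nat (j : A →ₗ[k] A) {π : W.V →ₗ[k] Z.V} (hπ : ∀ a v, π (W.lact a v) = Z.lact a (π v))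
    (t : W.V ⊗[k] A) : π (actBy W j t) = actBy Z j (π.rTensor A t) := by
  induction t with
  | zero => simp only [map_zero]
  | add x y hx hy => simp only [map_add, hx, hy]
  | tmul w a => rw [actBy_tmul, hπ, LinearMap.rTensor_tmul, actBy_tmul]

/-- The reconstruction `w ↦ ∑ w₁ φ(w₀)`. -/
noncomputable def recon (φ : W.V →ₗ[k] Z.V) : W.V →ₗ[k] Z.V :=
  actBy Z LinearMap.id ∘ₗ φ.rTensor A ∘ₗ W.δR

/-- The reconstruction of a map that factors through coinvariants is left linear and right
colinear. -/
theorem isLR_recon (φ : W.V →ₗ[k] Z.V) (h1 : ∀ a w, φ (W.lact a w) = counit (R := k) a • φ w)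
    (h2 : ∀ w, Z.δR (φ w) = φ w ⊗ₜ 1) : IsLR (recon φ) := by
  constructor
  · intro a w
    change actBy Z _ (φ.rTensor A (W.δR (W.lact a w))) =
      Z.lact a (actBy Z LinearMap.id (φ.rTensor A (W.δR w)))
    rw [W.δR_lact, diag_eq]
    generalize W.δR w = t
    induction t with
    | zero => simp only [map_zero]
    | add x y hx hy => simp only [map_add, hx, hy]
    | tmul w b =>
      have h : ∀ s : A ⊗[k] A, actBy Z LinearMap.id
          (φ.rTensor A (diagAux W.lact (leftMul k A) s (w ⊗ₜ b))) =
          Z.lact (TensorProduct.lid k A (counit.rTensor A s) * b) (φ w) := by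
        intro s
        induction s with
        | zero => simp only [map_zero, LinearMap.zero_apply, zero_mul]
        | add x y hx hy => simp only [map_add, LinearMap.add_apply, add_mul, hx, hy]
        | tmul x y =>
          rw [diagAux_tmul, map_tmul, LinearMap.rTensor_tmul, actBy_tmul, h1,
            LinearMap.rTensor_tmul, lid_tmul, smul_mul_assoc, map_smul, map_smul]
          rfl
      rw [h, Coalgebra.rTensor_counit_comul, lid_tmul, one_smul, map_mul]
      rfl
  · intro w
    have h : ∀ t : W.V ⊗[k] A, Z.δR (actBy Z LinearMap.id (φ.rTensor A t)) =
        (actBy Z LinearMap.id ∘ₗ φ.rTensor A).rTensor A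
          ((TensorProduct.assoc k W.V A A).symm (comul.lTensor W.V t)) := by
      intro t
      induction t with
      | zero => simp only [map_zero]
      | add x y hx hy => simp only [map_add, hx, hy]
      | tmul w b =>
        rw [LinearMap.rTensor_tmul, actBy_tmul, LinearMap.id_apply, Z.δR_lact, h2,
          LinearMap.lTensor_tmul, diag_eq]
        generalize comul (R := k) b = s
        induction s with
        | zero => simp only [map_zero, LinearMap.zero_apply, tmul_zero]
        | add x y hx hy => simp only [map_add, LinearMap.add_apply, tmul_add, hx, hy]
        | tmul x y => simp [diagAux_tmul, actBy_tmul]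
    change Z.δR (actBy Z LinearMap.id (φ.rTensor A (W.δR w))) =
      (actBy Z LinearMap.id ∘ₗ φ.rTensor A ∘ₗ W.δR).rTensor A (W.δR w)
    rw [h, ← W.coassocR, LinearEquiv.symm_apply_apply, ← LinearMap.rTensor_comp_apply]
    rfl

variable [FiniteDimensional k A]

/-- The projection `w ↦ ∑ S⁻¹(w₁) w₀` onto the coinvariants. -/
noncomputable def coinv (W : HopfBimodule k A) : W.V →ₗ[k] W.V :=
  actBy W (antipodeInv k A) ∘ₗ W.δR

/-- The projection is built from the left action and the right coaction alone, so `IsLR` is enough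
and a full morphism of Hopf bimodules is not needed. -/
theorem coinv_nat {π : W.V →ₗ[k] Z.V} (hπ : IsLR π) (w : W.V) :
    π (coinv W w) = coinv Z (π w) := by
  change π (actBy W _ (W.δR w)) = actBy Z _ (Z.δR (π w))
  rw [actBy_nat _ hπ.map_lact, hπ.map_δR]

/-- Because `S⁻¹` reverses products, `S⁻¹(a₂ w₁) a₁ w₀ = S⁻¹(w₁) S⁻¹(a₂) a₁ w₀`, and `∑ S⁻¹(a₂) a₁ =
ε(a)`. -/
theorem coinv_lact (a : A) (w : W.V) : coinv W (W.lact a w) = counit (R := k) a • coinv W w := by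
  change actBy W _ (W.δR (W.lact a w)) = _ • actBy W _ (W.δR w)
  rw [W.δR_lact, diag_eq]
  generalize W.δR w = t
  induction t with
  | zero => simp only [map_zero, smul_zero]
  | add x y hx hy => simp only [map_add, smul_add, hx, hy]
  | tmul w b =>
    have h : ∀ s : A ⊗[k] A, actBy W (antipodeInv k A)
        (diagAux W.lact (leftMul k A) s (w ⊗ₜ b)) =
        W.lact (antipodeInv k A b * LinearMap.mul' k A (TensorProduct.comm k A A
          ((antipodeInv k A).lTensor A s))) w := by
      intro s
      induction s with
      | zero => simp only [map_zero, LinearMap.zero_apply, mul_zero]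
      | add x y hx hy => simp only [map_add, LinearMap.add_apply, mul_add, hx, hy]
      | tmul x y =>
        change W.lact (antipodeInv k A (y * b)) (W.lact x w) =
          W.lact (antipodeInv k A b * (antipodeInv k A y * x)) w
        simp only [antipodeInv_mul, map_mul, Module.End.mul_apply]
    rw [h, antipodeInv_mul_swap, Algebra.algebraMap_eq_smul_one, mul_smul_comm, mul_one, map_smul,
      LinearMap.smul_apply, actBy_tmul]

/-- By coassociativity the left side is `∑ w₂ S⁻¹(w₁) w₀`, and `∑ a₂ S⁻¹(a₁) = ε(a)`. This is the
part of the fundamental theorem of Hopf modules that the extension of maps uses. -/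
theorem recon_coinv (w : W.V) : recon (coinv W) w = w := by
  have h : ∀ t : W.V ⊗[k] A, actBy W LinearMap.id ((actBy W (antipodeInv k A)).rTensor A
      ((TensorProduct.assoc k W.V A A).symm (comul.lTensor W.V t))) =
      TensorProduct.rid k W.V (counit.lTensor W.V t) := by
    intro t
    induction t with
    | zero => simp only [map_zero]
    | add x y hx hy => simp only [map_add, hx, hy]
    | tmul w b =>
      have h : ∀ s : A ⊗[k] A, actBy W LinearMap.id ((actBy W (antipodeInv k A)).rTensor A
          ((TensorProduct.assoc k W.V A A).symm (w ⊗ₜ s))) =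
          W.lact (LinearMap.mul' k A (TensorProduct.comm k A A
            ((antipodeInv k A).rTensor A s))) w := by
        intro s
        induction s with
        | zero => simp only [map_zero, LinearMap.zero_apply, tmul_zero]
        | add x y hx hy => simp only [map_add, LinearMap.add_apply, tmul_add, hx, hy]
        | tmul x y => simp [actBy_tmul]
      rw [LinearMap.lTensor_tmul, h, mul_antipodeInv_swap, LinearMap.lTensor_tmul, rid_tmul,
        Algebra.algebraMap_eq_smul_one, map_smul, map_one]
      rfl
  change actBy W LinearMap.id ((actBy W (antipodeInv k A) ∘ₗ W.δR).rTensor A (W.δR w)) = w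
  rw [LinearMap.rTensor_comp_apply, ← LinearEquiv.symm_apply_apply (TensorProduct.assoc k W.V A A)
    (W.δR.rTensor A (W.δR w)), W.coassocR, h, W.counitR, rid_tmul, one_smul]

/-- As `S⁻¹` reverses comultiplications, the coaction of `∑ S⁻¹(w₁) w₀` is `∑ S⁻¹(w₃) w₀ ⊗ S⁻¹(w₂)
w₁`, and the inner factors cancel by `∑ S⁻¹(a₂) a₁ = ε(a)`. -/
theorem δR_coinv (w : W.V) : W.δR (coinv W w) = coinv W w ⊗ₜ 1 := by
  let G : (W.V ⊗[k] A) ⊗[k] A →ₗ[k] W.V ⊗[k] A := TensorProduct.lift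
    ((diag W.lact (leftMul k A)).toLinearMap ∘ₗ antipodeInv k A).flip
  have h1 : ∀ t, W.δR (actBy W (antipodeInv k A) t) = G (W.δR.rTensor A t) := by
    intro t
    induction t with
    | zero => simp only [map_zero]
    | add x y hx hy => simp only [map_add, hx, hy]
    | tmul w b => exact W.δR_lact _ _
  have h2 : ∀ t, G ((TensorProduct.assoc k W.V A A).symm (comul.lTensor W.V t)) =
      actBy W (antipodeInv k A) t ⊗ₜ 1 := by
    intro t
    induction t with
    | zero => simp only [map_zero, zero_tmul]
    | add x y hx hy => simp only [map_add, add_tmul, hx, hy]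
    | tmul w b =>
      -- `x ⊗ y ⊗ z ↦ S⁻¹(z) w ⊗ S⁻¹(y) x`
      let Φ : A ⊗[k] (A ⊗[k] A) →ₗ[k] W.V ⊗[k] A :=
        map (W.lact.toLinearMap.flip w ∘ₗ antipodeInv k A) (LinearMap.mul' k A ∘ₗ
          (antipodeInv k A).rTensor A ∘ₗ (TensorProduct.comm k A A).toLinearMap) ∘ₗ
          (TensorProduct.comm k (A ⊗[k] A) A).toLinearMap ∘ₗ
          (TensorProduct.assoc k A A A).symm.toLinearMap
      have h3 : ∀ s : A ⊗[k] A, G ((TensorProduct.assoc k W.V A A).symm (w ⊗ₜ s)) =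
          Φ (comul.lTensor A s) := by
        intro s
        induction s with
        | zero => simp only [map_zero, tmul_zero]
        | add x y hx hy => simp only [map_add, tmul_add, hx, hy]
        | tmul x y =>
          change diag W.lact (leftMul k A) (antipodeInv k A y) (w ⊗ₜ x) = Φ (x ⊗ₜ comul y)
          rw [diag_eq, comul_antipodeInv]
          generalize comul (R := k) y = s
          induction s with
          | zero => simp only [map_zero, tmul_zero, LinearMap.zero_apply]
          | add x y hx hy => simp only [map_add, tmul_add, LinearMap.add_apply, hx, hy]
          | tmul y z => rfl
      -- After coassociativity the first two legs come from one comultiplication, so they meet as `∑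
      -- S⁻¹(x₂) x₁ = ε(x)`.
      have h4 : ∀ s : A ⊗[k] A, Φ (TensorProduct.assoc k A A A (comul.rTensor A s)) =
          W.lact (antipodeInv k A (TensorProduct.lid k A (counit.rTensor A s))) w ⊗ₜ 1 := by
        intro s
        induction s with
        | zero => simp only [map_zero, zero_tmul, LinearMap.zero_apply]
        | add x y hx hy => simp only [map_add, add_tmul, LinearMap.add_apply, hx, hy]
        | tmul x y =>
          have h5 : ∀ s : A ⊗[k] A, Φ (TensorProduct.assoc k A A A (s ⊗ₜ y)) =
              W.lact (antipodeInv k A y) w ⊗ₜ LinearMap.mul' k A (TensorProduct.comm k A A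
                ((antipodeInv k A).lTensor A s)) := by
            intro s
            induction s with
            | zero => simp only [map_zero, zero_tmul, tmul_zero]
            | add x y hx hy => simp only [map_add, add_tmul, tmul_add, hx, hy]
            | tmul y z => rfl
          rw [LinearMap.rTensor_tmul, h5, antipodeInv_mul_swap, LinearMap.rTensor_tmul, lid_tmul,
            Algebra.algebraMap_eq_smul_one, map_smul, map_smul, LinearMap.smul_apply, smul_tmul]
      rw [LinearMap.lTensor_tmul, h3, ← Coalgebra.coassoc_apply, h4,
        Coalgebra.rTensor_counit_comul, lid_tmul, one_smul, actBy_tmul]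
  change W.δR (actBy W (antipodeInv k A) (W.δR w)) = actBy W (antipodeInv k A) (W.δR w) ⊗ₜ 1
  rw [h1, ← LinearEquiv.symm_apply_apply (TensorProduct.assoc k W.V A A)
    (W.δR.rTensor A (W.δR w)), W.coassocR, h2]

/-- On a coinvariant element the formula reduces to the action of `S⁻¹(1) = 1`. -/
theorem coinv_coinv (w : W.V) : coinv W (coinv W w) = coinv W w := by
  change actBy W (antipodeInv k A) (W.δR (coinv W w)) = _
  rw [δR_coinv, actBy_tmul, antipodeInv_one, map_one]
  rfl

/-- Left linear and right colinear maps extend along injections. -/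
theorem IsLR.exists_extension {W' : HopfBimodule k A} {i : W'.V →ₗ[k] W.V} (hi : IsLR i)
    (hinj : Function.Injective i) {π : W'.V →ₗ[k] Z.V} (hπ : IsLR π) :
    ∃ π' : W.V →ₗ[k] Z.V, IsLR π' ∧ ∀ v, π' (i v) = π v := by
  obtain ⟨s, hs⟩ := i.exists_leftInverse_of_injective (LinearMap.ker_eq_bot.mpr hinj)
  -- The retraction `s` is merely linear. The inner `coinv` makes the composite transform through
  -- `ε` under the left action, and the outer one makes its values coinvariant; these are the
  -- hypotheses of `isLR_recon`.
  let φ : W.V →ₗ[k] Z.V := coinv Z ∘ₗ π ∘ₗ s ∘ₗ coinv W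
  refine ⟨recon φ, isLR_recon φ (fun a w => ?_) (fun w => δR_coinv _), fun v => ?_⟩
  · simp only [φ, LinearMap.comp_apply, coinv_lact, map_smul]
  -- On the image of `i` the map `s` only meets `coinv W (i w) = i (coinv W' w)`, where it undoes
  -- `i`. The reconstruction of `π ∘ coinv` is then `π`, by `recon_coinv`.
  · have h1 : φ ∘ₗ i = π ∘ₗ coinv W' := LinearMap.ext fun w => by
      simp only [φ, LinearMap.comp_apply, ← coinv_nat hi]
      rw [← coinv_nat hπ, ← LinearMap.comp_apply s i, hs, LinearMap.id_apply, coinv_coinv]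
    change actBy Z LinearMap.id (φ.rTensor A (W.δR (i v))) = π v
    rw [hi.map_δR, ← LinearMap.rTensor_comp_apply, h1, LinearMap.rTensor_comp_apply,
      ← actBy_nat _ hπ.map_lact]
    exact congrArg π (recon_coinv v)

end FundamentalTheorem

end HopfBimod

namespace HopfBimod

/-! ### Morphisms `W ⊗ A → A ⊗ Z` as left linear and right colinear maps `W → Z` -/

section Sharp

variable {k A : Type u} [Field k] [Ring A] [HopfAlgebra k A] {W Z : HopfBimodule k A}

/-- The morphism `W ⊗ A → Z ⊗ A` induced by a left linear map of bicomodules `W → Z`. -/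
noncomputable def tensAMapOfLeft (f : W.V →ₗ[k] Z.V) (h1 : ∀ a v, f (W.lact a v) = Z.lact a (f v))
    (h2 : ∀ v, Z.δL (f v) = f.lTensor A (W.δL v)) (h3 : ∀ v, Z.δR (f v) = f.rTensor A (W.δR v)) :
    HomA4 (tensA W) (tensA Z) :=
  let g : (tensA W).V →ₗ[k] (tensA Z).V := f.rTensor A
  ⟨g, by
    refine ⟨fun a => tensA_ext (g ∘ₗ (tensA W).lact a) ((tensA Z).lact a ∘ₗ g) fun v b => ?_,
      fun a => tensA_ext (g ∘ₗ (tensA W).ract a) ((tensA Z).ract a ∘ₗ g) fun v b => rfl,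
      tensA_ext ((tensA Z).δL ∘ₗ g) (g.lTensor A ∘ₗ (tensA W).δL) fun v b => ?_,
      tensA_ext ((tensA Z).δR ∘ₗ g) (g.rTensor A ∘ₗ (tensA W).δR) fun v b => ?_⟩
    · change f (W.lact a v) ⊗ₜ b = Z.lact a (f v) ⊗ₜ b
      rw [h1]
    · change codiagL Z.δL comul (f v ⊗ₜ b) = LinearMap.lTensor A (map f LinearMap.id)
        (codiagL W.δL comul (v ⊗ₜ b))
      rw [codiagL_tmul, codiagL_tmul, shufL_nat, h2, LinearMap.lTensor_id]
      rfl
    · change codiagR Z.δR comul (f v ⊗ₜ b) = LinearMap.rTensor A (map f LinearMap.id)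
        (codiagR W.δR comul (v ⊗ₜ b))
      rw [codiagR_tmul, codiagR_tmul, shufR_nat, h3, LinearMap.rTensor_id]
      rfl⟩

/-- The morphism `W ⊗ A → A ⊗ Z`, `w ⊗ b ↦ (1 ⊗ π)(δ_L w) b`, that corresponds to a left linear and
right colinear map `π`. -/
noncomputable def sharp (π : W.V →ₗ[k] Z.V) (hπ : IsLR π) : HomA4 (tensA W) (aTens Z) :=
  compH (actMap (aTens Z)) (tensAMapOfLeft (Z := aTens Z) (π.lTensor A ∘ₗ W.δL)
    (fun a v => by
      change π.lTensor A (W.δL (W.lact a v)) = diag (leftMul k A) Z.lact a (π.lTensor A (W.δL v))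
      rw [W.δL_lact]
      exact map_diag LinearMap.id π (fun _ _ => rfl) hπ.map_lact _ _)
    (fun v => by
      change TensorProduct.assoc k A A Z.V (comul.rTensor Z.V (π.lTensor A (W.δL v))) =
        (π.lTensor A ∘ₗ W.δL).lTensor A (W.δL v)
      rw [ExtData.comul_lTensor, W.coassocL, LinearMap.lTensor_comp_apply])
    (fun v => by
      change (TensorProduct.assoc k A Z.V A).symm (Z.δR.lTensor A (π.lTensor A (W.δL v))) =
        (π.lTensor A ∘ₗ W.δL).rTensor A (W.δR v)
      rw [LinearEquiv.symm_apply_eq, LinearMap.rTensor_comp_apply, ExtData.assoc_mid, W.bicomod,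
        ExtData.lTensor_congr (h := π.rTensor A ∘ₗ W.δR) hπ.map_δR,
        LinearMap.lTensor_comp_apply]))

theorem counitLin_δL (v : Z.V) : counitLin A Z.V (Z.δL v) = v := by
  change TensorProduct.lid k Z.V (counit.rTensor Z.V (Z.δL v)) = v
  rw [Z.counitL, lid_tmul, one_smul]

/-- At `b = 1` what remains is `(ε ⊗ 1)(1 ⊗ π) δ_L = π (ε ⊗ 1) δ_L`, which the counit axiom
simplifies. -/
theorem flat_sharp (π : W.V →ₗ[k] Z.V) (hπ : IsLR π) : flat (sharp π hπ) = π :=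
  LinearMap.ext fun w => by
    change counitLin A Z.V (diag (rightMul k A) Z.ract (MulOpposite.op 1)
      (π.lTensor A (W.δL w))) = π w
    rw [counitLin_ract, MulOpposite.op_one, map_one, Module.End.one_apply, counitLin_nat,
      counitLin_δL]

theorem isLR_flat (α : HomA4 (tensA W) (aTens Z)) : IsLR (flat α) := ⟨flat_lact α, flat_δR α⟩

/-- Right linearity determines `α` from its values at `w ⊗ 1`, and left colinearity determines those
from `(ε ⊗ 1) α`, as recorded in `flat_one`. Identities between cochains are checked through this
lemma. -/
theorem flat_injective {α β : HomA4 (tensA W) (aTens Z)} (h : flat α = flat β) : α = β := by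
  refine homA4_ext fun x => tensA_ext α.1 β.1 (fun w b => ?_) x
  have h1 : (tensA W).ract (MulOpposite.op b) (w ⊗ₜ[k] (1 : A) : W.V ⊗[k] A) =
      (w ⊗ₜ[k] b : W.V ⊗[k] A) := by
    change w ⊗ₜ[k] ((1 : A) * b) = w ⊗ₜ[k] b
    rw [one_mul]
  have h2 : α.1 (w ⊗ₜ[k] (1 : A) : W.V ⊗[k] A) = β.1 (w ⊗ₜ[k] (1 : A) : W.V ⊗[k] A) := by
    rw [flat_one, flat_one, h]
  rw [← h1]
  exact (HomA4.map_ract α _ _).trans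
    ((congrArg ((aTens Z).ract (MulOpposite.op b)) h2).trans (HomA4.map_ract β _ _).symm)

theorem HomA4.isLR (f : HomA4 W Z) : IsLR f.1 := ⟨HomA4.map_lact f, HomA4.map_δR f⟩

theorem flat_tensAMap {W' : HopfBimodule k A} (α : HomA4 (tensA W) (aTens Z)) (f : HomA4 W' W) :
    flat (compH α (tensAMap f)) = flat α ∘ₗ f.1 := rfl

variable [FiniteDimensional k A]

/-- The extension problem is moved through `flat` to left linear and right colinear maps, solved
there, and moved back by `sharp`. This is the relative injectivity of `A ⊗ Z` behind the exactness
of `K^{pq}(-, N)`. -/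
theorem exists_extension_tensA {W' : HopfBimodule k A} (i : HomA4 W' W)
    (hi : Function.Injective i.1) (α : HomA4 (tensA W') (aTens Z)) :
    ∃ β : HomA4 (tensA W) (aTens Z), compH β (tensAMap i) = α := by
  obtain ⟨π, hπ, h⟩ := (HomA4.isLR i).exists_extension hi (isLR_flat α)
  refine ⟨sharp π hπ, flat_injective ?_⟩
  rw [flat_tensAMap, flat_sharp]
  exact LinearMap.ext h

end Sharp

/-! ### Short exact sequences of cochain complexes and the snake lemma -/

section Exactness

variable {k A : Type u} [Field k] [Ring A] [HopfAlgebra k A] [FiniteDimensional k A]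
  {M' M M'' N Z : HopfBimodule k A} {i : HomA4 M' M} {p : HomA4 M M''}

namespace IsShortExact

/-- Over a field `A` is flat, and exactness is a property of the underlying linear maps. -/
theorem tensA (h : IsShortExact i p) : IsShortExact (tensAMap i) (tensAMap p) where
  inj := Module.Flat.rTensor_preserves_injective_linearMap (M := A) i.1 h.inj
  exact := rTensor_exact A h.exact h.surj
  surj := LinearMap.rTensor_surjective A h.surj

theorem tpow (h : IsShortExact i p) : ∀ q, IsShortExact (tpowMap i q) (tpowMap p q)
  | 0 => h
  | q + 1 => (h.tpow q).tensA

/-- This is the universal property of the cokernel; it gives exactness of `K^{pq}(-, N)` in the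
middle. -/
theorem exists_desc (h : IsShortExact i p) (α : HomA4 M Z) (hα : compH α i = 0) :
    ∃ β : HomA4 M'' Z, compH β p = α := by
  -- The section `s` is only linear. Since `α` kills the image of `i`, the composite `α ∘ s` still
  -- satisfies `(α ∘ s) ∘ p = α`, and the four compatibilities may be tested on elements `p v`.
  obtain ⟨s, hs⟩ := p.1.exists_rightInverse_of_surjective (LinearMap.range_eq_top.mpr h.surj)
  let β : M''.V →ₗ[k] Z.V := α.1 ∘ₗ s
  have hβ : ∀ v, β (p.1 v) = α.1 v := fun v => by
    have h1 : p.1 (s (p.1 v) - v) = 0 := by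
      rw [map_sub, ← LinearMap.comp_apply p.1 s, hs, LinearMap.id_apply, sub_self]
    obtain ⟨w, hw⟩ := (h.exact _).mp h1
    have h2 : α.1 (i.1 w) = 0 := congrArg (fun γ : HomA4 M' Z => γ.1 w) hα
    rw [hw, map_sub, sub_eq_zero] at h2
    exact h2
  have hβ' : β ∘ₗ p.1 = α.1 := LinearMap.ext hβ
  refine ⟨⟨β, fun a w => ?_, fun b w => ?_, fun w => ?_, fun w => ?_⟩, homA4_ext hβ⟩ <;>
    obtain ⟨v, rfl⟩ := h.surj w
  · rw [← HomA4.map_lact p, hβ, hβ, HomA4.map_lact α]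
  · rw [← HomA4.map_ract p, hβ, hβ, HomA4.map_ract α]
  · rw [hβ, HomA4.map_δL p, ← LinearMap.lTensor_comp_apply, hβ', HomA4.map_δL α]
  · rw [hβ, HomA4.map_δR p, ← LinearMap.rTensor_comp_apply, hβ', HomA4.map_δR α]

theorem comp_eq_zero (h : IsShortExact i p) (β : HomA4 M'' Z) : compH (compH β p) i = 0 :=
  homA4_ext fun v => (congrArg β.1 (h.exact.apply_apply_eq_zero v)).trans (map_zero _)

/-- The component at `(p, q)` lives on `M' ⊗ A^{⊗ q+1}`, which is `tensA` of `M' ⊗ A^{⊗ q}`; the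
last factor `A` is the one that `exists_extension_tensA` needs. -/
theorem pullC_surjective (h : IsShortExact i p) (n : ℕ) : Function.Surjective (pullC N i n) := by
  intro F
  choose G hG using fun x : {x : ℕ × ℕ // x.1 + x.2 = n} =>
    exists_extension_tensA (tpowMap i x.1.2) (h.tpow x.1.2).inj (F x)
  exact ⟨G, funext hG⟩

theorem pullC_injective (h : IsShortExact i p) (n : ℕ) : Function.Injective (pullC N p n) := by
  refine fun F G hFG => funext fun x => homA4_ext fun w => ?_
  obtain ⟨v, rfl⟩ := (h.tpow (x.1.2 + 1)).surj w
  exact congrArg (fun γ : Cochain M N n => (γ x).1 v) hFG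

theorem pullC_pullC (h : IsShortExact i p) (n : ℕ) (F : Cochain M'' N n) :
    pullC N i n (pullC N p n F) = 0 :=
  funext fun x => (h.tpow (x.1.2 + 1)).comp_eq_zero (F x)

theorem exists_pullC_eq (h : IsShortExact i p) (n : ℕ) (F : Cochain M N n)
    (hF : pullC N i n F = 0) : ∃ G, pullC N p n G = F := by
  choose G hG using fun x : {x : ℕ × ℕ // x.1 + x.2 = n} =>
    (h.tpow (x.1.2 + 1)).exists_desc (F x) (congrArg (fun γ : Cochain M' N n => γ x) hF)
  exact ⟨G, funext hG⟩

/-- The usual diagram chase: extend `z` to a cochain `g` on `M`; its differential restricts to zero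
on `M'`, hence descends to `M''`, and the result is a cocycle because pullback along `p` is
injective. -/
theorem exists_isConnecting (h : IsShortExact i p) {n : ℕ} (z : Cocycle M' N n) :
    ∃ c : Cocycle M'' N (n + 1), IsConnecting i p z c := by
  obtain ⟨g, hg⟩ := h.pullC_surjective (N := N) n z.1
  obtain ⟨c, hc⟩ := h.exists_pullC_eq (n + 1) (D M N n g) (by
    rw [pullC_D, hg]
    exact z.2)
  refine ⟨⟨c, LinearMap.mem_ker.mpr (h.pullC_injective _ ?_)⟩, g, hg, hc.symm⟩
  rw [pullC_D, hc, D_D, map_zero]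

end IsShortExact

theorem cls_eq_zero {n : ℕ} {z : Cocycle M N n} : cls z = 0 ↔ z.1 ∈ Coboundary M N n := by
  rw [cls, Submodule.mkQ_apply, Submodule.Quotient.mk_eq_zero]
  exact Iff.rfl

theorem IsConnecting.add {n : ℕ} {z z' : Cocycle M' N n} {c c' : Cocycle M'' N (n + 1)}
    (h : IsConnecting i p z c) (h' : IsConnecting i p z' c') : IsConnecting i p (z + z') (c + c') := by
  obtain ⟨g, h1, h2⟩ := h
  obtain ⟨g', h1', h2'⟩ := h'
  refine ⟨g + g', ?_, ?_⟩
  · rw [map_add, h1, h1']; rfl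
  · rw [map_add, h2, h2', ← map_add]; rfl

theorem IsConnecting.smul {n : ℕ} {z : Cocycle M' N n} {c : Cocycle M'' N (n + 1)} (r : k)
    (h : IsConnecting i p z c) : IsConnecting i p (r • z) (r • c) := by
  obtain ⟨g, h1, h2⟩ := h
  refine ⟨r • g, ?_, ?_⟩
  · rw [map_smul, h1]; rfl
  · rw [map_smul, h2, ← map_smul]; rfl

/-- Single-valuedness of the connecting relation. As the relation is linear, only the pairs with `z`
a coboundary matter. -/
theorem IsConnecting.cls_eq_zero (h : IsShortExact i p) {n : ℕ} {z : Cocycle M' N n}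
    {c : Cocycle M'' N (n + 1)} (hc : IsConnecting i p z c) (hz : cls z = 0) : cls c = 0 := by
  obtain ⟨g, h1, h2⟩ := hc
  rw [HopfBimod.cls_eq_zero] at hz ⊢
  -- A cochain on `M` with the differential of `g` is wanted whose restriction to `M'` vanishes, so
  -- that it descends to `M''`. In degree zero the coboundaries are `0` and `g` itself serves;
  -- otherwise `z = D b`, and `g` is corrected by the differential of an extension of `b`.
  obtain ⟨g', h3, h4⟩ : ∃ g', pullC N i n g' = 0 ∧ D M N n g' = D M N n g := by
    cases n with
    | zero => exact ⟨g, h1.trans hz, rfl⟩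
    | succ n =>
      obtain ⟨b, hb⟩ := hz
      obtain ⟨e, rfl⟩ := h.pullC_surjective n b
      refine ⟨g - D M N n e, ?_, ?_⟩
      · rw [map_sub, h1, pullC_D, hb, sub_self]
      · rw [map_sub, D_D, sub_zero]
  obtain ⟨e, rfl⟩ := h.exists_pullC_eq n g' h3
  exact ⟨e, h.pullC_injective _ (by rw [pullC_D, h4, h2])⟩

theorem cls_surjective (n : ℕ) : Function.Surjective (cls (M := M) (N := N) (n := n)) :=
  Submodule.mkQ_surjective _

/-- Apply `IsConnecting.cls_eq_zero` to the difference of the two connecting pairs. -/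
theorem cls_eq_cls_of_isConnecting (h : IsShortExact i p) {n : ℕ} {z z' : Cocycle M' N n}
    {c c' : Cocycle M'' N (n + 1)} (hc : IsConnecting i p z c) (hc' : IsConnecting i p z' c')
    (hz : cls z = cls z') : cls c = cls c' := by
  have h1 := (hc.add (hc'.smul (-1))).cls_eq_zero h (by
    rw [map_add, map_smul, hz, neg_one_smul, add_neg_cancel])
  rw [map_add, map_smul, neg_one_smul, ← sub_eq_add_neg, sub_eq_zero] at h1
  exact h1

end Exactness

end HopfBimod

namespace HopfBimod

/-! ### Convolution acting on maps from a bialgebra into a vector space -/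

section ModuleConv

variable {k C Z : Type u} [Field k] [Ring C] [Bialgebra k C] [AddCommGroup Z] [Module k Z]

/-- The pairing `x ⊗ y ↦ f(x) m(y)`. -/
noncomputable def evalPair (f : C →ₗ[k] Module.End k Z) (m : C →ₗ[k] Z) : C ⊗[k] C →ₗ[k] Z :=
  TensorProduct.lift (LinearMap.lcomp k Z m ∘ₗ f)

theorem evalPair_tmul (f : C →ₗ[k] Module.End k Z) (m : C →ₗ[k] Z) (x y : C) :
    evalPair f m (x ⊗ₜ y) = f x (m y) := rfl

/-- Both sides are `∑ f(c₁) g(c₂) m(c₃)`. It lets `f` be cancelled against a convolution inverse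
`g`. -/
theorem evalPair_comul_comul (f g : C →ₗ[k] Module.End k Z) (m : C →ₗ[k] Z) (c : C) :
    evalPair f (evalPair g m ∘ₗ comul) (comul c) = evalPair (conv f g) m (comul c) := by
  let Ψ : C ⊗[k] (C ⊗[k] C) →ₗ[k] Z :=
    TensorProduct.lift (LinearMap.lcomp k Z (evalPair g m) ∘ₗ f)
  have h1 : ∀ s : C ⊗[k] C, evalPair f (evalPair g m ∘ₗ comul) s = Ψ (comul.lTensor C s) := by
    intro s
    induction s with
    | zero => simp only [map_zero]
    | add x y hx hy => simp only [map_add, hx, hy]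
    | tmul x y => rfl
  have h2 : ∀ s : C ⊗[k] C, evalPair (conv f g) m s =
      Ψ (TensorProduct.assoc k C C C (comul.rTensor C s)) := by
    intro s
    induction s with
    | zero => simp only [map_zero]
    | add x y hx hy => simp only [map_add, hx, hy]
    | tmul x y =>
      rw [evalPair_tmul, conv_apply, LinearMap.rTensor_tmul]
      generalize comul (R := k) x = s
      induction s with
      | zero => simp only [map_zero, zero_tmul, LinearMap.zero_apply]
      | add x y hx hy => simp only [map_add, add_tmul, LinearMap.add_apply, hx, hy]
      | tmul x y => rfl
  rw [h1, h2, Coalgebra.coassoc_apply]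

/-- The mirror version, with both sides equal to `∑ f(c₃) g(c₂) m(c₁)`. The reversed order is the
one in which `S⁻¹` is a convolution inverse. -/
theorem evalPair_comm_comul_comul (f g : C →ₗ[k] Module.End k Z) (m : C →ₗ[k] Z) (c : C) :
    evalPair f (evalPair g m ∘ₗ (TensorProduct.comm k C C).toLinearMap ∘ₗ comul)
      (TensorProduct.comm k C C (comul c)) =
      evalPair (oconv g f) m (TensorProduct.comm k C C (comul c)) := by
  let Ψ : (C ⊗[k] C) ⊗[k] C →ₗ[k] Z := TensorProduct.lift
    ((LinearMap.lcomp k Z (evalPair g m ∘ₗ (TensorProduct.comm k C C).toLinearMap) ∘ₗ f).flip)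
  have h1 : ∀ s : C ⊗[k] C,
      evalPair f (evalPair g m ∘ₗ (TensorProduct.comm k C C).toLinearMap ∘ₗ comul)
        (TensorProduct.comm k C C s) = Ψ (comul.rTensor C s) := by
    intro s
    induction s with
    | zero => simp only [map_zero]
    | add x y hx hy => simp only [map_add, hx, hy]
    | tmul x y => rfl
  have h2 : ∀ s : C ⊗[k] C, evalPair (oconv g f) m (TensorProduct.comm k C C s) =
      Ψ ((TensorProduct.assoc k C C C).symm (comul.lTensor C s)) := by
    intro s
    induction s with
    | zero => simp only [map_zero]
    | add x y hx hy => simp only [map_add, hx, hy]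
    | tmul x y =>
      rw [comm_tmul, evalPair_tmul, oconv_apply, LinearMap.lTensor_tmul]
      generalize comul (R := k) y = s
      induction s with
      | zero => simp only [map_zero, tmul_zero, LinearMap.zero_apply]
      | add x y hx hy => simp only [map_add, tmul_add, LinearMap.add_apply, hx, hy]
      | tmul x y => rfl
  rw [h1, h2, Coalgebra.coassoc_symm_apply]

theorem evalPair_unit (m : C →ₗ[k] Z) (s : C ⊗[k] C) :
    evalPair (Algebra.linearMap k (Module.End k Z) ∘ₗ counit) m s =
      m (TensorProduct.lid k C (counit.rTensor C s)) := by
  induction s with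
  | zero => simp only [map_zero]
  | add x y hx hy => simp only [map_add, hx, hy]
  | tmul x y => simp [evalPair_tmul, Module.algebraMap_end_apply]

theorem evalPair_unit_comul (m : C →ₗ[k] Z) (c : C) :
    evalPair (Algebra.linearMap k (Module.End k Z) ∘ₗ counit) m (comul c) = m c := by
  rw [evalPair_unit, Coalgebra.rTensor_counit_comul, lid_tmul, one_smul]

theorem evalPair_unit_comm_comul (m : C →ₗ[k] Z) (c : C) :
    evalPair (Algebra.linearMap k (Module.End k Z) ∘ₗ counit) m
      (TensorProduct.comm k C C (comul c)) = m c := by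
  have h : ∀ s : C ⊗[k] C, TensorProduct.lid k C (counit.rTensor C (TensorProduct.comm k C C s)) =
      TensorProduct.rid k C (counit.lTensor C s) := by
    intro s
    induction s with
    | zero => simp only [map_zero]
    | add x y hx hy => simp only [map_add, hx, hy]
    | tmul x y => rfl
  rw [evalPair_unit, h, Coalgebra.lTensor_counit_comul, rid_tmul, one_smul]

end ModuleConv

/-! ### From representations of `X` to Hopf bimodules -/

section FromRep

variable {k A : Type u} [Field k] [Ring A] [HopfAlgebra k A] [FiniteDimensional k A]
  {V : Type u} [AddCommGroup V] [Module k V]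

variable (k A) in
/-- The dual basis of a basis of `A`. -/
noncomputable def dualBasis (i : Fin (Module.finrank k A)) : DualA k A :=
  (toForm k A).symm ((Module.finBasis k A).coord i)

theorem toForm_dualBasis (i : Fin (Module.finrank k A)) (a : A) :
    toForm k A (dualBasis k A i) a = (Module.finBasis k A).repr a i := rfl

/-- Finite dimensionality enters here: a tensor is recovered from its contractions by a dual basis,
so identities in `A ⊗ V` can be tested after applying linear forms. -/
theorem sum_contrL (t : A ⊗[k] V) :
    ∑ i, Module.finBasis k A i ⊗ₜ[k] contrL V (dualBasis k A i) t = t := by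
  induction t with
  | zero => simp only [map_zero, tmul_zero, Finset.sum_const_zero]
  | add x y hx hy => simp only [map_add, tmul_add, Finset.sum_add_distrib, hx, hy]
  | tmul a v =>
    simp only [contrL_tmul, toForm_dualBasis, ← smul_tmul]
    rw [← sum_tmul, (Module.finBasis k A).sum_repr]

theorem sum_contrR (t : V ⊗[k] A) :
    ∑ i, contrR V (dualBasis k A i) t ⊗ₜ[k] Module.finBasis k A i = t := by
  induction t with
  | zero => simp only [map_zero, zero_tmul, Finset.sum_const_zero]
  | add x y hx hy => simp only [map_add, add_tmul, Finset.sum_add_distrib, hx, hy]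
  | tmul v a =>
    simp only [contrR_tmul, toForm_dualBasis, smul_tmul]
    rw [← tmul_sum, (Module.finBasis k A).sum_repr]

theorem contrL_ext {s t : A ⊗[k] V} (h : ∀ l, contrL V l s = contrL V l t) : s = t := by
  rw [← sum_contrL s, ← sum_contrL t]
  simp only [h]

theorem contrR_ext {s t : V ⊗[k] A} (h : ∀ l, contrR V l s = contrR V l t) : s = t := by
  rw [← sum_contrR s, ← sum_contrR t]
  simp only [h]

theorem sum_dualBasis (l : DualA k A) :
    ∑ i, toForm k A l (Module.finBasis k A i) • dualBasis k A i = l := by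
  apply dual_ext
  intro a
  simp only [map_sum, map_smul, LinearMap.sum_apply, LinearMap.smul_apply, toForm_dualBasis]
  conv_rhs => rw [← (Module.finBasis k A).sum_repr a, map_sum]
  simp only [map_smul, smul_eq_mul, mul_comm]

theorem contrL_twistL (c : A ⊗[k] Aᵐᵒᵖ) (l : DualA k A) (t : A ⊗[k] V) :
    contrL V (twistL k A c l) t = contrL V l ((regAct k A (antipode k c)).rTensor V t) := by
  induction t with
  | zero => simp only [map_zero]
  | add x y hx hy => simp only [map_add, hx, hy]
  | tmul a v => rfl

theorem contrR_twistR (c : A ⊗[k] Aᵐᵒᵖ) (l : DualA k A) (t : V ⊗[k] A) :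
    contrR V (twistR k A c l) t = contrR V l ((regAct k A (antipodeInv k _ c)).lTensor V t) := by
  induction t with
  | zero => simp only [map_zero]
  | add x y hx hy => simp only [map_add, hx, hy]
  | tmul a v => rfl

namespace XRep

variable (ρ : XRep k A V)

/-- The left coaction that corresponds to the action of `A*ᵒᵖ`. -/
noncomputable def coactL : V →ₗ[k] A ⊗[k] V :=
  ∑ i, TensorProduct.mk k A V (Module.finBasis k A i) ∘ₗ ρ.actL (dualBasis k A i)

/-- The right coaction that corresponds to the action of `A*`. -/
noncomputable def coactR : V →ₗ[k] V ⊗[k] A :=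
  ∑ i, (TensorProduct.mk k V A).flip (Module.finBasis k A i) ∘ₗ ρ.actR (dualBasis k A i)

/-- Expanding `l` in the dual basis removes the basis from the definition. This identity and
`contrL_ext` characterize the coaction, and the later arguments use nothing else about it. -/
theorem contrL_coactL (l : DualA k A) (v : V) : contrL V l (ρ.coactL v) = ρ.actL l v := by
  conv_rhs => rw [← sum_dualBasis l]
  simp [coactL, contrL_tmul]

theorem contrR_coactR (l : DualA k A) (v : V) : contrR V l (ρ.coactR v) = ρ.actR l v := by
  conv_rhs => rw [← sum_dualBasis l]
  simp [coactR, contrR_tmul]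

/-- The straightening relation says `(1 ⊗ c) δ v = ∑ (S(c₁) ⊗ 1) δ(c₂ v)`. Acting by `c₁` on the
first leg cancels the antipode: `∑ (c₁ ⊗ c₂) δ v = ∑ (c₁ S(c₂) ⊗ 1) δ(c₃ v) = δ(c v)`. -/
theorem coactL_act (c : A ⊗[k] Aᵐᵒᵖ) (v : V) :
    ρ.coactL (ρ.act c v) = diag (regAct k A) ρ.act c (ρ.coactL v) := by
  let p₁ : A ⊗[k] Aᵐᵒᵖ →ₐ[k] Module.End k (A ⊗[k] V) :=
    (Module.End.rTensorAlgHom k A V).comp (regAct k A)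
  let p₂ : A ⊗[k] Aᵐᵒᵖ →ₐ[k] Module.End k (A ⊗[k] V) :=
    (Module.End.lTensorAlgHom k V A).comp ρ.act
  let E : A ⊗[k] Aᵐᵒᵖ →ₗ[k] A ⊗[k] V := ρ.coactL ∘ₗ ρ.act.toLinearMap.flip v
  -- The straightening relation for `A*ᵒᵖ`, with the linear form stripped off: after contraction by
  -- each `l` it is the relation `act_actL` of the representation.
  have h1 : p₂.toLinearMap.flip (ρ.coactL v) =
      evalPair (p₁.toLinearMap ∘ₗ antipode k) E ∘ₗ comul := by
    refine LinearMap.ext fun c => contrL_ext fun l => ?_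
    have h2 : ∀ s, (LinearMap.mul' k _ (map (ρ.actL ∘ₗ (twistL k A).toLinearMap.flip l)
        ρ.act.toLinearMap s)) v = contrL V l (evalPair (p₁.toLinearMap ∘ₗ antipode k) E s) := by
      intro s
      induction s with
      | zero => simp only [map_zero, LinearMap.zero_apply]
      | add x y hx hy => simp only [map_add, LinearMap.add_apply, hx, hy]
      | tmul x y =>
        change ρ.actL (twistL k A x l) (ρ.act y v) =
          contrL V l ((regAct k A (antipode k x)).rTensor V (ρ.coactL (ρ.act y v)))
        rw [← contrL_twistL, contrL_coactL]
    change contrL V l ((ρ.act c).lTensor A (ρ.coactL v)) = contrL V l (evalPair _ E (comul c))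
    rw [← h2, ← ρ.act_actL, ← contrL_nat, contrL_coactL]
    rfl
  have h3 : ∀ s, diagAux (regAct k A) ρ.act s (ρ.coactL v) =
      evalPair p₁.toLinearMap (p₂.toLinearMap.flip (ρ.coactL v)) s := by
    intro s
    induction s with
    | zero => simp only [map_zero, LinearMap.zero_apply]
    | add x y hx hy => simp only [map_add, LinearMap.add_apply, hx, hy]
    | tmul x y =>
      rw [diagAux_tmul]
      exact (LinearMap.congr_fun (LinearMap.rTensor_comp_lTensor (f := regAct k A x) (g := ρ.act y)) _).symm
  rw [diag_eq, h3, h1, evalPair_comul_comul, conv_antipode, evalPair_unit_comul]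
  rfl

/-- Here the relation reads `(c ⊗ 1) δ v = ∑ (1 ⊗ S⁻¹(c₂)) δ(c₁ v)`, so `∑ (c₁ ⊗ c₂) δ v = ∑ (1 ⊗ c₃
S⁻¹(c₂)) δ(c₁ v) = δ(c v)`. -/
theorem coactR_act (c : A ⊗[k] Aᵐᵒᵖ) (v : V) :
    ρ.coactR (ρ.act c v) = diag ρ.act (regAct k A) c (ρ.coactR v) := by
  let q₁ : A ⊗[k] Aᵐᵒᵖ →ₐ[k] Module.End k (V ⊗[k] A) :=
    (Module.End.rTensorAlgHom k V A).comp ρ.act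
  let q₂ : A ⊗[k] Aᵐᵒᵖ →ₐ[k] Module.End k (V ⊗[k] A) :=
    (Module.End.lTensorAlgHom k A V).comp (regAct k A)
  let E : A ⊗[k] Aᵐᵒᵖ →ₗ[k] V ⊗[k] A := ρ.coactR ∘ₗ ρ.act.toLinearMap.flip v
  have h1 : q₁.toLinearMap.flip (ρ.coactR v) =
      evalPair (q₂.toLinearMap ∘ₗ antipodeInv k _) E ∘ₗ
        (TensorProduct.comm k _ _).toLinearMap ∘ₗ comul := by
    refine LinearMap.ext fun c => contrR_ext fun l => ?_
    have h2 : ∀ s, (LinearMap.mul' k _ (TensorProduct.comm k _ _ (map ρ.act.toLinearMap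
        (ρ.actR ∘ₗ (twistR k A).toLinearMap.flip l) s))) v =
        contrR V l (evalPair (q₂.toLinearMap ∘ₗ antipodeInv k _) E
          (TensorProduct.comm k _ _ s)) := by
      intro s
      induction s with
      | zero => simp only [map_zero, LinearMap.zero_apply]
      | add x y hx hy => simp only [map_add, LinearMap.add_apply, hx, hy]
      | tmul x y =>
        change ρ.actR (twistR k A y l) (ρ.act x v) =
          contrR V l ((regAct k A (antipodeInv k _ y)).lTensor V (ρ.coactR (ρ.act x v)))
        rw [← contrR_twistR, contrR_coactR]
    change contrR V l ((ρ.act c).rTensor A (ρ.coactR v)) =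
      contrR V l (evalPair _ E (TensorProduct.comm k _ _ (comul c)))
    rw [← h2, ← ρ.act_actR, ← contrR_nat, contrR_coactR]
    rfl
  have h3 : ∀ s, diagAux ρ.act (regAct k A) s (ρ.coactR v) =
      evalPair q₂.toLinearMap (q₁.toLinearMap.flip (ρ.coactR v)) (TensorProduct.comm k _ _ s) := by
    intro s
    induction s with
    | zero => simp only [map_zero, LinearMap.zero_apply]
    | add x y hx hy => simp only [map_add, LinearMap.add_apply, hx, hy]
    | tmul x y =>
      rw [diagAux_tmul]
      exact (LinearMap.congr_fun (LinearMap.lTensor_comp_rTensor (f := ρ.act x) (g := regAct k A y)) _).symm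
  -- The operator identity `∑ q₂(c₂) q₂(S⁻¹(c₁)) = ε(c)`, which is the image under `q₂` of
  -- `mul_antipodeInv_swap`.
  have h4 : oconv (q₂.toLinearMap ∘ₗ antipodeInv k _) q₂.toLinearMap =
      Algebra.linearMap k _ ∘ₗ counit := by
    refine LinearMap.ext fun c => ?_
    have h : ∀ s, LinearMap.mul' k _ (TensorProduct.comm k _ _
        (map (q₂.toLinearMap ∘ₗ antipodeInv k _) q₂.toLinearMap s)) =
        q₂ (LinearMap.mul' k _ (TensorProduct.comm k _ _ ((antipodeInv k _).rTensor _ s))) := by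
      intro s
      induction s with
      | zero => simp only [map_zero]
      | add x y hx hy => simp only [map_add, hx, hy]
      | tmul x y => exact (map_mul q₂ y _).symm
    rw [oconv_apply, h, mul_antipodeInv_swap, AlgHom.commutes]
    rfl
  rw [diag_eq, h3, h1, evalPair_comm_comul_comul, h4, evalPair_unit_comm_comul]
  rfl

theorem commute_act (a : A) (b : Aᵐᵒᵖ) :
    Commute (ρ.act.comp Algebra.TensorProduct.includeLeft a)
      (ρ.act.comp Algebra.TensorProduct.includeRight b) := by
  refine Commute.map (?_ : Commute (a ⊗ₜ[k] (1 : Aᵐᵒᵖ)) ((1 : A) ⊗ₜ[k] b)) ρ.act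
  simp [Commute, SemiconjBy]

theorem lift_act : Algebra.TensorProduct.lift (ρ.act.comp Algebra.TensorProduct.includeLeft)
    (ρ.act.comp Algebra.TensorProduct.includeRight) ρ.commute_act = ρ.act := by
  refine Algebra.TensorProduct.ext ?_ ?_ <;> ext x : 1 <;> simp

/-- It splits the compatibility of the coaction with `A ⊗ Aᵒᵖ` into the separate axioms for the left
and the right action, obtained at `b = 1` and at `a = 1`. -/
theorem diag_regAct_act (a : A) (b : Aᵐᵒᵖ) : diag (regAct k A) ρ.act (a ⊗ₜ b) =
    diag (leftMul k A) (ρ.act.comp Algebra.TensorProduct.includeLeft) a *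
      diag (rightMul k A) (ρ.act.comp Algebra.TensorProduct.includeRight) b := by
  rw [← diag_tensor (leftMul_rightMul_comm k A) ρ.commute_act, lift_act]
  rfl

theorem diag_act_regAct (a : A) (b : Aᵐᵒᵖ) : diag ρ.act (regAct k A) (a ⊗ₜ b) =
    diag (ρ.act.comp Algebra.TensorProduct.includeLeft) (leftMul k A) a *
      diag (ρ.act.comp Algebra.TensorProduct.includeRight) (rightMul k A) b := by
  rw [← diag_tensor ρ.commute_act (leftMul_rightMul_comm k A), lift_act]
  rfl

/-- The Hopf bimodule given by a representation of `X`. -/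
noncomputable def toHopfBimodule : HopfBimodule k A where
  V := V
  lact := ρ.act.comp Algebra.TensorProduct.includeLeft
  ract := ρ.act.comp Algebra.TensorProduct.includeRight
  δL := ρ.coactL
  δR := ρ.coactR
  lact_ract := ρ.commute_act
  -- Contracted by two linear forms, coassociativity becomes multiplicativity of the action of
  -- `A*ᵒᵖ`. In the same way the counit axioms become unitality, and the bicomodule axiom the
  -- commutation of `A*ᵒᵖ` with `A*`.
  coassocL v := contrL_ext fun l' => contrL_ext fun l => by
    rw [← contrL_mul, contrL_coactL, ρ.actL_mul, ← contrL_nat, contrL_coactL, contrL_coactL]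
    rfl
  counitL v := (TensorProduct.lid k V).injective <| by
    rw [← contrL_one, contrL_coactL, ρ.actL_one, lid_tmul, one_smul]
    rfl
  coassocR v := by
    rw [← LinearEquiv.eq_symm_apply]
    refine contrR_ext fun l' => contrR_ext fun l => ?_
    rw [← contrR_mul, contrR_coactR, ρ.actR_mul, ← contrR_nat, contrR_coactR, contrR_coactR]
    rfl
  counitR v := (TensorProduct.rid k V).injective <| by
    rw [← contrR_one, contrR_coactR, ρ.actR_one, rid_tmul, one_smul]
    rfl
  bicomod v := contrL_ext fun l => contrR_ext fun m => by
    rw [← contrL_contrR, ← contrR_nat, contrR_coactR, contrL_coactL, ← contrL_nat, contrL_coactL,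
      contrR_coactR]
    exact LinearMap.congr_fun (ρ.actL_actR l m).eq v
  δL_lact a v := by
    have h := ρ.coactL_act (a ⊗ₜ 1) v
    rwa [diag_regAct_act, map_one, mul_one] at h
  δL_ract b v := by
    have h := ρ.coactL_act (1 ⊗ₜ b) v
    rwa [diag_regAct_act, map_one, one_mul] at h
  δR_lact a v := by
    have h := ρ.coactR_act (a ⊗ₜ 1) v
    rwa [diag_act_regAct, map_one, mul_one] at h
  δR_ract b v := by
    have h := ρ.coactR_act (1 ⊗ₜ b) v
    rwa [diag_act_regAct, map_one, one_mul] at h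

/-- The construction loses nothing: the action of `X` on the new Hopf bimodule is the given one. On
generators this is `contrL_coactL`, `contrR_coactR` and `lift_act`. -/
theorem xRep_toHopfBimodule_hom (x : AlgX k A) (v : V) :
    ρ.toHopfBimodule.xRep.hom x v = ρ.hom x v := by
  let H : AlgX k A →ₗ[k] Module.End k V := ρ.toHopfBimodule.xRep.hom
  change H x v = ρ.hom x v
  induction x using xInduction with
  | zero => rw [map_zero, map_zero]
  | add x y hx hy => rw [map_add, map_add, LinearMap.add_apply, LinearMap.add_apply, hx, hy]
  | mk l m c =>
    have h : ρ.toHopfBimodule.biact = ρ.act := ρ.lift_act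
    change contrL V l (ρ.coactL (contrR V m (ρ.coactR (ρ.toHopfBimodule.biact c v)))) =
      ρ.actL l (ρ.actR m (ρ.act c v))
    rw [h]
    exact (ρ.contrL_coactL _ _).trans (congrArg (ρ.actL l) (ρ.contrR_coactR _ _))

end XRep

end FromRep

end HopfBimod

namespace HopfBimod

/-! ### Representations of `X` from algebra maps `X → End V` -/

section FromModule

variable {k A : Type u} [Field k] [Ring A] [HopfAlgebra k A] [FiniteDimensional k A]

/-- The operators in the regular representation are left multiplications by their values at `1`.
This is how the operator identities of `xReg` become relations between elements of `X`, which an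
algebra map preserves. -/
theorem xL_mul (l : DualA k A) (x : AlgX k A) : xL k A l 1 * x = xL k A l x := by
  have h := (xReg k A).hom_xL l 1
  rw [xmul_def, h]
  exact congrArg (xL k A l) (one_mul x)

theorem xR_mul (l : DualA k A) (x : AlgX k A) : xR k A l 1 * x = xR k A l x := by
  have h := (xReg k A).hom_xR l 1
  rw [xmul_def, h]
  exact congrArg (xR k A l) (one_mul x)

theorem xGamma_mul (c : A ⊗[k] Aᵐᵒᵖ) (x : AlgX k A) : xGamma k A c 1 * x = xGamma k A c x := by
  have h := (xReg k A).hom_xGamma c 1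
  rw [xmul_def, h]
  exact congrArg (xGamma k A c) (one_mul x)

variable {V : Type u} [AddCommGroup V] [Module k V] (σ : AlgX k A →ₐ[k] Module.End k V)

/-- The operator `σ(T 1)` given by an operator `T` on `X`. -/
noncomputable def evalOne : Module.End k (AlgX k A) →ₗ[k] Module.End k V :=
  σ.toLinearMap ∘ₗ LinearMap.applyₗ 1

theorem evalOne_mul (S T : Module.End k (AlgX k A)) (hS : ∀ x, S 1 * x = S x) :
    evalOne σ S * evalOne σ T = evalOne σ (S * T) := by
  change σ (S 1) * σ (T 1) = σ (S (T 1))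
  rw [← map_mul, hS]

/-- The representation of `X` given by an algebra map `X → End V`. -/
noncomputable def xRepOfAlgHom : XRep k A V where
  actL := evalOne σ ∘ₗ xL k A
  actR := evalOne σ ∘ₗ xR k A
  act := AlgHom.ofLinearMap (evalOne σ ∘ₗ (xGamma k A).toLinearMap)
    (by
      change σ (xGamma k A 1 1) = 1
      rw [map_one (xGamma k A), Module.End.one_apply]
      exact map_one σ)
    (fun x y => by
      change evalOne σ (xGamma k A (x * y)) = evalOne σ (xGamma k A x) * evalOne σ (xGamma k A y)
      rw [evalOne_mul σ _ _ (xGamma_mul x), map_mul])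
  actL_one := by
    rw [LinearMap.comp_apply]
    have h : xL k A (dualOne k A) = 1 := (xReg k A).actL_one
    rw [h]
    exact map_one σ
  actR_one := by
    rw [LinearMap.comp_apply]
    have h : xR k A (dualOne k A) = 1 := (xReg k A).actR_one
    rw [h]
    exact map_one σ
  actL_mul l l' := by
    simp only [LinearMap.comp_apply]
    rw [evalOne_mul σ _ _ (xL_mul l)]
    exact congrArg (evalOne σ) ((xReg k A).actL_mul l l')
  actR_mul l l' := by
    simp only [LinearMap.comp_apply]
    rw [evalOne_mul σ _ _ (xR_mul l)]
    exact congrArg (evalOne σ) ((xReg k A).actR_mul l l')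
  actL_actR l m := by
    simp only [LinearMap.comp_apply, Commute, SemiconjBy]
    rw [evalOne_mul σ _ _ (xL_mul l), evalOne_mul σ _ _ (xR_mul m), (xL_xR k A l m).eq]
  act_actL c l := by
    change evalOne σ (xGamma k A c) * evalOne σ (xL k A l) = _
    rw [evalOne_mul σ _ _ (xGamma_mul c), xGamma_xL]
    generalize comul (R := k) c = s
    induction s with
    | zero => simp only [map_zero]
    | add x y hx hy => simp only [map_add, hx, hy]
    | tmul x y => exact (evalOne_mul σ _ _ (xL_mul _)).symm
  act_actR c m := by
    change evalOne σ (xGamma k A c) * evalOne σ (xR k A m) = _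
    rw [evalOne_mul σ _ _ (xGamma_mul c), xGamma_xR]
    generalize comul (R := k) c = s
    induction s with
    | zero => simp only [map_zero]
    | add x y hx hy => simp only [map_add, hx, hy]
    | tmul x y => exact (evalOne_mul σ _ _ (xR_mul _)).symm

/-- Each `(l ⊗ m) ⊗ c` is the product in `X` of its three parts, so `σ` is determined by its values
on the three subalgebras. -/
theorem xRepOfAlgHom_hom (x : AlgX k A) : (xRepOfAlgHom σ).hom x = σ x := by
  induction x using xInduction with
  | zero => simp only [map_zero]
  | add x y hx hy => simp only [map_add, hx, hy]
  | mk l m c =>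
    rw [XRep.hom_mk]
    change evalOne σ (xL k A l) * evalOne σ (xR k A m) * evalOne σ (xGamma k A c) = _
    rw [mul_assoc, evalOne_mul σ _ _ (xR_mul m), evalOne_mul σ _ _ (xL_mul l)]
    change σ (xL k A l (xR k A m (xGamma k A c (xmk k A (dualOne k A) (dualOne k A) 1)))) = _
    rw [xGamma_one, xR_mk, xL_mk, dualMul_one, one_dualMul]

end FromModule

/-! ### `X`-linear maps as morphisms of Hopf bimodules -/

section Full

variable {k A : Type u} [Field k] [Ring A] [HopfAlgebra k A] [FiniteDimensional k A]
  {M N : HopfBimodule k A}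

/-- The scalars inside `X` act as the original ones; hence `X`-linear maps are `k`-linear, and the
linear structures on both `Hom` spaces agree. -/
theorem xRep_algebraMap (M : HopfBimodule k A) (r : k) (v : M.V) :
    M.xRep.hom (algebraMap k (AlgX k A) r) v = r • v := by
  have h := M.xRep.algHom.commutes r
  exact LinearMap.congr_fun h v

theorem xRep_contrL (M : HopfBimodule k A) (l : DualA k A) (v : M.V) :
    M.xRep.hom (xmk k A l (dualOne k A) 1) v = contrL M.V l (M.δL v) := by
  rw [XRep.hom_mk, M.xRep.actR_one, map_one, mul_one, mul_one]
  rfl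

theorem xRep_contrR (M : HopfBimodule k A) (l : DualA k A) (v : M.V) :
    M.xRep.hom (xmk k A (dualOne k A) l 1) v = contrR M.V l (M.δR v) := by
  rw [XRep.hom_mk, M.xRep.actL_one, map_one, mul_one, one_mul]
  rfl

theorem xRep_biact (M : HopfBimodule k A) (c : A ⊗[k] Aᵐᵒᵖ) (v : M.V) :
    M.xRep.hom (xmk k A (dualOne k A) (dualOne k A) c) v = M.biact c v := by
  rw [XRep.hom_mk, M.xRep.actL_one, M.xRep.actR_one, mul_one, one_mul]
  rfl

/-- An additive map that commutes with the action of `X` is a morphism of Hopf bimodules. -/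
noncomputable def homOfX (f : M.V →+ N.V)
    (hf : ∀ (x : AlgX k A) v, f (M.xRep.hom x v) = N.xRep.hom x (f v)) : HomA4 M N :=
  let g : M.V →ₗ[k] N.V :=
    { f with
      map_smul' := fun r v => by
        have h := hf (algebraMap k _ r) v
        rwa [xRep_algebraMap, xRep_algebraMap] at h }
  ⟨g, by
    have hg : ∀ (x : AlgX k A) v, g (M.xRep.hom x v) = N.xRep.hom x (g v) := hf
    -- Each of the four structures is seen by its own elements of `X`: the actions by `a ⊗ 1` and `1
    -- ⊗ b`, the coactions by all linear forms, which separate tensors by `contrL_ext` and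
    -- `contrR_ext`.
    refine ⟨fun a v => ?_, fun b v => ?_, fun v => contrL_ext fun l => ?_,
      fun v => contrR_ext fun l => ?_⟩
    · have h := hg (xmk k A (dualOne k A) (dualOne k A) (a ⊗ₜ 1)) v
      rw [xRep_biact, xRep_biact, HopfBimodule.biact_tmul, HopfBimodule.biact_tmul, map_one,
        map_one, mul_one, mul_one] at h
      exact h
    · have h := hg (xmk k A (dualOne k A) (dualOne k A) (1 ⊗ₜ b)) v
      rw [xRep_biact, xRep_biact, HopfBimodule.biact_tmul, HopfBimodule.biact_tmul, map_one,
        map_one, one_mul, one_mul] at h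
      exact h
    · rw [← contrL_nat, ← xRep_contrL, ← xRep_contrL, hg]
    · rw [← contrR_nat, ← xRep_contrR, ← xRep_contrR, hg]⟩

/-- An `X`-linear map is a morphism of Hopf bimodules. -/
noncomputable def homOfLinear (f : M.XMod →ₗ[AlgX k A] N.XMod) : HomA4 M N :=
  homOfX (M := M) (N := N) f.toAddMonoidHom f.map_smul

/-- A morphism of Hopf bimodules as an `X`-linear map. -/
noncomputable def HomA4.toLinear (f : HomA4 M N) : M.XMod →ₗ[AlgX k A] N.XMod where
  toFun := f.1
  map_add' := f.1.map_add
  map_smul' := HomA4.map_hom f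

variable (k A) (Y : Type u) [AddCommGroup Y] [Module (AlgX k A) Y]

/-- The Hopf bimodule given by an `X`-module. -/
noncomputable def ofX : HopfBimodule k A :=
  -- Only an action of `X` is given, so the scalars act through `k → X`.
  letI : Module k Y := Module.compHom Y (algebraMap k (AlgX k A))
  letI : IsScalarTower k (AlgX k A) Y := ⟨fun r x y => by
    change _ = algebraMap k (AlgX k A) r • (x • y)
    rw [Algebra.smul_def, mul_smul]⟩
  (xRepOfAlgHom (Algebra.lsmul k k Y : AlgX k A →ₐ[k] Module.End k Y)).toHopfBimodule

/-- The `X`-module of the Hopf bimodule given by an `X`-module. -/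
noncomputable def ofXEquiv : Y ≃ₗ[AlgX k A] (ofX k A Y).XMod where
  toFun y := y
  invFun y := y
  map_add' _ _ := rfl
  map_smul' x y := by
    -- The same local structure as in `ofX`. The underlying group is `Y` itself, so the map is the
    -- identity and only the agreement of the two actions of `X` needs an argument.
    let _ : Module k Y := Module.compHom Y (algebraMap k (AlgX k A))
    let _ : IsScalarTower k (AlgX k A) Y := ⟨fun r x y => by
      change _ = algebraMap k (AlgX k A) r • (x • y)
      rw [Algebra.smul_def, mul_smul]⟩
    let ρ := xRepOfAlgHom (Algebra.lsmul k k Y : AlgX k A →ₐ[k] Module.End k Y)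
    have h : ρ.toHopfBimodule.xRep.hom x y = x • y := by
      rw [XRep.xRep_toHopfBimodule_hom, xRepOfAlgHom_hom]
      rfl
    exact h.symm
  left_inv _ := rfl
  right_inv _ := rfl

end Full

/-! ### Enough projective Hopf bimodules -/

section Projective

variable {k A : Type u} [Field k] [Ring A] [HopfAlgebra k A] [FiniteDimensional k A]

/-- Every Hopf bimodule has a presentation `0 → K → P → M → 0` by an `X`-projective one. -/
theorem exists_projective_presentation (M : HopfBimodule k A) :
    ∃ (K P : HopfBimodule k A) (i : HomA4 K P) (p : HomA4 P M), IsShortExact i p ∧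
      Module.Projective (AlgX k A) P.XMod := by
  -- The free `X`-module on the underlying set of `M`. It and the kernel of its map onto `M` become
  -- Hopf bimodules through `ofX`.
  let F := M.XMod →₀ AlgX k A
  let f : F →ₗ[AlgX k A] M.XMod := Finsupp.linearCombination (AlgX k A) id
  have hf : Function.Surjective f := Finsupp.linearCombination_id_surjective _ _
  let j : (ofX k A (LinearMap.ker f)).XMod →ₗ[AlgX k A] (ofX k A F).XMod :=
    (ofXEquiv k A F).toLinearMap ∘ₗ (LinearMap.ker f).subtype ∘ₗ (ofXEquiv k A _).symm.toLinearMap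
  refine ⟨ofX k A (LinearMap.ker f), ofX k A F, homOfLinear j,
    homOfLinear (f ∘ₗ (ofXEquiv k A F).symm.toLinearMap), ⟨?_, ?_, ?_⟩,
    Module.Projective.of_equiv (ofXEquiv k A F)⟩
  · exact Subtype.val_injective
  · exact LinearMap.exact_subtype_ker_map f
  · exact hf

/-- The lifting property of an `X`-projective Hopf bimodule. -/
theorem exists_lift {P W Z : HopfBimodule k A} [Module.Projective (AlgX k A) P.XMod]
    (g : HomA4 W Z) (f : HomA4 P Z) (h : ∀ v, ∃ w, g.1 w = f.1 v) :
    ∃ l : HomA4 P W, compH g l = f := by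
  let g' := HomA4.toLinear g
  -- The morphism `g` need not be surjective: it is replaced by its corestriction to its range,
  -- which contains the image of `f` by hypothesis. The cobar differential, which is rarely onto, is
  -- used in this way.
  obtain ⟨l, hl⟩ := Module.projective_lifting_property g'.rangeRestrict
    ((HomA4.toLinear f).codRestrict (LinearMap.range g') h) g'.surjective_rangeRestrict
  refine ⟨homOfLinear l, homA4_ext fun v => ?_⟩
  exact congrArg Subtype.val (LinearMap.congr_fun hl v)

end Projective

end HopfBimod

namespace HopfBimod

/-! ### Vanishing of the cohomology on projective Hopf bimodules -/

section Acyclic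

variable {k A : Type u} [Field k] [Ring A] [HopfAlgebra k A] {M N W P : HopfBimodule k A}

theorem tensAMap_id : tensAMap (HomA4.id W) = HomA4.id (tensA W) :=
  homA4_ext <| tensA_ext (tensAMap (HomA4.id W)).1 LinearMap.id fun _ _ => rfl

theorem tensAMap_add {L : HopfBimodule k A} (f g : HomA4 L M) :
    tensAMap (f + g) = tensAMap f + tensAMap g :=
  homA4_ext <| tensA_ext (tensAMap (f + g)).1 ((tensAMap f).1 + (tensAMap g).1) fun _ _ =>
    add_tmul _ _ _

/-- A contraction of the bar complex of `W` given by a section of the action `W ⊗ A → W`. -/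
noncomputable def barHtpy (s : HomA4 W (tensA W)) : ∀ q, HomA4 (tpow W q) (tpow W (q + 1))
  | 0 => s
  | q + 1 => tensAMap (barHtpy s q)

/-- The first term of the differential gives `(μ s) ⊗ 1 = 1`, and the second gives `-s μ` by
naturality of the action. -/
theorem barStep_htpy_zero (s : HomA4 W (tensA W)) (hs : compH (actMap W) s = HomA4.id W)
    (x : (tensA W).V) :
    (barStep (-1) (actMap W)).1 ((tensAMap s).1 x) + s.1 ((actMap W).1 x) = x := by
  rw [barStep_apply, tensAMap_comp, hs, tensAMap_id, actMap_nat, neg_one_smul,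
    neg_add_cancel_right]
  rfl

/-- Tensoring the homotopy identity with `A` accounts for all terms except the two that multiply the
last factors. These enter with the opposite signs `r'` and `r` and cancel by naturality of the
action. -/
theorem barStep_htpy_succ {r r' : k} (hr : r' = -r) (b : HomA4 (tensA W) W)
    (t : HomA4 W (tensA W))
    (h : ∀ x, (barStep r b).1 ((tensAMap t).1 x) + t.1 (b.1 x) = x) (x : (tensA (tensA W)).V) :
    (barStep r' (barStep r b)).1 ((tensAMap (tensAMap t)).1 x) +
      (tensAMap t).1 ((barStep r b).1 x) = x := by
  subst hr
  have h1 : compH (barStep r b) (tensAMap t) + compH t b = HomA4.id (tensA W) := homA4_ext h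
  have h2 : (tensAMap t).1 ((barStep r b).1 x) = (tensAMap (compH t b)).1 x +
      r • (tensAMap t).1 ((actMap (tensA W)).1 x) := by
    rw [barStep_apply, map_add, map_smul, tensAMap_comp]
  have h3 : (tensAMap (compH (barStep r b) (tensAMap t))).1 x + (tensAMap (compH t b)).1 x = x := by
    have h4 := congrArg (fun f : HomA4 (tensA (tensA W)) (tensA (tensA W)) => f.1 x)
      (tensAMap_add (compH (barStep r b) (tensAMap t)) (compH t b))
    rw [h1, tensAMap_id] at h4
    exact h4.symm
  rw [h2, barStep_apply (-r), tensAMap_comp, actMap_nat]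
  conv_rhs => rw [← h3]
  module

/-- The contraction consists of morphisms of Hopf bimodules, as precomposition of cochains requires.
The customary linear contraction by the unit would not do; this is why a splitting of the action is
needed. -/
theorem barHtpy_spec (s : HomA4 W (tensA W)) (hs : compH (actMap W) s = HomA4.id W) (q : ℕ)
    (x : (tpow W (q + 1)).V) : (barMap W (q + 1)).1 ((barHtpy s (q + 1)).1 x) +
      (barHtpy s q).1 ((barMap W q).1 x) = x := by
  induction q with
  | zero =>
    have h := barStep_htpy_zero s hs x
    rw [← pow_one (-1 : k)] at h
    exact h
  | succ q ih =>
    exact barStep_htpy_succ (r := (-1) ^ (q + 1)) (r' := (-1) ^ (q + 2)) (by ring) (barMap W q)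
      (barHtpy s q) ih x

/-- Apply `ε` to the first factor of `δ_L y = (1 ⊗ f) y`. The preimage is given by a map that is
linear but in general not a morphism, so projectivity has to be used afterwards to lift morphisms.
-/
theorem cobarStep_exact (f : HomA4 W (aTens W)) (y : (aTens W).V) (h : (cobarStep f).1 y = 0) :
    f.1 (counitLin A W.V y) = y := by
  have h1 : counitLin A (A ⊗[k] W.V) ((coactMap (aTens W)).1 y) = y := counitLin_comul _
  have h2 : counitLin A (A ⊗[k] W.V) ((aTensMap f).1 y) = f.1 (counitLin A W.V y) :=
    counitLin_nat f.1 y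
  rw [cobarStep_apply, sub_eq_zero] at h
  rw [← h2, ← h]
  exact h1

/-- The cochain `(p, q) ↦ F_{p, q + 1} ∘ t_{q + 1}` for the contraction `t` of the bar complex. -/
noncomputable def contract (s : HomA4 W (tensA W)) {n : ℕ} (F : Cochain W N (n + 1)) :
    Cochain W N n := fun x =>
  HomA4.precomp (upow N (x.1.1 + 1)) (barHtpy s (x.1.2 + 1))
    (F ⟨(x.1.1, x.1.2 + 1), by have := x.2; omega⟩)

theorem D_eq_zero {n : ℕ} (F : Cochain M N n) {p q : ℕ} {h : p + q = n + 1}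
    (hh : hPart F p q h = 0) (hc : cPart F p q h = 0) : D M N n F ⟨(p, q), h⟩ = 0 := by
  change hPart F p q h + cPart F p q h = 0
  rw [hh, hc, add_zero]

theorem dc_comp_actMap (p : ℕ) (l : HomA4 W (upow N (p + 1))) :
    dc W N p 0 (compH l (actMap W)) = compH (compH (cobarMap N (p + 1)) l) (actMap W) :=
  homA4_ext fun x => by
    change (-1 : k) ^ 0 • (cobarMap N (p + 1)).1 (l.1 ((actMap W).1 x)) =
      (cobarMap N (p + 1)).1 (l.1 ((actMap W).1 x))
    rw [pow_zero]
    exact one_smul k _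

theorem hPart_eq_zero {n : ℕ} (F : Cochain M N n) (p q : ℕ) (h : p + (q + 1) = n + 1)
    (hF : F ⟨(p, q), by omega⟩ = 0) : hPart F p (q + 1) h = 0 := by
  change dh M N p q (F ⟨(p, q), _⟩) = 0
  rw [hF, map_zero]

theorem cPart_eq_zero {n : ℕ} (F : Cochain M N n) (q : ℕ) (hF : ∀ p h, F ⟨(p, q), h⟩ = 0)
    (p : ℕ) (h : p + q = n + 1) : cPart F p q h = 0 := by
  cases p with
  | zero => rfl
  | succ p =>
    change dc M N p q (F ⟨(p, q), _⟩) = 0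
    rw [hF, map_zero]

/-- The homotopy identity writes a component of `F` as `F t λ + F λ t`. The first term is the `d_h`
part of the differential of the contraction; the cocycle equation one place higher in `q` turns the
second into its `d_c` part. -/
theorem sub_D_contract (s : HomA4 W (tensA W)) (hs : compH (actMap W) s = HomA4.id W) {n : ℕ}
    (F : Cochain W N (n + 1)) (hF : D W N (n + 1) F = 0) (p q : ℕ) (h : p + (q + 1) = n + 1) :
    D W N n (contract s F) ⟨(p, q + 1), h⟩ = F ⟨(p, q + 1), h⟩ := by
  have hD : dh W N p (q + 1) (F ⟨(p, q + 1), h⟩) + cPart F p (q + 2) (by omega) = 0 :=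
    congrArg (fun G : Cochain W N (n + 2) => G ⟨(p, q + 2), by omega⟩) hF
  refine homA4_ext fun x => ?_
  have h1 : (F ⟨(p, q + 1), h⟩).1 x =
      (F ⟨(p, q + 1), h⟩).1 ((barMap W (q + 2)).1 ((barHtpy s (q + 2)).1 x)) +
      (F ⟨(p, q + 1), h⟩).1 ((barHtpy s (q + 1)).1 ((barMap W (q + 1)).1 x)) := by
    rw [← map_add, barHtpy_spec s hs]
  have h2 : (F ⟨(p, q + 1), h⟩).1 ((barMap W (q + 2)).1 ((barHtpy s (q + 2)).1 x)) =
      -(cPart F p (q + 2) (by omega)).1 ((barHtpy s (q + 2)).1 x) :=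
    eq_neg_of_add_eq_zero_left
      (congrArg (fun α : KK W N p (q + 2) => α.1 ((barHtpy s (q + 2)).1 x)) hD)
  -- Contracting lowers `q` by one, so the sign `(-1)^q` in `d_c` changes. This change supplies the
  -- minus sign produced by the cocycle equation.
  have h3 : (cPart (contract s F) p (q + 1) h).1 x =
      -(cPart F p (q + 2) (by omega)).1 ((barHtpy s (q + 2)).1 x) := by
    cases p with
    | zero => exact neg_zero.symm
    | succ p =>
      change (-1 : k) ^ (q + 1) • (cobarMap N (p + 1)).1 _ =
        -((-1 : k) ^ (q + 2) • (cobarMap N (p + 1)).1 _)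
      rw [pow_succ (-1 : k) (q + 1), mul_neg_one, neg_smul, neg_neg]
      rfl
  refine Eq.trans ?_ (h1.trans (congrArg (· + _) (h2.trans h3.symm))).symm
  exact add_comm _ _

variable [FiniteDimensional k A]

/-- The only possibly nonzero component `f` is killed by both differentials. The first condition
gives `f = (f s) μ`; the second lets the map `f s`, defined on the projective `P`, lift through the
cobar differential to some `l`. Then `l μ` is the required primitive. -/
theorem exists_D_eq_of_column [Module.Projective (AlgX k A) P.XMod] (s : HomA4 P (tensA P))
    (hs : compH (actMap P) s = HomA4.id P) {n : ℕ} (F : Cochain P N (n + 1))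
    (hF : D P N (n + 1) F = 0) (hv : ∀ p q h, F ⟨(p, q + 1), h⟩ = 0) :
    ∃ G, D P N n G = F := by
  have key : ∀ p (h : p + 1 + 0 = n + 1), ∃ l : HomA4 P (upow N (p + 1)),
      compH (compH (cobarMap N (p + 1)) l) (actMap P) = F ⟨(p + 1, 0), h⟩ := by
    intro p h
    set f : HomA4 (tensA P) (upow N (p + 2)) := F ⟨(p + 1, 0), h⟩ with hf
    -- The cocycle equation at `(p + 1, 1)`, where the component with `q = 1` contributes nothing.
    have h1 : ∀ x, f.1 ((barMap P 1).1 x) = 0 := fun x => by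
      have h2 : dh P N (p + 1) 0 f + dc P N p 1 (F ⟨(p, 1), by omega⟩) = 0 :=
        congrArg (fun G : Cochain P N (n + 2) => G ⟨(p + 1, 1), by omega⟩) hF
      rw [hv, map_zero, add_zero] at h2
      exact congrArg (fun α : KK P N (p + 1) 1 => α.1 x) h2
    have h2 : ∀ x, (cobarMap N (p + 2)).1 (f.1 x) = 0 := fun x => by
      have h3 : 0 + dc P N (p + 1) 0 f = 0 :=
        congrArg (fun G : Cochain P N (n + 2) => G ⟨(p + 2, 0), by omega⟩) hF
      have h4 : (-1 : k) ^ 0 • (cobarMap N (p + 2)).1 (f.1 x) = 0 :=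
        congrArg (fun α : KK P N (p + 2) 0 => α.1 x) ((zero_add _).symm.trans h3)
      rwa [pow_zero, one_smul] at h4
    -- Pointwise preimages come from the counit; projectivity of `P` assembles a morphism.
    obtain ⟨l, hl⟩ := exists_lift (cobarMap N (p + 1)) (compH f s) fun v =>
      ⟨_, cobarStep_exact (cobarMap N (p + 1)) _ (h2 (s.1 v))⟩
    refine ⟨l, homA4_ext fun x => ?_⟩
    rw [hl]
    -- Apply `f` to `x = λ t x + s μ x`; the first term dies by `h1`.
    have h5 := congrArg f.1 (barHtpy_spec s hs 0 x)
    exact ((zero_add _).symm.trans ((congrArg (· + _) (h1 _)).symm.trans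
      ((map_add f.1 _ _).symm.trans h5)))
  choose l hl using key
  obtain ⟨G, hG0, hG⟩ : ∃ G : Cochain P N n,
      (∀ p h, G ⟨(p, 0), h⟩ = compH (l p (by omega)) (actMap P)) ∧
        ∀ p q h, G ⟨(p, q + 1), h⟩ = 0 :=
    ⟨fun x => match x with
      | ⟨(p, 0), h⟩ => compH (l p (by omega)) (actMap P)
      | ⟨(_, _ + 1), _⟩ => 0, fun _ _ => rfl, fun _ _ _ => rfl⟩
  have hc : ∀ p q h, cPart G p (q + 1) h = 0 := fun p q h =>
    cPart_eq_zero G (q + 1) (fun p h => hG p q h) p h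
  refine ⟨G, cochain_ext fun p q h => ?_⟩
  rcases q with _ | _ | q
  · rcases p with _ | p
    · omega
    · rw [← hl p h]
      exact (zero_add _).trans ((congrArg (dc P N p 0) (hG0 p _)).trans
        (dc_comp_actMap p (l p (by omega))))
  -- At `q = 1` the `d_h` part is `l μ λ`, and consecutive bar differentials compose to zero.
  · refine (D_eq_zero G ?_ (hc p 0 h)).trans (hv p 0 h).symm
    refine (congrArg (dh P N p 0) (hG0 p _)).trans (homA4_ext fun x => ?_)
    change (l p _).1 ((actMap P).1 ((barMap P 1).1 x)) = 0
    have h1 : (actMap P).1 ((barMap P 1).1 x) = 0 := barMap_barMap 0 x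
    rw [h1, map_zero]
  · exact (D_eq_zero G (hPart_eq_zero G p (q + 1) h (hG p q (by omega))) (hc p (q + 1) h)).trans
      (hv p (q + 1) h).symm

/-- The cohomology of an `X`-projective Hopf bimodule vanishes in positive degrees. -/
theorem cls_eq_zero_of_projective [Module.Projective (AlgX k A) P.XMod] {n : ℕ}
    (c : Cocycle P N (n + 1)) : cls c = 0 := by
  -- The action `P ⊗ A → P` hits `v` at `v ⊗ 1`, so it splits over the projective `P` by a morphism
  -- of Hopf bimodules.
  obtain ⟨s, hs⟩ := exists_lift (actMap P) (HomA4.id P) fun v =>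
    ⟨(v ⊗ₜ[k] (1 : A) : P.V ⊗[k] A), by
      change P.ract (MulOpposite.op 1) v = v
      rw [MulOpposite.op_one, map_one]
      rfl⟩
  have hc : D P N (n + 1) c.1 = 0 := c.2
  obtain ⟨G, hG⟩ := exists_D_eq_of_column s hs (c.1 - D P N n (contract s c.1))
    (by rw [map_sub, D_D, hc, sub_zero])
    (fun p q h => sub_eq_zero.mpr (sub_D_contract s hs c.1 hc p q h).symm)
  rw [cls_eq_zero]
  exact ⟨G + contract s c.1, by rw [map_add, hG, sub_add_cancel]⟩

end Acyclic

end HopfBimod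

universe v w

namespace HopfBimod

/-! ### Effaceable `δ`-functors and dimension shifting -/

section UniversalDelta

variable {k A : Type u} [Field k] [Ring A] [HopfAlgebra k A]

/-- A contravariant `δ`-functor on Hopf bimodules whose positive degrees are effaced by the
`X`-projective Hopf bimodules. Only the part of the long exact sequence that determines the higher
degrees from the lower ones is recorded. -/
structure EffaceableDelta [FiniteDimensional k A] (H : HopfBimodule k A → ℕ → Type v)
    [∀ M n, AddCommGroup (H M n)] [∀ M n, Module k (H M n)] where
  /-- the map induced by a morphism -/
  pull : ∀ {M M' : HopfBimodule k A} (_ : HomA4 M M') (n : ℕ), H M' n →ₗ[k] H M n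
  /-- the connecting map of a short exact sequence -/
  conn : ∀ {M' M M'' : HopfBimodule k A} {i : HomA4 M' M} {p : HomA4 M M''}
    (_ : IsShortExact i p) (n : ℕ), H M' n →ₗ[k] H M'' (n + 1)
  pull_id : ∀ (M : HopfBimodule k A) (n : ℕ) (x : H M n), pull (HomA4.id M) n x = x
  conn_natural : ∀ {K P M K' P' M' : HopfBimodule k A} {i : HomA4 K P} {p : HomA4 P M}
    {i' : HomA4 K' P'} {p' : HomA4 P' M'} (h : IsShortExact i p) (h' : IsShortExact i' p')
    (f₁ : HomA4 K K') (f₂ : HomA4 P P') (f₃ : HomA4 M M'), compH i' f₁ = compH f₂ i →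
    compH p' f₂ = compH f₃ p → ∀ (n : ℕ) (x : H K' n),
      conn h n (pull f₁ n x) = pull f₃ (n + 1) (conn h' n x)
  conn_eq_zero_iff : ∀ {M' M M'' : HopfBimodule k A} {i : HomA4 M' M} {p : HomA4 M M''}
    (h : IsShortExact i p) (n : ℕ) (x : H M' n), conn h n x = 0 ↔ ∃ w, pull i n w = x
  conn_surjective : ∀ {M' M M'' : HopfBimodule k A} {i : HomA4 M' M} {p : HomA4 M M''}
    (h : IsShortExact i p) [Module.Projective (AlgX k A) M.XMod] (n : ℕ),
      Function.Surjective (conn h n)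

variable [FiniteDimensional k A]

/-- The universal property of the kernel. Working with `X`-linear maps makes the factor a morphism
without separate checks of actions and coactions. -/
theorem IsShortExact.exists_factor {M' M M'' W : HopfBimodule k A} {i : HomA4 M' M}
    {p : HomA4 M M''} (h : IsShortExact i p) (g : HomA4 W M) (hg : compH p g = 0) :
    ∃ l : HomA4 W M', compH i l = g := by
  let i' := HomA4.toLinear i
  have hr : ∀ v, HomA4.toLinear g v ∈ LinearMap.range i' := fun v =>
    (h.exact _).mp (congrArg (fun f : HomA4 W M'' => f.1 v) hg)
  let l : W.XMod →ₗ[AlgX k A] M'.XMod :=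
    (LinearEquiv.ofInjective i' h.inj).symm.toLinearMap ∘ₗ (HomA4.toLinear g).codRestrict _ hr
  refine ⟨homOfLinear l, homA4_ext fun v => ?_⟩
  exact congrArg Subtype.val ((LinearEquiv.ofInjective i' h.inj).apply_symm_apply ⟨_, hr v⟩)

/-- A morphism lifts to a morphism from an `X`-projective presentation to any presentation. -/
theorem IsShortExact.exists_lift {K P M K' P' M' : HopfBimodule k A} {i : HomA4 K P}
    {p : HomA4 P M} {i' : HomA4 K' P'} {p' : HomA4 P' M'} (h : IsShortExact i p)
    [Module.Projective (AlgX k A) P.XMod] (h' : IsShortExact i' p') (f : HomA4 M M') :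
    ∃ (f₁ : HomA4 K K') (f₂ : HomA4 P P'), compH i' f₁ = compH f₂ i ∧
      compH p' f₂ = compH f p := by
  obtain ⟨f₂, h2⟩ := HopfBimod.exists_lift p' (compH f p) fun v => h'.surj _
  obtain ⟨f₁, h1⟩ := h'.exists_factor (compH f₂ i) (by
    have h3 : compH p' (compH f₂ i) = compH (compH f p) i := by rw [← h2]; rfl
    rw [h3]
    exact h.comp_eq_zero f)
  exact ⟨f₁, f₂, h1, h2⟩

namespace EffaceableDelta

variable {H : HopfBimodule k A → ℕ → Type v} {H' : HopfBimodule k A → ℕ → Type w}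
  [∀ M n, AddCommGroup (H M n)] [∀ M n, Module k (H M n)]
  [∀ M n, AddCommGroup (H' M n)] [∀ M n, Module k (H' M n)]
  (T : EffaceableDelta H) (T' : EffaceableDelta H')

/-- A natural transformation in degree `n`. -/
def IsNatural (n : ℕ) (φ : ∀ M, H M n →ₗ[k] H' M n) : Prop :=
  ∀ {M M' : HopfBimodule k A} (f : HomA4 M M') (x : H M' n),
    φ M (T.pull f n x) = T'.pull f n (φ M' x)

/-- Compatibility with the connecting maps from degree `n` to degree `n + 1`. -/
def IsCompatible (n : ℕ) (φ : ∀ M, H M n →ₗ[k] H' M n)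
    (φ' : ∀ M, H M (n + 1) →ₗ[k] H' M (n + 1)) : Prop :=
  ∀ {M' M M'' : HopfBimodule k A} {i : HomA4 M' M} {p : HomA4 M M''} (h : IsShortExact i p)
    (x : H M' n), φ' M'' (T.conn h n x) = T'.conn h n (φ M' x)

variable {T T'}

/-- Degree `n + 1` at `M` is the quotient of degree `n` at `K` by the image of degree `n` at `P`.
Naturality for `K → P` sends that image into the corresponding one for `H'`, so the map passes to
the quotient. -/
theorem exists_linearMap_succ {n : ℕ} {φ : ∀ M, H M n →ₗ[k] H' M n} (hφ : IsNatural T T' n φ)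
    {K P M : HopfBimodule k A} {i : HomA4 K P} {p : HomA4 P M} (h : IsShortExact i p)
    [Module.Projective (AlgX k A) P.XMod] :
    ∃ f : H M (n + 1) →ₗ[k] H' M (n + 1), ∀ x, f (T.conn h n x) = T'.conn h n (φ K x) := by
  obtain ⟨s, hs⟩ := (T.conn h n).exists_rightInverse_of_surjective
    (LinearMap.range_eq_top.mpr (T.conn_surjective h n))
  refine ⟨T'.conn h n ∘ₗ φ K ∘ₗ s, fun x => ?_⟩
  -- The section `s` is an arbitrary linear one; its ambiguity lies in the image of degree `n` at
  -- `P`, which the connecting map of `H'` kills after `φ`.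
  have h1 : T.conn h n (s (T.conn h n x) - x) = 0 := by
    rw [map_sub, ← LinearMap.comp_apply (T.conn h n) s, hs, LinearMap.id_apply, sub_self]
  obtain ⟨w, hw⟩ := (T.conn_eq_zero_iff h n _).mp h1
  have h2 : T'.conn h n (φ K (s (T.conn h n x) - x)) = 0 :=
    (T'.conn_eq_zero_iff h n _).mpr ⟨φ P w, by rw [← hw, hφ]⟩
  rw [map_sub, map_sub, sub_eq_zero] at h2
  exact h2

/-- One projective presentation is chosen for each `M`. Presentations map to one another over any
morphism, and both connecting maps are natural, so the resulting family is independent of the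
choices. -/
theorem exists_succ {n : ℕ} {φ : ∀ M, H M n →ₗ[k] H' M n} (hφ : IsNatural T T' n φ) :
    ∃ φ' : ∀ M, H M (n + 1) →ₗ[k] H' M (n + 1),
      IsNatural T T' (n + 1) φ' ∧ IsCompatible T T' n φ φ' := by
  choose K P i p h hP using fun M : HopfBimodule k A => exists_projective_presentation M
  choose φ' hφ' using fun M => exists_linearMap_succ hφ (h M)
  refine ⟨φ', fun {M M'} f y => ?_, fun {M' M M''} i' p' h' x => ?_⟩
  · obtain ⟨x, rfl⟩ := T.conn_surjective (h M') n y
    obtain ⟨f₁, f₂, h1, h2⟩ := (h M).exists_lift (h M') f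
    rw [hφ', ← T.conn_natural (h M) (h M') f₁ f₂ f h1 h2, hφ', hφ,
      T'.conn_natural (h M) (h M') f₁ f₂ f h1 h2]
  -- An arbitrary short exact sequence ending in `M''` receives a map from the chosen presentation
  -- over the identity of `M''`; this reduces its connecting map to the chosen one.
  · obtain ⟨f₁, f₂, h1, h2⟩ := (h M'').exists_lift h' (HomA4.id M'')
    have h3 := T.conn_natural (h M'') h' f₁ f₂ _ h1 h2 n x
    have h4 := T'.conn_natural (h M'') h' f₁ f₂ _ h1 h2 n (φ M' x)
    rw [T.pull_id] at h3
    rw [T'.pull_id] at h4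
    rw [← h3, ← h4, hφ', hφ]

/-- A natural transformation in degree zero extends to a map of `δ`-functors. -/
theorem exists_extension (φ₀ : ∀ M, H M 0 →ₗ[k] H' M 0) (h₀ : IsNatural T T' 0 φ₀) :
    ∃ φ : ∀ n M, H M n →ₗ[k] H' M n, φ 0 = φ₀ ∧ (∀ n, IsNatural T T' n (φ n)) ∧
      ∀ n, IsCompatible T T' n (φ n) (φ (n + 1)) := by
  choose s hs hs' using fun (n : ℕ) (φ : {φ : ∀ M, H M n →ₗ[k] H' M n // IsNatural T T' n φ}) =>
    exists_succ φ.2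
  -- The recursion carries naturality along, because the step to the next degree requires it.
  let φ : ∀ n, {φ : ∀ M, H M n →ₗ[k] H' M n // IsNatural T T' n φ} := fun n =>
    Nat.rec ⟨φ₀, h₀⟩ (fun n φ => ⟨s n φ, hs n φ⟩) n
  exact ⟨fun n => (φ n).1, rfl, fun n => (φ n).2, fun n => hs' n (φ n)⟩

/-- A four lemma argument on a projective presentation. Injectivity in degree `n + 1` uses
surjectivity at `P` and injectivity at `K`; surjectivity uses surjectivity at `K`. -/
theorem bijective_succ {n : ℕ} {φ : ∀ M, H M n →ₗ[k] H' M n}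
    {φ' : ∀ M, H M (n + 1) →ₗ[k] H' M (n + 1)} (hφ : IsNatural T T' n φ)
    (hφ' : IsCompatible T T' n φ φ') (hb : ∀ M, Function.Bijective (φ M)) (M) :
    Function.Bijective (φ' M) := by
  obtain ⟨K, P, i, p, h, hP⟩ := exists_projective_presentation M
  constructor
  · rw [injective_iff_map_eq_zero]
    intro y hy
    obtain ⟨x, rfl⟩ := T.conn_surjective h n y
    rw [hφ', T'.conn_eq_zero_iff] at hy
    obtain ⟨w, hw⟩ := hy
    obtain ⟨w, rfl⟩ := (hb P).2 w
    rw [← hφ] at hw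
    exact (T.conn_eq_zero_iff h n x).mpr ⟨w, (hb K).1 hw⟩
  · intro y
    obtain ⟨x, rfl⟩ := T'.conn_surjective h n y
    obtain ⟨x, rfl⟩ := (hb K).2 x
    exact ⟨_, hφ' h x⟩

theorem bijective {φ : ∀ n M, H M n →ₗ[k] H' M n} (hφ : ∀ n, IsNatural T T' n (φ n))
    (hφ' : ∀ n, IsCompatible T T' n (φ n) (φ (n + 1))) (hb : ∀ M, Function.Bijective (φ 0 M))
    (n : ℕ) : ∀ M, Function.Bijective (φ n M) := by
  induction n with
  | zero => exact hb
  | succ n ih => exact bijective_succ (hφ n) (hφ' n) ih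

/-- A map of `δ`-functors is determined by its degree zero part. -/
theorem eq_of_isCompatible {φ ψ : ∀ n M, H M n →ₗ[k] H' M n}
    (hφ : ∀ n, IsCompatible T T' n (φ n) (φ (n + 1)))
    (hψ : ∀ n, IsCompatible T T' n (ψ n) (ψ (n + 1))) (h₀ : ∀ M, φ 0 M = ψ 0 M)
    (n : ℕ) : ∀ M, φ n M = ψ n M := by
  induction n with
  | zero => exact h₀
  | succ n ih =>
    intro M
    obtain ⟨K, P, i, p, h, hP⟩ := exists_projective_presentation M
    refine LinearMap.ext fun y => ?_
    obtain ⟨x, rfl⟩ := T.conn_surjective h n y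
    rw [hφ n h, hψ n h, ih]

end EffaceableDelta

end UniversalDelta

end HopfBimod

namespace HopfBimod

/-! ### The `δ`-functors `Ext_X^*(-, N)` and `H_{A4}^*(-, N)` -/

section Instances

variable {k A : Type u} [Field k] [Ring A] [HopfAlgebra k A] [FiniteDimensional k A]
  {M' M M'' : HopfBimodule k A} {i : HomA4 M' M} {p : HomA4 M M''}

theorem toXMap_comp {L : HopfBimodule k A} (g : HomA4 M L) (f : HomA4 M' M) :
    toXMap f ≫ toXMap g = toXMap (compH g f) := rfl

theorem toXMap_id : toXMap (HomA4.id M) = 𝟙 (toX M) := rfl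

instance [Module.Projective (AlgX k A) M.XMod] : Projective (toX M) :=
  (IsProjective.iff_projective M.XMod).mp inferInstance

theorem extClass_natural {K P L K' P' L' : HopfBimodule k A} {i : HomA4 K P} {p : HomA4 P L}
    {i' : HomA4 K' P'} {p' : HomA4 P' L'} (h : IsShortExact i p) (h' : IsShortExact i' p')
    (f₁ : HomA4 K K') (f₂ : HomA4 P P') (f₃ : HomA4 L L') (h1 : compH i' f₁ = compH f₂ i)
    (h2 : compH p' f₂ = compH f₃ p) :
    h.extClass.comp (Ext.mk₀ (toXMap f₁)) (add_zero 1) =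
      (Ext.mk₀ (toXMap f₃)).comp h'.extClass (zero_add 1) :=
  ShortComplex.ShortExact.extClass_naturality h.shortExact h'.shortExact
    { τ₁ := toXMap f₁
      τ₂ := toXMap f₂
      τ₃ := toXMap f₃
      comm₁₂ := congrArg toXMap h1
      comm₂₃ := congrArg toXMap h2 }

/-- The `δ`-functor `Ext_X^*(-, N)`. -/
noncomputable def extDelta (N : HopfBimodule k A) :
    EffaceableDelta fun (M : HopfBimodule k A) n => Ext (toX M) (toX N) n where
  pull f n := Ext.precompOfLinear (Ext.mk₀ (toXMap f)) k (toX N) (zero_add n)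
  conn h n := Ext.precompOfLinear h.extClass k (toX N) (add_comm 1 n)
  pull_id M n x := by
    change (Ext.mk₀ (toXMap (HomA4.id M))).comp x (zero_add n) = x
    rw [toXMap_id, Ext.mk₀_id_comp]
  conn_natural h h' f₁ f₂ f₃ h1 h2 n x := by
    change h.extClass.comp ((Ext.mk₀ (toXMap f₁)).comp x (zero_add n)) (add_comm 1 n) =
      (Ext.mk₀ (toXMap f₃)).comp (h'.extClass.comp x (add_comm 1 n)) (zero_add (n + 1))
    rw [← Ext.comp_assoc_of_second_deg_zero, extClass_natural h h' f₁ f₂ f₃ h1 h2,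
      Ext.comp_assoc (Ext.mk₀ (toXMap f₃)) h'.extClass x (zero_add 1) (add_comm 1 n) (by omega)]
  conn_eq_zero_iff h n x := by
    constructor
    · intro hx
      exact Ext.contravariant_sequence_exact₁ h.shortExact (toX N) x (add_comm 1 n) hx
    · rintro ⟨w, rfl⟩
      exact h.shortExact.extClass_comp_assoc w (h := add_comm 1 n)
  conn_surjective {_ M _ _ _} h _ n y := by
    have : Projective h.toX.X₂ := inferInstanceAs (Projective (toX M))
    -- The pullback of `y` to the projective middle term vanishes in positive degree, so the long
    -- exact sequence puts `y` in the image of the connecting map.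
    obtain ⟨x, hx⟩ := Ext.contravariant_sequence_exact₃ h.shortExact (toX N) y
      (Ext.eq_zero_of_projective _) (add_comm 1 n)
    exact ⟨x, hx⟩

section Coh

variable {N : HopfBimodule k A}

/-- The representatives `s` and the partners `t` are chosen without any linearity. The map becomes
linear on classes because connecting pairs add and scale, and the class of the partner depends only
on the class of the representative. -/
theorem exists_connecting (h : IsShortExact i p) (n : ℕ) : ∃ f : HA4 M' N n →ₗ[k] HA4 M'' N (n + 1),
    ∀ z c, IsConnecting i p z c → f (cls z) = cls c := by
  choose s hs using cls_surjective (M := M') (N := N) n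
  choose t ht using fun z : Cocycle M' N n => h.exists_isConnecting z
  have key : ∀ z c, IsConnecting i p z c → cls (t (s (cls z))) = cls c := fun z c hc =>
    cls_eq_cls_of_isConnecting h (ht _) hc (hs _)
  refine ⟨⟨⟨fun x => cls (t (s x)), fun x y => ?_⟩, fun r x => ?_⟩, key⟩
  · have h1 := key _ _ ((ht (s x)).add (ht (s y)))
    rw [map_add, map_add, hs, hs] at h1
    exact h1
  · have h1 := key _ _ ((ht (s x)).smul r)
    rw [map_smul, map_smul, hs] at h1
    exact h1

/-- The connecting map of a short exact sequence. -/
noncomputable def connH (h : IsShortExact i p) (n : ℕ) : HA4 M' N n →ₗ[k] HA4 M'' N (n + 1) :=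
  (exists_connecting h n).choose

theorem connH_cls (h : IsShortExact i p) {n : ℕ} {z : Cocycle M' N n}
    {c : Cocycle M'' N (n + 1)} (hc : IsConnecting i p z c) : connH h n (cls z) = cls c :=
  (exists_connecting h n).choose_spec z c hc

theorem pullC_compH {L : HopfBimodule k A} (g : HomA4 M L) (f : HomA4 M' M) (n : ℕ)
    (F : Cochain L N n) : pullC N f n (pullC N g n F) = pullC N (compH g f) n F := by
  have h1 : ∀ q, compH (tpowMap g q) (tpowMap f q) = tpowMap (compH g f) q := fun q => by
    induction q with
    | zero => rfl
    | succ q ih =>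
      refine Eq.trans ?_ (congrArg tensAMap ih)
      exact homA4_ext fun x => tensAMap_comp _ _ x
  refine cochain_ext fun p q h => ?_
  change compH (F ⟨(p, q), h⟩) (compH (tpowMap g (q + 1)) (tpowMap f (q + 1))) =
    compH (F ⟨(p, q), h⟩) (tpowMap (compH g f) (q + 1))
  rw [h1]

theorem pullC_id (n : ℕ) (F : Cochain M N n) : pullC N (HomA4.id M) n F = F := by
  have h1 : ∀ q, tpowMap (HomA4.id M) q = HomA4.id (tpow M q) := fun q => by
    induction q with
    | zero => rfl
    | succ q ih =>
      rw [tpowMap, ih]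
      exact tensAMap_id
  refine cochain_ext fun p q h => ?_
  change compH (F ⟨(p, q), h⟩) (tpowMap (HomA4.id M) (q + 1)) = F ⟨(p, q), h⟩
  rw [h1]
  rfl

theorem pullH_cls (f : HomA4 M' M) (n : ℕ) (z : Cocycle M N n) :
    pullH N f n (cls z) = cls (pullZ N f n z) := rfl

/-- The pullback along `f₂` of the witnessing cochain is again a witness, by functoriality of
`pullC`. -/
theorem IsConnecting.pull {K P L K' P' L' : HopfBimodule k A} {i : HomA4 K P} {p : HomA4 P L}
    {i' : HomA4 K' P'} {p' : HomA4 P' L'} (f₁ : HomA4 K K') (f₂ : HomA4 P P') (f₃ : HomA4 L L')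
    (h1 : compH i' f₁ = compH f₂ i) (h2 : compH p' f₂ = compH f₃ p) {n : ℕ} {z : Cocycle K' N n}
    {c : Cocycle L' N (n + 1)} (h : IsConnecting i' p' z c) :
    IsConnecting i p (pullZ N f₁ n z) (pullZ N f₃ (n + 1) c) := by
  obtain ⟨g, hg, hg'⟩ := h
  refine ⟨pullC N f₂ n g, ?_, ?_⟩
  · rw [pullC_compH, ← h1, ← pullC_compH, hg]
    rfl
  · rw [← pullC_D, hg', pullC_compH, h2, ← pullC_compH]
    rfl

/-- Exactness of the long exact sequence at `H^n(M', N)`. -/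
theorem connH_eq_zero_iff (h : IsShortExact i p) (n : ℕ) (x : HA4 M' N n) :
    connH h n x = 0 ↔ ∃ w, pullH N i n w = x := by
  constructor
  · obtain ⟨z, rfl⟩ := cls_surjective n x
    obtain ⟨c, hc⟩ := h.exists_isConnecting z
    rw [connH_cls h hc, cls_eq_zero]
    rintro ⟨e, he⟩
    obtain ⟨g, h1, h2⟩ := hc
    -- If `c = D e`, then `g - p^* e` is a cocycle on `M`, and it still restricts to `z` because
    -- `i^* p^* = 0`.
    refine ⟨cls ⟨g - pullC N p n e, LinearMap.mem_ker.mpr ?_⟩, ?_⟩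
    · rw [map_sub, h2, ← pullC_D, he, sub_self]
    · rw [pullH_cls]
      refine congrArg cls (Subtype.ext ?_)
      change pullC N i n (g - pullC N p n e) = z.1
      rw [map_sub, h.pullC_pullC, sub_zero, h1]
  · rintro ⟨w, rfl⟩
    obtain ⟨z, rfl⟩ := cls_surjective n w
    -- A cocycle on `M` is itself a lift of its restriction; its differential is zero, so the
    -- connecting partner can be taken to be `0`.
    rw [pullH_cls, connH_cls h (c := 0) ⟨z.1, rfl, ?_⟩, map_zero]
    exact (LinearMap.mem_ker.mp z.2).trans (map_zero (pullC N p (n + 1))).symm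

/-- Exactness at `H^{n+1}(M'', N)`: a cochain `g` on `M` that bounds `p^* c` witnesses that `c` is
the connecting partner of `i^* g`. -/
theorem exists_connH_eq (h : IsShortExact i p) (n : ℕ) (y : HA4 M'' N (n + 1))
    (hy : pullH N p (n + 1) y = 0) : ∃ x, connH h n x = y := by
  obtain ⟨c, rfl⟩ := cls_surjective (n + 1) y
  rw [pullH_cls, cls_eq_zero] at hy
  obtain ⟨g, hg⟩ := hy
  refine ⟨cls ⟨pullC N i n g, LinearMap.mem_ker.mpr ?_⟩, connH_cls h ⟨g, rfl, hg⟩⟩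
  rw [← pullC_D, hg]
  exact h.pullC_pullC (n + 1) c.1

end Coh

/-- The `δ`-functor `H_{A4}^*(-, N)`. -/
noncomputable def cohDelta (N : HopfBimodule k A) :
    EffaceableDelta fun (M : HopfBimodule k A) n => HA4 M N n where
  pull f n := pullH N f n
  conn h n := connH h n
  pull_id M n x := by
    obtain ⟨z, rfl⟩ := cls_surjective n x
    exact congrArg cls (Subtype.ext (pullC_id n z.1))
  conn_natural h h' f₁ f₂ f₃ h1 h2 n x := by
    obtain ⟨z, rfl⟩ := cls_surjective n x
    obtain ⟨c, hc⟩ := h'.exists_isConnecting z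
    rw [connH_cls h' hc, pullH_cls, pullH_cls]
    exact connH_cls h (hc.pull f₁ f₂ f₃ h1 h2)
  conn_eq_zero_iff h n x := connH_eq_zero_iff h n x
  conn_surjective h _ n y := exists_connH_eq h n y (by
    obtain ⟨c, hc⟩ := cls_surjective (n + 1) (pullH N _ (n + 1) y)
    rw [← hc, cls_eq_zero_of_projective])

end Instances

end HopfBimod

namespace HopfBimod

/-! ### Degree zero cohomology and morphisms of Hopf bimodules -/

section DegreeZero

variable {k A : Type u} [Field k] [Ring A] [HopfAlgebra k A] [FiniteDimensional k A]
  {M M' N W Z : HopfBimodule k A}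

/-- The unit and counit axioms undo the action and the coaction, so `flat` recovers `β` from its
cochain. -/
theorem flat_unit (β : HomA4 W Z) : flat (compH (compH (coactMap Z) β) (actMap W)) = β.1 :=
  LinearMap.ext fun w => by
    change counitLin A Z.V (Z.δL (β.1 (W.ract (MulOpposite.op 1) w))) = β.1 w
    rw [counitLin_δL, MulOpposite.op_one, map_one, Module.End.one_apply]

theorem cochain_zero_ext {F G : Cochain M N 0} (h : F ⟨(0, 0), rfl⟩ = G ⟨(0, 0), rfl⟩) : F = G :=
  cochain_ext fun p q hpq => by
    obtain rfl : p = 0 := by omega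
    obtain rfl : q = 0 := by omega
    exact h

variable (M N) in
/-- The map `β ↦ [δ_L ∘ β ∘ μ_R]` from `Hom_{A4}(M, N)` to the cohomology of degree zero. -/
noncomputable def unitH : HomA4 M N →ₗ[k] HA4 M N 0 where
  toFun β := cls (unitCocycle β)
  map_add' β γ := by
    rw [← map_add]
    refine congrArg cls (Subtype.ext (cochain_zero_ext (homA4_ext fun x => ?_)))
    exact map_add (coactMap N).1 (β.1 ((actMap M).1 x)) (γ.1 ((actMap M).1 x))
  map_smul' r β := by
    rw [RingHom.id_apply, ← map_smul]
    refine congrArg cls (Subtype.ext (cochain_zero_ext (homA4_ext fun x => ?_)))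
    exact map_smul (coactMap N).1 r (β.1 ((actMap M).1 x))

theorem unitH_apply (β : HomA4 M N) : unitH M N β = cls (unitCocycle β) := rfl

/-- There are no nonzero coboundaries in degree zero, so equal classes have equal cochains, and
`flat_unit` applies. -/
theorem unitH_injective : Function.Injective (unitH M N) := by
  intro β γ h
  have h1 : (unitCocycle β).1 - (unitCocycle γ).1 = 0 := by
    rw [unitH_apply, unitH_apply, ← sub_eq_zero, ← map_sub, cls_eq_zero] at h
    exact h
  have h2 : compH (compH (coactMap N) β) (actMap M) = compH (compH (coactMap N) γ) (actMap M) :=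
    congrArg (fun F : Cochain M N 0 => F ⟨(0, 0), rfl⟩) (sub_eq_zero.mp h1)
  have h3 := congrArg flat h2
  rw [flat_unit, flat_unit] at h3
  exact homA4_ext fun v => LinearMap.congr_fun h3 v

/-- Through `flat`, the horizontal differential becomes the failure of right linearity. It vanishes
on cocycles of degree zero, and for an extension it yields the entry `f₀`. -/
theorem flat_comp_barStep (α : HomA4 (tensA W) (aTens Z)) (w : W.V) (a : A) :
    flat (compH α (barStep ((-1) ^ 1) (actMap W))) (w ⊗ₜ[k] a : W.V ⊗[k] A) =
      flat α (W.ract (MulOpposite.op a) w) - Z.ract (MulOpposite.op a) (flat α w) := by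
  let g : W.V ⊗[k] A →ₗ[k] A ⊗[k] Z.V := α.1
  have h1 : flat (compH α (barStep ((-1) ^ 1) (actMap W))) (w ⊗ₜ[k] a : W.V ⊗[k] A) =
    counitLin A Z.V
      (g (W.ract (MulOpposite.op a) w ⊗ₜ[k] (1 : A) + (-1 : k) ^ 1 • (w ⊗ₜ[k] (a * 1)))) := rfl
  have h2 : ∀ b w, counitLin A Z.V (g (w ⊗ₜ[k] b)) = Z.ract (MulOpposite.op b) (flat α w) :=
    fun b w => flat_ract α b w
  rw [h1, pow_one, neg_one_smul, ← sub_eq_add_neg, map_sub, map_sub, mul_one, h2, h2,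
    MulOpposite.op_one, map_one, Module.End.one_apply]

/-- The counterpart for the vertical differential: it becomes the failure of left colinearity, and
for an extension it yields the entry `f₁`. -/
theorem flat_cobarStep_comp (α : HomA4 (tensA W) (aTens Z)) (w : W.V) :
    flat (compH (cobarStep (coactMap Z)) α) w =
      ((flat α).lTensor A (W.δL w) - Z.δL (flat α w) : A ⊗[k] Z.V) := by
  rw [← flat_one, flat_apply, flat_apply]
  let t : A ⊗[k] Z.V := α.1 (w ⊗ₜ[k] (1 : A) : W.V ⊗[k] A)
  have h1 : (cobarStep (coactMap Z)).1 (α.1 (w ⊗ₜ[k] (1 : A) : W.V ⊗[k] A)) =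
    (TensorProduct.assoc k A A Z.V (comul.rTensor Z.V t) -
      Z.δL.lTensor A t : A ⊗[k] (A ⊗[k] Z.V)) := rfl
  have h2 : counitLin A (A ⊗[k] Z.V) (TensorProduct.assoc k A A Z.V (comul.rTensor Z.V t) -
      Z.δL.lTensor A t) = t - Z.δL (counitLin A Z.V t) := by
    rw [map_sub, counitLin_comul, counitLin_nat]
  exact (congrArg (counitLin A (A ⊗[k] Z.V)) h1).trans h2

theorem flat_zero : flat (0 : HomA4 (tensA W) (aTens Z)) = 0 :=
  LinearMap.ext fun _ => map_zero (counitLin (k := k) A Z.V)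

theorem dc_zero_zero (α : HomA4 (tensA M) (aTens N)) :
    dc M N 0 0 α = compH (cobarStep (coactMap N)) α :=
  homA4_ext fun x => by
    change (-1 : k) ^ 0 • (cobarStep (coactMap N)).1 (α.1 x) = (cobarStep (coactMap N)).1 (α.1 x)
    rw [pow_zero]
    exact one_smul k _

/-- The map `flat α` is always left linear and right colinear; the two components of the cocycle
equation add right linearity and left colinearity, so it is a morphism. By `flat_injective` it gives
back `z`. -/
theorem exists_unitCocycle_eq (z : Cocycle M N 0) : ∃ β, unitCocycle β = z := by
  let α : HomA4 (tensA M) (aTens N) := z.1 ⟨(0, 0), rfl⟩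
  have h1 : compH α (barStep ((-1) ^ 1) (actMap M)) = 0 := (add_zero _).symm.trans
    (congrArg (fun F : Cochain M N 1 => F ⟨(0, 1), rfl⟩) (LinearMap.mem_ker.mp z.2))
  have h2 : dc M N 0 0 α = 0 := (zero_add _).symm.trans
    (congrArg (fun F : Cochain M N 1 => F ⟨(1, 0), rfl⟩) (LinearMap.mem_ker.mp z.2))
  have h3 : ∀ b w, flat α (M.ract b w) = N.ract b (flat α w) := fun b w => by
    have h4 := flat_comp_barStep α w b.unop
    rw [h1, MulOpposite.op_unop, flat_zero] at h4
    exact sub_eq_zero.mp h4.symm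
  have h5 : ∀ w, N.δL (flat α w) = (flat α).lTensor A (M.δL w) := fun w => by
    have h6 := flat_cobarStep_comp α w
    rw [← dc_zero_zero, h2] at h6
    exact (sub_eq_zero.mp (h6.symm.trans (LinearMap.congr_fun flat_zero w))).symm
  refine ⟨⟨flat α, flat_lact α, h3, h5, flat_δR α⟩, Subtype.ext (cochain_zero_ext ?_)⟩
  exact flat_injective (flat_unit _)

variable (M N) in
/-- The cohomology of degree zero is `Hom_{A4}(M, N)`. -/
noncomputable def unitEquiv : HomA4 M N ≃ₗ[k] HA4 M N 0 :=
  LinearEquiv.ofBijective (unitH M N) ⟨unitH_injective, fun x => by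
    obtain ⟨z, rfl⟩ := cls_surjective 0 x
    obtain ⟨β, rfl⟩ := exists_unitCocycle_eq z
    exact ⟨β, rfl⟩⟩

/-- Naturality of the right action moves `f ⊗ 1` past `μ_R`, where it composes with `β`. -/
theorem pullH_unitEquiv (f : HomA4 M M') (β : HomA4 M' N) :
    pullH N f 0 (unitEquiv M' N β) = unitEquiv M N (compH β f) := by
  refine congrArg cls (Subtype.ext (cochain_zero_ext (homA4_ext fun x => ?_)))
  exact congrArg (fun y => (coactMap N).1 (β.1 y)) (actMap_nat f x)

variable (M N) in
/-- Morphisms of Hopf bimodules are morphisms of `X`-modules. -/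
noncomputable def toXEquiv : HomA4 M N ≃ₗ[k] (toX M ⟶ toX N) where
  toFun := toXMap
  map_add' _ _ := rfl
  map_smul' r f := ModuleCat.hom_ext (LinearMap.ext fun v => (xRep_algebraMap N r (f.1 v)).symm)
  invFun g := homOfLinear g.hom
  left_inv _ := rfl
  right_inv _ := rfl

variable (M N) in
/-- The comparison of the two `δ`-functors in degree zero. -/
noncomputable def comparisonZero : HA4 M N 0 ≃ₗ[k] Ext (toX M) (toX N) 0 :=
  (unitEquiv M N).symm ≪≫ₗ toXEquiv M N ≪≫ₗ Ext.linearEquiv₀.symm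

theorem comparisonZero_unitEquiv (β : HomA4 M N) :
    comparisonZero M N (unitEquiv M N β) = Ext.mk₀ (toXMap β) := by
  simp only [comparisonZero, LinearEquiv.trans_apply, LinearEquiv.symm_apply_apply]
  rfl

theorem comparisonZero_natural (f : HomA4 M M') (x : HA4 M' N 0) :
    comparisonZero M N (pullH N f 0 x) =
      (Ext.mk₀ (toXMap f)).comp (comparisonZero M' N x) (zero_add 0) := by
  obtain ⟨β, rfl⟩ := (unitEquiv M' N).surjective x
  rw [pullH_unitEquiv, comparisonZero_unitEquiv, comparisonZero_unitEquiv, Ext.mk₀_comp_mk₀,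
    toXMap_comp]

end DegreeZero

/-! ### The extension given by a `1`-cocycle -/

section CocycleExtension

variable {k A : Type u} [Field k] [Ring A] [HopfAlgebra k A] [FiniteDimensional k A]
  {M N : HopfBimodule k A}

namespace ExtData

variable (f : ExtData M N)

/-- The left action and the right coaction of `N ⊕ M` are those of the direct sum, so the linear
projection respects them. The entries `f₀` and `f₁` are what may prevent it from being a morphism of
Hopf bimodules. -/
theorem isLR_fst : IsLR (W := f.total) (Z := N) (LinearMap.fst k N.V M.V) where
  map_lact _ _ := rfl
  map_δR := ext_ικ (F := N.δR ∘ₗ LinearMap.fst k N.V M.V)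
    (G := (LinearMap.fst k N.V M.V).rTensor A ∘ₗ δRE M N)
    (fun n => by
      rw [LinearMap.comp_apply, LinearMap.comp_apply, δRE_ι,
        rTensor_congr (h := LinearMap.id) (fun _ => rfl)]
      simp)
    (fun m => by
      rw [LinearMap.comp_apply, LinearMap.comp_apply, δRE_κ, rTensor_congr (h := 0) (fun _ => rfl)]
      simp)

/-- The morphism `(N ⊕ M) ⊗ A → A ⊗ N` that corresponds to the projection `N ⊕ M → N`. -/
noncomputable def sharpFst : HomA4 (tensA f.total) (aTens N) := sharp _ f.isLR_fst

theorem fst_lTensor_δLE (v : N.V × M.V) :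
    (LinearMap.fst k N.V M.V).lTensor A (f.δLE v) = N.δL v.1 + f.f₁ v.2 :=
  ext_ικ (F := (LinearMap.fst k N.V M.V).lTensor A ∘ₗ f.δLE)
    (G := N.δL.coprod f.f₁)
    (fun n => by
      rw [LinearMap.comp_apply, δLE_ι, lTensor_congr (h := LinearMap.id) (fun _ => rfl)]
      simp)
    (fun m => by
      rw [LinearMap.comp_apply, δLE_κ, map_add, lTensor_congr (h := LinearMap.id) (fun _ => rfl),
        lTensor_congr (h := 0) (fun _ => rfl)]
      simp) v

end ExtData

/-- The class of a `1`-cocycle is the image of the identity of `N` under the connecting map of the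
extension given by the cocycle. -/
theorem isConnecting_cocycleExtData (F : Cocycle M N 1) :
    IsConnecting (cocycleExtData F).incl (cocycleExtData F).proj (unitCocycle (HomA4.id N)) F := by
  let E := cocycleExtData F
  -- The witness is the `0`-cochain of the linear projection onto `N`; it extends the cocycle of the
  -- identity of `N`. The values at other indices are irrelevant, as `(0, 0)` is the only index of
  -- total degree zero.
  obtain ⟨g, hg⟩ : ∃ g : Cochain E.total N 0, ∀ h, g ⟨(0, 0), h⟩ = E.sharpFst :=
    ⟨fun x => match x with
      | ⟨(0, 0), _⟩ => E.sharpFst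
      | ⟨(_ + 1, _), _⟩ => 0
      | ⟨(0, _ + 1), _⟩ => 0, fun _ => rfl⟩
  have hf : flat E.sharpFst = LinearMap.fst k N.V M.V := flat_sharp _ E.isLR_fst
  -- By `flat_comp_barStep` the left side is `(n a + f₀(m ⊗ a)) - n a` at `(n, m) ⊗ a`; the
  -- remaining `f₀` is the `flat` of the component `F₀`.
  have h0 : compH E.sharpFst (barStep ((-1) ^ 1) (actMap E.total)) =
      compH (comp₀ F) (tensAMap (tensAMap E.proj)) := by
    refine flat_injective (LinearMap.ext fun x => ?_)
    refine tensA_ext (flat (compH E.sharpFst (barStep ((-1) ^ 1) (actMap E.total))))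
      (flat (comp₀ F) ∘ₗ (tensAMap E.proj).1) (fun e a => ?_) x
    refine (flat_comp_barStep E.sharpFst e a).trans ?_
    rw [hf]
    exact add_sub_cancel_left (N.ract (MulOpposite.op a) e.1) (E.f₀ (e.2 ⊗ₜ a))
  -- By `flat_cobarStep_comp` the left side is `(δ_L n + f₁ m) - δ_L n` at `(n, m)`, and `f₁` is the
  -- `flat` of the component `F₁`.
  have h1 : compH (cobarStep (coactMap N)) E.sharpFst = compH (comp₁ F) (tensAMap E.proj) := by
    refine flat_injective (LinearMap.ext fun e => ?_)
    refine (flat_cobarStep_comp E.sharpFst e).trans ?_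
    rw [hf]
    refine (congrArg (· - N.δL e.1) (E.fst_lTensor_δLE e)).trans ?_
    exact add_sub_cancel_left (N.δL e.1) (E.f₁ e.2)
  refine ⟨g, cochain_zero_ext ?_, cochain_ext fun p q h => ?_⟩
  · change compH (g ⟨(0, 0), rfl⟩) (tensAMap E.incl) =
      compH (compH (coactMap N) (HomA4.id N)) (actMap N)
    rw [hg]
    refine flat_injective ?_
    refine Eq.trans ?_ (flat_unit (HomA4.id N)).symm
    -- The projection restricted to `N` is the identity, whose cochain is `unitCocycle (HomA4.id
    -- N)`.
    exact congrArg (fun π : N.V × M.V →ₗ[k] N.V => π ∘ₗ E.incl.1) hf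
  · obtain ⟨rfl, rfl⟩ | ⟨rfl, rfl⟩ : p = 0 ∧ q = 1 ∨ p = 1 ∧ q = 0 := by omega
    · refine (add_zero _).trans ((congrArg (dh E.total N 0 0) (hg rfl)).trans ?_)
      exact h0
    · refine (zero_add _).trans ((congrArg (dc E.total N 0 0) (hg rfl)).trans ?_)
      exact (dc_zero_zero _).trans h1

end CocycleExtension

end HopfBimod

namespace HopfBimod

/-! ### The isomorphism of `δ`-functors -/

section Comparison

variable {k A : Type u} [Field k] [Ring A] [HopfAlgebra k A] [FiniteDimensional k A]
  {N : HopfBimodule k A}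

open EffaceableDelta

/-- Passes from the relational form of compatibility, stated with cocycles, to the map `connH`, as
the dimension shifting lemmas require. -/
theorem IsDeltaMap.isCompatible
    {φ : ∀ (M : HopfBimodule k A) (n : ℕ), HA4 M N n →ₗ[k] Ext (toX M) (toX N) n}
    (hφ : IsDeltaMap N φ) (n : ℕ) : IsCompatible (cohDelta N) (extDelta N) n
      (fun M => φ M n) (fun M => φ M (n + 1)) := by
  intro M' M M'' i p h x
  obtain ⟨z, rfl⟩ := cls_surjective n x
  obtain ⟨c, hc⟩ := h.exists_isConnecting z
  exact (congrArg (φ M'' (n + 1)) (connH_cls h hc)).trans (hφ.connecting h hc)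

/-- Every cocycle of degree zero comes from a morphism, so `degree_zero` fixes both families there;
effaceability propagates the equality to all degrees. -/
theorem IsDeltaMap.eq
    {φ ψ : ∀ (M : HopfBimodule k A) (n : ℕ), HA4 M N n →ₗ[k] Ext (toX M) (toX N) n}
    (hφ : IsDeltaMap N φ) (hψ : IsDeltaMap N ψ) (M : HopfBimodule k A) (n : ℕ) : φ M n = ψ M n :=
  eq_of_isCompatible (T := cohDelta N) (T' := extDelta N) (φ := fun n M => φ M n)
    (ψ := fun n M => ψ M n) hφ.isCompatible hψ.isCompatible (fun M => LinearMap.ext fun x => by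
      obtain ⟨z, rfl⟩ := cls_surjective 0 x
      obtain ⟨β, rfl⟩ := exists_unitCocycle_eq z
      exact (hφ.degree_zero β).trans (hψ.degree_zero β).symm) n M

variable (N) in
-- The degree zero isomorphism is natural, so it extends by dimension shifting, and bijectivity is
-- inherited in each degree.
theorem exists_comparison : ∃ φ : ∀ (M : HopfBimodule k A) (n : ℕ),
    HA4 M N n ≃ₗ[k] Ext (toX M) (toX N) n, IsDeltaMap N fun M n => (φ M n).toLinearMap := by
  obtain ⟨φ, h0, h1, h2⟩ := exists_extension (T := cohDelta N) (T' := extDelta N)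
    (fun M => (comparisonZero M N).toLinearMap) fun f x => comparisonZero_natural f x
  have hb := bijective h1 h2 fun M => by
    rw [h0]
    exact (comparisonZero M N).bijective
  refine ⟨fun M n => LinearEquiv.ofBijective (φ n M) (hb n M), fun f n x => h1 n f x,
    fun {M} β => ?_, fun {M' M M'' i p} h {n z c} hc => ?_⟩
  · change φ 0 M (cls (unitCocycle β)) = Ext.mk₀ (toXMap β)
    rw [h0]
    exact comparisonZero_unitEquiv β
  · exact (congrArg (φ (n + 1) M'') (connH_cls h hc)).symm.trans (h2 n h (cls z))

variable (N) in
/-- The isomorphism of `δ`-functors `H_{A4}^*(-, N) → Ext_X^*(-, N)`. -/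
noncomputable def comparison (M : HopfBimodule k A) (n : ℕ) :
    HA4 M N n ≃ₗ[k] Ext (toX M) (toX N) n :=
  (exists_comparison N).choose M n

variable (N) in
theorem isDeltaMap_comparison : IsDeltaMap N fun M n => (comparison N M n).toLinearMap :=
  (exists_comparison N).choose_spec

/-- In degree one a map of `δ`-functors sends a cocycle to the extension that it defines. -/
theorem IsDeltaMap.cls_eq_extensionClass
    {φ : ∀ (M : HopfBimodule k A) (n : ℕ), HA4 M N n →ₗ[k] Ext (toX M) (toX N) n}
    (hφ : IsDeltaMap N φ) {M : HopfBimodule k A} (F : Cocycle M N 1) :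
    φ M 1 (cls F) = extensionClass F := by
  refine (hφ.connecting (cocycleExtData F).isShortExact (isConnecting_cocycleExtData F)).trans ?_
  -- The cocycle is the connecting image of the identity of `N`, so its image is the Yoneda product
  -- of the extension class with the identity.
  rw [hφ.degree_zero, toXMap_id, Ext.comp_mk₀_id]
  rfl

end Comparison

end HopfBimod

theorem mainTheorem6 {k A : Type u} [Field k] [Ring A] [HopfAlgebra k A] [FiniteDimensional k A]
    (N : HopfBimod.HopfBimodule k A) :
    -- the connecting maps of `H_{A4}^*(-, N)` are defined everywhere and single valued
    (∀ {M' M M'' : HopfBimod.HopfBimodule k A} {i : HopfBimod.HomA4 M' M}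
      {p : HopfBimod.HomA4 M M''}, HopfBimod.IsShortExact i p →
      ∀ (n : ℕ) (x : HopfBimod.HA4 M' N n), ∃! y : HopfBimod.HA4 M'' N (n + 1),
        ∃ z c, HopfBimod.cls z = x ∧ HopfBimod.cls c = y ∧ HopfBimod.IsConnecting i p z c) ∧
    ∃ φ : ∀ (M : HopfBimod.HopfBimodule k A) (n : ℕ),
      HopfBimod.HA4 M N n ≃ₗ[k] Ext (HopfBimod.toX M) (HopfBimod.toX N) n,
      -- `φ` is the unique map of `δ`-functors that extends the identity in degree zero
      HopfBimod.IsDeltaMap N (fun M n => (φ M n).toLinearMap) ∧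
      (∀ φ', HopfBimod.IsDeltaMap N φ' → ∀ M n, φ' M n = (φ M n).toLinearMap) ∧
      -- the map from cocycles to extensions induces an isomorphism `ψ`, and it is `φ` in degree one
      ∀ M : HopfBimod.HopfBimodule k A,
        ∃ ψ : HopfBimod.HA4 M N 1 ≃ₗ[k] Ext (HopfBimod.toX M) (HopfBimod.toX N) 1,
          (∀ F : HopfBimod.Cocycle M N 1, ψ (HopfBimod.cls F) = HopfBimod.extensionClass F) ∧
          ψ = φ M 1 := by
  -- The map `ψ` is taken to be the degree one comparison itself. The formula on cocycles then shows
  -- that the extension class depends only on the cohomology class, and that the resulting map is a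
  -- linear isomorphism.
  refine ⟨fun h n x => ?_, HopfBimod.comparison N, HopfBimod.isDeltaMap_comparison N,
    fun φ' h' M n => h'.eq (HopfBimod.isDeltaMap_comparison N) M n,
    fun M => ⟨HopfBimod.comparison N M 1, fun F => ?_, rfl⟩⟩
  · obtain ⟨z, rfl⟩ := HopfBimod.cls_surjective n x
    obtain ⟨c, hc⟩ := h.exists_isConnecting z
    refine ⟨HopfBimod.cls c, ⟨z, c, rfl, rfl, hc⟩, ?_⟩
    rintro _ ⟨z', c', hz, rfl, hc'⟩
    exact HopfBimod.cls_eq_cls_of_isConnecting h hc' hc hz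
  · exact (HopfBimod.isDeltaMap_comparison N).cls_eq_extensionClass F
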